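/- **Relative energy inequality.** Setting. Let $d\in\{2,3\}$, $T>0$, $I=(0,T)$, let $\Omega\subset\mathbb R^d$ be a bounded Lipschitz domain with outer unit normal $\mathbf n$ and surface measure $dS_x$, and let $\mu>0$, $\lambda+\frac2d\mu>0$, $\mathbb S(A)=\mu(A+A^T)+\lambda\,\mathrm{tr}(A)\,\mathbb I$. Let $0<\underline b<\overline b<\infty$, $\mathcal O=\{(R,Z):\underline bR<Z<\overline bR\}$, and let $\mathcal D$ be a set of the form $\mathcal D=\{(R,Z): R>0,\ Z/R\in J\}$ with $(\underline b,\overline b)\subset J\subset[\underline b,\overline b]$ (so $\mathcal D$ is $\mathcal O$ together with none, one or both of its open boundary rays). Let $P\in C^1(\overline{\mathcal O})\cap C^2(\mathcal D)$ (derivatives up to the points of the boundary that belong to the set), $P(0,0)=0$, and $$H(R,Z)=R\int_1^R \frac{P(s,sZ/R)}{s^2}\,ds\quad (R>0),\qquad H(0,Z)=0 .$$ Let $\mathbf u_B\in C^1_c(\mathbb R^d;\mathbb R^d)$, let $R_B,Z_B\in C_c(\mathbb R^d)$ be nonnegative with $(R_B,Z_B)\in\overline{\mathcal O}$, $\Gamma^{\rm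 in}=\{x\in\partial\Omega:\mathbf u_B\cdot\mathbf n<0\}$, $\Gamma^{\rm out}=\partial\Omega\setminus\Gamma^{\rm in}$, and let $R_0,Z_0,\mathbf u_0$ be initial data of finite energy, $\frac12(R_0+Z_0)|\mathbf u_0|^2+H(R_0,Z_0)\in L^1(\Omega)$. For vectors and matrices, $(\nabla \mathbf v)_{ij}=\partial_jv_i$, $\mathbf v\cdot\nabla\mathbf U\cdot\mathbf w=\sum_{i,j}v_j\,\partial_jU_i\,w_i$, and $[f]_{t=0}^{t=\tau}=f(\tau)-f(0)$. A triple $(R,Z,\mathbf u)$ is a *dissipative turbulent solution*, with Reynolds defect $\mathfrak R$ and energy defect $\mathfrak E$, if for some $\gamma>1$: $R,Z\ge0$; $R,Z\in C_{\rm weak}([0,T];L^\gamma(\Omega))\cap L^\gamma(0,T;L^\gamma(\partial\Omega;|\mathbf u_B\cdot\mathbf n|dS_x))$ (the values on $\partial\Omega$ being part of the unknown); $\mathbf u-\mathbf u_B\in L^2(I;W^{1,2}_0(\Omega;\mathbb R^d))$; $(R+Z)\mathbf u$ has a representative in $C_{\rm weak}([0,T];L^{2\gamma/(\gamma+1)}(\Omega;\mathbb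 R^d))$, which is used wherever $(R+Z)\mathbf u$ is evaluated at a given time; $P(R,Z)$, $H(R,Z)$, $(R+Z)\mathbf u\otimes\mathbf u\in L^1(I\times\Omega)$ and $H(R,Z)\in L^1(I;L^1(\partial\Omega;|\mathbf u_B\cdot\mathbf n|dS_x))$; and 1. for $r=R$ and $r=Z$ (with $r_B=R_B,Z_B$), all $\tau\in[0,T]$ and $\varphi\in C^1([0,T]\times\overline\Omega)$, with $r(0)=r_0$, $$\Big[\int_\Omega r\varphi\,dx\Big]_{0}^{\tau}+\int_0^\tau\!\!\int_{\Gamma^{\rm out}}\varphi r\,\mathbf u_B\cdot\mathbf n\,dS_xdt+\int_0^\tau\!\!\int_{\Gamma^{\rm in}}\varphi r_B\,\mathbf u_B\cdot\mathbf n\,dS_xdt=\int_0^\tau\!\!\int_\Omega (r\partial_t\varphi+r\mathbf u\cdot\nabla\varphi)\,dxdt;$$ 2. $\mathfrak R\in L^\infty_{\text{weak-}*}(0,T;\mathcal M^+(\overline\Omega;\mathbb R^{d\times d}_{\rm sym}))$ (symmetric positive semidefinite matrices of finite signed measures) and, for all $\tau\in[0,T]$ and $\boldsymbol\varphi\in C^1([0,T]\times\overline\Omega;\mathbb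 R^d)$ with $\boldsymbol\varphi|_{\partial\Omega}=0$, with $(R+Z)\mathbf u(0)=(R_0+Z_0)\mathbf u_0$, $$\Big[\int_\Omega (R+Z)\mathbf u\cdot\boldsymbol\varphi\,dx\Big]_0^\tau=\int_0^\tau\!\!\int_\Omega\big[(R+Z)\mathbf u\cdot\partial_t\boldsymbol\varphi+(R+Z)\mathbf u\otimes\mathbf u:\nabla\boldsymbol\varphi+P(R,Z)\,\mathrm{div}\boldsymbol\varphi-\mathbb S(\nabla\mathbf u):\nabla\boldsymbol\varphi\big]dxdt+\int_0^\tau\!\!\int_{\overline\Omega}\nabla\boldsymbol\varphi:d\mathfrak R(t)\,dt;$$ 3. $\mathfrak E\in L^\infty_{\text{weak-}*}(0,T;\mathcal M^+(\overline\Omega))$ and, for a.a. $\tau\in(0,T)$ (with $R_0,Z_0,\mathbf u_0$ at $t=0$), $$\begin{aligned}&\Big[\int_\Omega \tfrac12(R+Z)|\mathbf u-\mathbf u_B|^2+H(R,Z)\,dx\Big]_0^\tau+\int_0^\tau\!\!\int_\Omega\mathbb S(\nabla\mathbf u):\nabla\mathbf u\,dxdt+\int_0^\tau\!\!\int_{\Gamma^{\rm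 out}}H(R,Z)\mathbf u_B\cdot\mathbf n\,dS_xdt\\&+\int_0^\tau\!\!\int_{\Gamma^{\rm in}}H(R_B,Z_B)\mathbf u_B\cdot\mathbf n\,dS_xdt+\int_{\overline\Omega}d\mathfrak E(\tau)\le-\int_0^\tau\!\!\int_\Omega[(R+Z)\mathbf u\otimes\mathbf u+P(R,Z)\mathbb I]:\nabla\mathbf u_B\,dxdt\\&+\int_0^\tau\!\!\int_\Omega(R+Z)\mathbf u\cdot\nabla\mathbf u_B\cdot\mathbf u_B\,dxdt+\int_0^\tau\!\!\int_\Omega\mathbb S(\nabla\mathbf u):\nabla\mathbf u_B\,dxdt-\int_0^\tau\!\!\int_{\overline\Omega}\nabla\mathbf u_B:d\mathfrak R(t)\,dt;\end{aligned}$$ 4. $\underline d\,\mathfrak E\le\mathrm{tr}\,\mathfrak R\le\overline d\,\mathfrak E$ for some constants $0<\underline d\le\overline d$. The relative energy is $$\mathcal E(R,Z,\mathbf u\,|\,\mathfrak r,\mathfrak z,\mathfrak u)=\tfrac12(R+Z)|\mathbf u-\mathfrak u|^2+H(R,Z)-\partial_RH(\mathfrak r,\mathfrak z)(R-\mathfrak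 r)-\partial_ZH(\mathfrak r,\mathfrak z)(Z-\mathfrak z)-H(\mathfrak r,\mathfrak z).$$ Theorem. Let $(R,Z,\mathbf u)$ be a dissipative turbulent solution with defects $\mathfrak R,\mathfrak E$, and let $\mathfrak r,\mathfrak z\in C^1([0,T]\times\overline\Omega)$, $\mathfrak u\in C^1([0,T]\times\overline\Omega;\mathbb R^d)$ satisfy $(\mathfrak r,\mathfrak z)\in\mathcal D$ (so in particular $(\mathfrak r,\mathfrak z)\in\overline{\mathcal O}$), $\inf\mathfrak z>0$ and $\mathfrak u|_{\partial\Omega}=\mathbf u_B|_{\partial\Omega}$. Then the relative energy is integrable over $\Omega$ at $t=0$ (with $R_0,Z_0,\mathbf u_0$) and at a.a. $t\in(0,T)$, and for a.a. $\tau\in(0,T)$ $$\begin{aligned} &\Big[\int_\Omega\mathcal E(R,Z,\mathbf u|\mathfrak r,\mathfrak z,\mathfrak u)\,dx\Big]_{t=0}^{t=\tau}+\int_0^\tau\!\!\int_\Omega\mathbb S(\nabla\mathbf u):\nabla(\mathbf u-\mathfrak u)\,dxdt\\ &+\int_0^\tau\!\!\int_{\Gamma^{\rm out}}\big[H(R,Z)-\partial_RH(\mathfrak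 r,\mathfrak z)(R-\mathfrak r)-\partial_ZH(\mathfrak r,\mathfrak z)(Z-\mathfrak z)-H(\mathfrak r,\mathfrak z)\big]\mathbf u_B\cdot\mathbf n\,dS_xdt\\ &+\int_0^\tau\!\!\int_{\Gamma^{\rm in}}\big[H(R_B,Z_B)-\partial_RH(\mathfrak r,\mathfrak z)(R_B-\mathfrak r)-\partial_ZH(\mathfrak r,\mathfrak z)(Z_B-\mathfrak z)-H(\mathfrak r,\mathfrak z)\big]\mathbf u_B\cdot\mathbf n\,dS_xdt+\int_{\overline\Omega}d\mathfrak E(\tau)\\ \le{}&-\int_0^\tau\!\!\int_\Omega(R+Z)(\mathfrak u-\mathbf u)\cdot\nabla\mathfrak u\cdot(\mathfrak u-\mathbf u)\,dxdt\\ &-\int_0^\tau\!\!\int_\Omega\big[P(R,Z)-\partial_RP(\mathfrak r,\mathfrak z)(R-\mathfrak r)-\partial_ZP(\mathfrak r,\mathfrak z)(Z-\mathfrak z)-P(\mathfrak r,\mathfrak z)\big]\mathrm{div}\,\mathfrak u\,dxdt\\ &+\int_0^\tau\!\!\int_\Omega\Big(\frac{R+Z}{\mathfrak r+\mathfrak z}-1\Big)(\mathfrak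 u-\mathbf u)\cdot\big[\partial_t((\mathfrak r+\mathfrak z)\mathfrak u)+\mathrm{div}((\mathfrak r+\mathfrak z)\mathfrak u\otimes\mathfrak u)\big]dxdt\\ &+\int_0^\tau\!\!\int_\Omega(\mathfrak u-\mathbf u)\cdot\big[\partial_t((\mathfrak r+\mathfrak z)\mathfrak u)+\mathrm{div}((\mathfrak r+\mathfrak z)\mathfrak u\otimes\mathfrak u)+\nabla P(\mathfrak r,\mathfrak z)\big]dxdt\\ &+\int_0^\tau\!\!\int_\Omega(R-\mathfrak r)(\mathfrak u-\mathbf u)\cdot\big(\nabla\mathfrak r\,\partial_R^2H(\mathfrak r,\mathfrak z)+\nabla\mathfrak z\,\partial_R\partial_ZH(\mathfrak r,\mathfrak z)\big)dxdt\\ &+\int_0^\tau\!\!\int_\Omega(Z-\mathfrak z)(\mathfrak u-\mathbf u)\cdot\big(\nabla\mathfrak z\,\partial_Z^2H(\mathfrak r,\mathfrak z)+\nabla\mathfrak r\,\partial_R\partial_ZH(\mathfrak r,\mathfrak z)\big)dxdt\\ &+\int_0^\tau\!\!\int_\Omega\Big[\frac{R+Z}{\mathfrak r+\mathfrak z}(\mathbf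 u-\mathfrak u)\cdot\mathfrak u+\partial_RP(\mathfrak r,\mathfrak z)-R\,\partial_R^2H(\mathfrak r,\mathfrak z)-Z\,\partial_R\partial_ZH(\mathfrak r,\mathfrak z)\Big]\big[\partial_t\mathfrak r+\mathrm{div}(\mathfrak r\mathfrak u)\big]dxdt\\ &+\int_0^\tau\!\!\int_\Omega\Big[\frac{R+Z}{\mathfrak r+\mathfrak z}(\mathbf u-\mathfrak u)\cdot\mathfrak u+\partial_ZP(\mathfrak r,\mathfrak z)-Z\,\partial_Z^2H(\mathfrak r,\mathfrak z)-R\,\partial_R\partial_ZH(\mathfrak r,\mathfrak z)\Big]\big[\partial_t\mathfrak z+\mathrm{div}(\mathfrak z\mathfrak u)\big]dxdt\\ &-\int_0^\tau\!\!\int_{\overline\Omega}\nabla\mathfrak u:d\mathfrak R(t)\,dt . \end{aligned}$$ -/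

import Mathlib

open MeasureTheory Set Filter Topology
open scoped ENNReal NNReal ContDiff

noncomputable section

namespace Bifluid

/-- Euclidean space of dimension `d`. -/
abbrev E (d : ℕ) := EuclideanSpace ℝ (Fin d)

/-- Square matrices of size `d`. -/
abbrev Mat (d : ℕ) := Matrix (Fin d) (Fin d) ℝ

/-! ### Geometry of the domain -/

/-- Bounded Lipschitz domain: a bounded, connected, nonempty open set which, near each of its
boundary points, is the part above the graph of a Lipschitz function of the `d - 1` coordinates
orthogonal to some unit direction `e`. -/
structure IsBoundedLipschitzDomain {d : ℕ} (Ω : Set (E d)) : Prop where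
  isOpen : IsOpen Ω
  isConnected : IsConnected Ω
  isBounded : Bornology.IsBounded Ω
  graph : ∀ x₀ ∈ frontier Ω, ∃ ρ > (0 : ℝ), ∃ e : E d, ‖e‖ = 1 ∧
    ∃ (K : ℝ≥0) (g : E d → ℝ), LipschitzWith K g ∧
      ∀ x ∈ Metric.ball x₀ ρ, x ∈ Ω ↔ g (x - inner ℝ e x • e) < inner ℝ e x

/-- `n` is the outer unit normal to `Ω` at `x`: seen from `x`, the set `Ω` is, up to an error
`o(|y - x|)`, the half space `⟪n, y - x⟫ < 0`. There is at most one such `n`. -/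
def IsOuterNormal {d : ℕ} (Ω : Set (E d)) (x n : E d) : Prop :=
  ‖n‖ = 1 ∧ ∀ ε > (0 : ℝ), ∀ᶠ y in 𝓝 x,
    (inner ℝ n (y - x) < -(ε * ‖y - x‖) → y ∈ Ω) ∧
    (ε * ‖y - x‖ < inner ℝ n (y - x) → y ∉ closure Ω)

open Classical in
/-- The outer unit normal; on a Lipschitz boundary it exists at almost every point, and the value
at the remaining points is `0`. -/
def outerNormal {d : ℕ} (Ω : Set (E d)) (x : E d) : E d :=
  if h : ∃ n, IsOuterNormal Ω x n then h.choose else 0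

/-- The surface measure `dS` on `∂Ω`: `(d-1)`-dimensional Hausdorff measure, normalised so that it
is Lebesgue measure on hyperplanes. -/
def surfaceMeasure {d : ℕ} (Ω : Set (E d)) : Measure (E d) :=
  (Measure.euclideanHausdorffMeasure (d - 1) : Measure (E d)).restrict (frontier Ω)

/-! ### Differential operators on the closed space-time cylinder

Derivatives are taken within `[0,T]` and within `closure Ω`; in the interior they are the ordinary
ones, and on the boundary they are the continuous extensions. -/

/-- `φ ∈ C¹([0,T] × closure Ω)`. -/
def IsC1 {d : ℕ} (T : ℝ) (Ω : Set (E d)) {F : Type*} [NormedAddCommGroup F] [NormedSpace ℝ F]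
    (φ : ℝ → E d → F) : Prop :=
  ContDiffOn ℝ 1 (fun p : ℝ × E d => φ p.1 p.2) (Icc 0 T ×ˢ closure Ω)

/-- Time derivative `∂ₜ φ (t,x)`. -/
def dt {d : ℕ} (T : ℝ) {F : Type*} [NormedAddCommGroup F] [NormedSpace ℝ F]
    (φ : ℝ → E d → F) (t : ℝ) (x : E d) : F :=
  derivWithin (fun s => φ s x) (Icc 0 T) t

/-- Partial derivative `∂_j f (x)`. -/
def pd {d : ℕ} (Ω : Set (E d)) (j : Fin d) (f : E d → ℝ) (x : E d) : ℝ :=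
  fderivWithin ℝ f (closure Ω) x (EuclideanSpace.single j 1)

/-- Gradient of a scalar field. -/
def grad {d : ℕ} (Ω : Set (E d)) (f : E d → ℝ) (x : E d) : E d :=
  WithLp.toLp 2 fun j => pd Ω j f x

/-- Gradient of a vector field, `(∇v)_{ij} = ∂_j v_i`. -/
def jac {d : ℕ} (Ω : Set (E d)) (v : E d → E d) (x : E d) : Mat d :=
  Matrix.of fun i j => pd Ω j (fun y => v y i) x

/-- Divergence of a vector field. -/
def div {d : ℕ} (Ω : Set (E d)) (v : E d → E d) (x : E d) : ℝ :=
  ∑ j, pd Ω j (fun y => v y j) x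

/-- Divergence of a tensor field, `(div A)_i = ∑_j ∂_j A_{ij}`. -/
def divTensor {d : ℕ} (Ω : Set (E d)) (A : E d → Mat d) (x : E d) : E d :=
  WithLp.toLp 2 fun i => ∑ j, pd Ω j (fun y => A y i j) x

/-- `v ⊗ w`. -/
def outer {d : ℕ} (v w : E d) : Mat d := Matrix.of fun i j => v i * w j

/-- `A : B`. -/
def frob {d : ℕ} (A B : Mat d) : ℝ := ∑ i, ∑ j, A i j * B i j

/-- `v · ∇U · w = ∑ v_j ∂_j U_i w_i`, where `A = ∇U`. -/
def convect {d : ℕ} (v : E d) (A : Mat d) (w : E d) : ℝ := ∑ i, ∑ j, v j * A i j * w i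

/-- Newtonian stress `𝕊(A) = μ (A + Aᵀ) + λ tr(A) 𝕀`. -/
def stress {d : ℕ} (mu lam : ℝ) (A : Mat d) : Mat d :=
  mu • (A + A.transpose) + (lam * A.trace) • (1 : Mat d)

/-! ### Constitutive functions -/

/-- The open cone `𝒪 = {b₁ R < Z < b₂ R}` in the `(R,Z)` plane. -/
def coneO (b₁ b₂ : ℝ) : Set (ℝ × ℝ) := {p | b₁ * p.1 < p.2 ∧ p.2 < b₂ * p.1}

/-- The points `(R,Z)` with `R > 0` and slope `Z / R` in `J`. -/
def slopeCone (J : Set ℝ) : Set (ℝ × ℝ) := {p | 0 < p.1 ∧ p.2 / p.1 ∈ J}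

/-- The Helmholtz function `H(R,Z) = R ∫₁ᴿ P(s, s Z / R) / s² ds`, with `H(0,Z) = 0`. -/
def helmholtz (P : ℝ × ℝ → ℝ) (p : ℝ × ℝ) : ℝ :=
  p.1 * ∫ s in (1 : ℝ)..p.1, P (s, s * (p.2 / p.1)) / s ^ 2

/-- `∂_R F` for a function `F` on the closed cone `K`. -/
def dR (K : Set (ℝ × ℝ)) (F : ℝ × ℝ → ℝ) (p : ℝ × ℝ) : ℝ := fderivWithin ℝ F K p (1, 0)

/-- `∂_Z F` for a function `F` on the closed cone `K`. -/
def dZ (K : Set (ℝ × ℝ)) (F : ℝ × ℝ → ℝ) (p : ℝ × ℝ) : ℝ := fderivWithin ℝ F K p (0, 1)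

/-- `F(R,Z) - ∂_R F(r,z) (R - r) - ∂_Z F(r,z) (Z - z) - F(r,z)`. -/
def bregman (K : Set (ℝ × ℝ)) (F : ℝ × ℝ → ℝ) (R Z r z : ℝ) : ℝ :=
  F (R, Z) - dR K F (r, z) * (R - r) - dZ K F (r, z) * (Z - z) - F (r, z)

/-! ### The initial-boundary value problem -/

/-- The data of the bi-fluid problem. -/
structure Data (d : ℕ) where
  /-- final time -/
  T : ℝ
  /-- domain -/
  Ω : Set (E d)
  /-- shear viscosity -/
  mu : ℝ
  /-- second viscosity coefficient -/
  lam : ℝ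
  /-- lower slope of the cone -/
  b₁ : ℝ
  /-- upper slope of the cone -/
  b₂ : ℝ
  /-- pressure -/
  P : ℝ × ℝ → ℝ
  /-- boundary velocity -/
  uB : E d → E d
  /-- boundary density of the first species -/
  RB : E d → ℝ
  /-- boundary density of the second species -/
  ZB : E d → ℝ
  /-- initial density of the first species -/
  R0 : E d → ℝ
  /-- initial density of the second species -/
  Z0 : E d → ℝ
  /-- initial velocity -/
  u0 : E d → E d

namespace Data

variable {d : ℕ} (D : Data d)

/-- `H`. -/
def H : ℝ × ℝ → ℝ := helmholtz D.P

/-- The closure of `𝒪`. -/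
def K : Set (ℝ × ℝ) := closure (coneO D.b₁ D.b₂)

/-- `u_B · n` on `∂Ω`. -/
def flux (x : E d) : ℝ := inner ℝ (D.uB x) (outerNormal D.Ω x)

/-- The inflow boundary. -/
def inflow : Set (E d) := {x ∈ frontier D.Ω | D.flux x < 0}

/-- The outflow boundary. -/
def outflow : Set (E d) := frontier D.Ω \ D.inflow

/-- `𝕊(A)`. -/
def S (A : Mat d) : Mat d := stress D.mu D.lam A

/-- Lebesgue measure on the time interval `(0,T)`. -/
def timeMeasure : Measure ℝ := volume.restrict (Ioo 0 D.T)

/-- Lebesgue measure on `(0,T) × Ω`. -/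
def cylMeasure : Measure (ℝ × E d) := D.timeMeasure.prod (volume.restrict D.Ω)

/-- The measure `|u_B · n| dS` on `∂Ω`. -/
def fluxMeasure : Measure (E d) :=
  (surfaceMeasure D.Ω).withDensity fun x => ENNReal.ofReal |D.flux x|

/-- The measure `|u_B · n| dS dt` on `(0,T) × ∂Ω`. -/
def latMeasure : Measure (ℝ × E d) := D.timeMeasure.prod D.fluxMeasure

/-- Total energy density `½ (R+Z) |u|² + H(R,Z)`. -/
def energyDensity (R Z : ℝ) (u : E d) : ℝ := 1 / 2 * (R + Z) * ‖u‖ ^ 2 + D.H (R, Z)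

/-- Relative energy density `ℰ(R, Z, u | r, z, v)`. -/
def relEnergy (R Z : ℝ) (u : E d) (r z : ℝ) (v : E d) : ℝ :=
  1 / 2 * (R + Z) * ‖u - v‖ ^ 2 + bregman D.K D.H R Z r z

/-- The conditions on time, viscosities and cone under which the problem is posed, on the boundary
data, and finiteness of the initial energy. Nothing is asked here of the domain and the pressure. -/
structure Admissible : Prop where
  T_pos : 0 < D.T
  mu_pos : 0 < D.mu
  lam_pos : 0 < D.lam + 2 / d * D.mu
  b₁_pos : 0 < D.b₁
  b₁_lt_b₂ : D.b₁ < D.b₂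
  uB_smooth : ContDiff ℝ 1 D.uB
  uB_supp : HasCompactSupport D.uB
  RB_cont : Continuous D.RB
  RB_supp : HasCompactSupport D.RB
  RB_nonneg : ∀ x, 0 ≤ D.RB x
  ZB_cont : Continuous D.ZB
  ZB_supp : HasCompactSupport D.ZB
  ZB_nonneg : ∀ x, 0 ≤ D.ZB x
  B_mem : ∀ x, (D.RB x, D.ZB x) ∈ D.K
  finite_energy :
    Integrable (fun x => D.energyDensity (D.R0 x) (D.Z0 x) (D.u0 x)) (volume.restrict D.Ω)

end Data

/-! ### Function spaces -/

/-- `f ∈ C_weak([0,T]; L^p(Ω))`, for `1 < p < ∞`. -/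
def IsWeaklyContinuous {d : ℕ} (T : ℝ) (Ω : Set (E d)) (p : ℝ) {F : Type*}
    [NormedAddCommGroup F] [InnerProductSpace ℝ F] (f : ℝ → E d → F) : Prop :=
  (∀ t ∈ Icc 0 T, MemLp (f t) (ENNReal.ofReal p) (volume.restrict Ω)) ∧
  (∃ C : ℝ≥0, ∀ᵐ t ∂(volume.restrict (Ioo 0 T)),
    eLpNorm (f t) (ENNReal.ofReal p) (volume.restrict Ω) ≤ C) ∧
  ∀ η : E d → F, MemLp η (ENNReal.ofReal (p / (p - 1))) (volume.restrict Ω) →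
    ContinuousOn (fun t => ∫ x in Ω, inner ℝ (η x) (f t x)) (Icc 0 T)

/-- `v ∈ W₀^{1,2}(Ω; ℝ^d)` with weak gradient `G`: limit in `W^{1,2}` of smooth fields with compact
support in `Ω`. -/
def IsW120 {d : ℕ} (Ω : Set (E d)) (v : E d → E d) (G : E d → Mat d) : Prop :=
  MemLp v 2 (volume.restrict Ω) ∧
  (∀ i j, MemLp (fun x => G x i j) 2 (volume.restrict Ω)) ∧
  ∃ φ : ℕ → E d → E d,
    (∀ n, ContDiff ℝ ∞ (φ n) ∧ HasCompactSupport (φ n) ∧ tsupport (φ n) ⊆ Ω) ∧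
    Tendsto (fun n => eLpNorm (fun x => φ n x - v x) 2 (volume.restrict Ω)) atTop (𝓝 0) ∧
    ∀ i j, Tendsto (fun n => eLpNorm (fun x => jac Ω (φ n) x i j - G x i j) 2
      (volume.restrict Ω)) atTop (𝓝 0)

/-! ### Defect measures -/

/-- `∫_{closure Ω} A : dM` for a matrix `M` of signed measures. -/
def pairing {d : ℕ} (Ω : Set (E d)) (A : E d → Mat d) (M : Fin d → Fin d → SignedMeasure (E d)) :
    ℝ :=
  ∑ i, ∑ j, ∫ᵛ x in closure Ω, A x i j ∂<•(M i j)

/-- `M ∈ L^∞(0,T; 𝓜⁺(closure Ω; ℝ^{d×d}_sym))`: for almost every time a symmetric, positive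
semidefinite matrix of finite signed measures on `closure Ω`; weakly-* measurable and essentially
bounded in time. -/
structure IsTensorDefect {d : ℕ} (T : ℝ) (Ω : Set (E d))
    (M : ℝ → Fin d → Fin d → SignedMeasure (E d)) : Prop where
  supp : ∀ᵐ t ∂(volume.restrict (Ioo 0 T)), ∀ i j, ∀ A, MeasurableSet A →
    Disjoint A (closure Ω) → M t i j A = 0
  symm : ∀ᵐ t ∂(volume.restrict (Ioo 0 T)), ∀ i j, M t i j = M t j i
  nonneg : ∀ᵐ t ∂(volume.restrict (Ioo 0 T)), ∀ ξ : Fin d → ℝ, ∀ A, MeasurableSet A →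
    0 ≤ ∑ i, ∑ j, ξ i * ξ j * M t i j A
  measurable : ∀ i j, ∀ φ : E d → ℝ, Continuous φ →
    AEMeasurable (fun t => ∫ᵛ x in closure Ω, φ x ∂<•(M t i j)) (volume.restrict (Ioo 0 T))
  bounded : ∃ C : ℝ≥0, ∀ᵐ t ∂(volume.restrict (Ioo 0 T)), ∀ i j,
    (M t i j).totalVariation univ ≤ C

/-- `m ∈ L^∞(0,T; 𝓜⁺(closure Ω))`. -/
structure IsScalarDefect {d : ℕ} (T : ℝ) (Ω : Set (E d)) (m : ℝ → Measure (E d)) : Prop where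
  supp : ∀ᵐ t ∂(volume.restrict (Ioo 0 T)), m t (closure Ω)ᶜ = 0
  measurable : ∀ φ : E d → ℝ, Continuous φ →
    AEMeasurable (fun t => ∫ x in closure Ω, φ x ∂(m t)) (volume.restrict (Ioo 0 T))
  bounded : ∃ C : ℝ≥0, ∀ᵐ t ∂(volume.restrict (Ioo 0 T)), m t univ ≤ C

/-! ### Dissipative turbulent solutions -/

/-- Integral form of the continuity equation for the density `r` with boundary value `rB` and
initial value `r0`. The values of `r (t, ·)` on `∂Ω` are those of the boundary density. -/
def ContinuityEq {d : ℕ} (D : Data d) (r : ℝ → E d → ℝ) (rB r0 : E d → ℝ)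
    (u : ℝ → E d → E d) : Prop :=
  ∀ φ : ℝ → E d → ℝ, IsC1 D.T D.Ω φ → ∀ τ ∈ Icc 0 D.T,
    (∫ x in D.Ω, r τ x * φ τ x) - (∫ x in D.Ω, r0 x * φ 0 x)
      + (∫ t in (0 : ℝ)..τ, ∫ x in D.outflow, φ t x * r t x * D.flux x ∂(surfaceMeasure D.Ω))
      + (∫ t in (0 : ℝ)..τ, ∫ x in D.inflow, φ t x * rB x * D.flux x ∂(surfaceMeasure D.Ω))
    = ∫ t in (0 : ℝ)..τ, ∫ x in D.Ω,
        (r t x * dt D.T φ t x + r t x * inner ℝ (u t x) (grad D.Ω (φ t) x))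

/-- `(R, Z, u)` is a dissipative turbulent solution with exponent `γ`, velocity gradient
`Du = ∇u`, weakly continuous momentum `m = (R+Z) u`, Reynolds defect `Rey` and energy defect `En`.
-/
structure IsDissipativeTurbulentSolution {d : ℕ} (D : Data d) (γ : ℝ)
    (R Z : ℝ → E d → ℝ) (u : ℝ → E d → E d) (Du : ℝ → E d → Mat d) (m : ℝ → E d → E d)
    (Rey : ℝ → Fin d → Fin d → SignedMeasure (E d)) (En : ℝ → Measure (E d)) : Prop where
  one_lt_gamma : 1 < γ
  -- regularity class
  R_meas : AEStronglyMeasurable (fun p : ℝ × E d => R p.1 p.2) D.cylMeasure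
  Z_meas : AEStronglyMeasurable (fun p : ℝ × E d => Z p.1 p.2) D.cylMeasure
  R_weak : IsWeaklyContinuous D.T D.Ω γ R
  Z_weak : IsWeaklyContinuous D.T D.Ω γ Z
  R_bdry : MemLp (fun p : ℝ × E d => R p.1 p.2) (ENNReal.ofReal γ) D.latMeasure
  Z_bdry : MemLp (fun p : ℝ × E d => Z p.1 p.2) (ENNReal.ofReal γ) D.latMeasure
  nonneg : ∀ᵐ p ∂D.cylMeasure, 0 ≤ R p.1 p.2 ∧ 0 ≤ Z p.1 p.2
  nonneg_bdry : ∀ᵐ p ∂D.latMeasure, 0 ≤ R p.1 p.2 ∧ 0 ≤ Z p.1 p.2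
  u_memLp : MemLp (fun p : ℝ × E d => u p.1 p.2) 2 D.cylMeasure
  Du_memLp : ∀ i j, MemLp (fun p : ℝ × E d => Du p.1 p.2 i j) 2 D.cylMeasure
  u_sobolev : ∀ᵐ t ∂D.timeMeasure,
    IsW120 D.Ω (fun x => u t x - D.uB x) (fun x => Du t x - jac D.Ω D.uB x)
  m_eq : ∀ᵐ t ∂D.timeMeasure, ∀ᵐ x ∂(volume.restrict D.Ω), m t x = (R t x + Z t x) • u t x
  m_weak : IsWeaklyContinuous D.T D.Ω (2 * γ / (γ + 1)) m
  P_int : Integrable (fun p : ℝ × E d => D.P (R p.1 p.2, Z p.1 p.2)) D.cylMeasure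
  H_int : Integrable (fun p : ℝ × E d => D.H (R p.1 p.2, Z p.1 p.2)) D.cylMeasure
  H_bdry : Integrable (fun p : ℝ × E d => D.H (R p.1 p.2, Z p.1 p.2)) D.latMeasure
  convective_int : ∀ i j,
    Integrable (fun p : ℝ × E d => (R p.1 p.2 + Z p.1 p.2) * u p.1 p.2 i * u p.1 p.2 j)
      D.cylMeasure
  -- continuity equations and initial densities
  continuity_R : ContinuityEq D R D.RB D.R0 u
  continuity_Z : ContinuityEq D Z D.ZB D.Z0 u
  init_R : R 0 =ᵐ[volume.restrict D.Ω] D.R0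
  init_Z : Z 0 =ᵐ[volume.restrict D.Ω] D.Z0
  -- momentum equation and initial momentum
  tensorDefect : IsTensorDefect D.T D.Ω Rey
  momentum : ∀ φ : ℝ → E d → E d, IsC1 D.T D.Ω φ →
    (∀ t ∈ Icc 0 D.T, ∀ x ∈ frontier D.Ω, φ t x = 0) → ∀ τ ∈ Icc 0 D.T,
      (∫ x in D.Ω, inner ℝ (m τ x) (φ τ x))
        - (∫ x in D.Ω, inner ℝ ((D.R0 x + D.Z0 x) • D.u0 x) (φ 0 x))
      = (∫ t in (0 : ℝ)..τ, ∫ x in D.Ω,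
          ((R t x + Z t x) * inner ℝ (u t x) (dt D.T φ t x)
            + (R t x + Z t x) * frob (outer (u t x) (u t x)) (jac D.Ω (φ t) x)
            + D.P (R t x, Z t x) * div D.Ω (φ t) x
            - frob (D.S (Du t x)) (jac D.Ω (φ t) x)))
        + ∫ t in (0 : ℝ)..τ, pairing D.Ω (jac D.Ω (φ t)) (Rey t)
  init_m : m 0 =ᵐ[volume.restrict D.Ω] fun x => (D.R0 x + D.Z0 x) • D.u0 x
  -- energy inequality
  scalarDefect : IsScalarDefect D.T D.Ω En
  energy : ∀ᵐ τ ∂D.timeMeasure,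
    (∫ x in D.Ω, D.energyDensity (R τ x) (Z τ x) (u τ x - D.uB x))
      - (∫ x in D.Ω, D.energyDensity (D.R0 x) (D.Z0 x) (D.u0 x - D.uB x))
      + (∫ t in (0 : ℝ)..τ, ∫ x in D.Ω, frob (D.S (Du t x)) (Du t x))
      + (∫ t in (0 : ℝ)..τ, ∫ x in D.outflow,
          D.H (R t x, Z t x) * D.flux x ∂(surfaceMeasure D.Ω))
      + (∫ _t in (0 : ℝ)..τ, ∫ x in D.inflow,
          D.H (D.RB x, D.ZB x) * D.flux x ∂(surfaceMeasure D.Ω))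
      + (En τ).real (closure D.Ω)
    ≤ - (∫ t in (0 : ℝ)..τ, ∫ x in D.Ω,
          frob ((R t x + Z t x) • outer (u t x) (u t x) + D.P (R t x, Z t x) • (1 : Mat d))
            (jac D.Ω D.uB x))
      + (∫ t in (0 : ℝ)..τ, ∫ x in D.Ω,
          (R t x + Z t x) * convect (u t x) (jac D.Ω D.uB x) (D.uB x))
      + (∫ t in (0 : ℝ)..τ, ∫ x in D.Ω, frob (D.S (Du t x)) (jac D.Ω D.uB x))
      - ∫ t in (0 : ℝ)..τ, pairing D.Ω (jac D.Ω D.uB) (Rey t)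
  -- compatibility of the defects
  compatible : ∃ c₁ c₂ : ℝ, 0 < c₁ ∧ c₁ ≤ c₂ ∧ ∀ᵐ t ∂D.timeMeasure, ∀ A, MeasurableSet A →
    c₁ * (En t).real A ≤ ∑ i, Rey t i i A ∧ ∑ i, Rey t i i A ≤ c₂ * (En t).real A

/-- Test functions for the relative energy inequality: `C¹` on the closed cylinder, `(r,z)` with
values in `V`, `inf z > 0`, and `v = u_B` on the boundary. -/
structure IsTestTriple {d : ℕ} (D : Data d) (V : Set (ℝ × ℝ)) (r z : ℝ → E d → ℝ)
    (v : ℝ → E d → E d) : Prop where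
  r_C1 : IsC1 D.T D.Ω r
  z_C1 : IsC1 D.T D.Ω z
  v_C1 : IsC1 D.T D.Ω v
  mem : ∀ t ∈ Icc 0 D.T, ∀ x ∈ closure D.Ω, (r t x, z t x) ∈ V
  z_pos : ∃ c > (0 : ℝ), ∀ t ∈ Icc 0 D.T, ∀ x ∈ closure D.Ω, c ≤ z t x
  v_bdry : ∀ t ∈ Icc 0 D.T, ∀ x ∈ frontier D.Ω, v t x = D.uB x

/-- `∂ₜ((r+z)v) + div((r+z) v ⊗ v)`. -/
def momentumResidual {d : ℕ} (D : Data d) (r z : ℝ → E d → ℝ) (v : ℝ → E d → E d) (t : ℝ)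
    (x : E d) : E d :=
  dt D.T (fun s y => (r s y + z s y) • v s y) t x
    + divTensor D.Ω (fun y => (r t y + z t y) • outer (v t y) (v t y)) x

/-- `∂ₜ r + div(r v)`. -/
def massResidual {d : ℕ} (D : Data d) (r : ℝ → E d → ℝ) (v : ℝ → E d → E d) (t : ℝ)
    (x : E d) : ℝ :=
  dt D.T r t x + div D.Ω (fun y => r t y • v t y) x

end Bifluid

end

noncomputable section

namespace Bifluid

/-! ### Area formula for injective maps with expanding derivative -/

/-! The relative energy differs from the energy by terms that the weak formulation controls. Write
`U` for the test velocity, `h₁`, `h₂` for the two derivatives of `H` at `(𝔯, 𝔷)`, and `p` for `P (𝔯,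
𝔷)`. Expanding squares, `½(R+Z)|u-U|² = ½(R+Z)|u-u_B|² + (R+Z)u·(u_B-U) + ½(R+Z)(|U|²-|u_B|²)`, and
the Helmholtz relation `R ∂_R H + Z ∂_Z H = H + P` (`helmholtz_relation`) turns the thermodynamic
part into `H(R,Z) - h₁R - h₂Z + p`. This is `integral_relEnergy_eq`. The change in time of each
piece is known: the energy inequality bounds the first, the momentum equation tested with `u_B - U`,
which vanishes on the boundary, gives the second, the two continuity equations tested with `½|U|² -
½|u_B|² - hᵢ` give the terms linear in `R` and `Z`, and the fundamental theorem of calculus in time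
gives `p`. Summing these leaves two identities to check.

In the interior (`interior_identity`) the integrands agree at every point. After the chain rule this
is the algebraic identity `relative_energy_identity`: `u_B` drops out of it, and the pressure
derivatives are replaced by second derivatives of `H` through the differentiated Helmholtz relation
(`dR_dZ_pressure`). On the boundary (`boundary_identity`) `U = u_B`, so the kinetic part of the test
functions disappears. What remains is the flux of `p` through the whole boundary, which the
divergence theorem converts into the volume integral of `div (p U)` used by the interior identity.

The divergence theorem is the main analytic ingredient, since the surface measure is a Hausdorff
measure and the normal is defined by a tangency condition. Over a Lipschitz graph the area formula
gives the density `√(1 + |∇g|²)` (`restrict_range_graphMap`), which cancels the normalisation of the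
outer normal `(∇g - e)/√(1 + |∇g|²)` (`IsBoundaryChart.isOuterNormal`). Above the graph the formula
is proved by integrating vertically from the graph upwards and horizontally along parallel layers
(`integral_fderiv_epigraph`); a partition of unity then gives `integral_fderivWithin_eq_surface`.

Two further points need care. `H` must be `C²` up to those edges of the cone that belong to the
domain, which follows by differentiation under an integral over a fixed interval
(`contDiffOn_helmholtz`). And every term must be integrable on its own, because integrals are only
then additive. For the Reynolds defect this includes measurability in time of its pairing with a
time-dependent field (`IsTensorDefect.integrable_pairing`). -/

theorem euclideanHausdorffMeasure_image_le_of_lipschitzOnWith {X Y : Type*}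
    [EMetricSpace X] [MeasurableSpace X] [BorelSpace X]
    [EMetricSpace Y] [MeasurableSpace Y] [BorelSpace Y] {K : ℝ≥0} {f : X → Y} {s : Set X}
    (h : LipschitzOnWith K f s) (n : ℕ) :
    (Measure.euclideanHausdorffMeasure n : Measure Y) (f '' s)
      ≤ (K : ℝ≥0∞) ^ n * (Measure.euclideanHausdorffMeasure n : Measure X) s := by
  simp only [Measure.euclideanHausdorffMeasure_def, Measure.smul_apply, ENNReal.smul_def,
    smul_eq_mul]
  have := h.hausdorffMeasure_image_le (d := n) (Nat.cast_nonneg n)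
  rw [ENNReal.rpow_natCast] at this
  calc _ ≤ _ * ((K : ℝ≥0∞) ^ n * _) := by gcongr
    _ = _ := by ring

section Area

variable {V E : Type*} [NormedAddCommGroup V] [InnerProductSpace ℝ V] [FiniteDimensional ℝ V]
  [MeasurableSpace V] [BorelSpace V] [NormedAddCommGroup E] [InnerProductSpace ℝ E]
  [MeasurableSpace E] [BorelSpace E]

open Module

/-- Because `A` does not shrink vectors, the error `ε‖x - y‖` is at most `ε‖A (x - y)‖`. Hence `f ∘
A⁻¹` is `(1 + ε)`-Lipschitz on `A '' u`, a set whose measure is `normDet A` times that of `u`. -/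
theorem measure_image_le_of_approximatesLinearOn {f : V → E} {A : V →L[ℝ] E} {u : Set V}
    {ε : ℝ≥0} (h : ApproximatesLinearOn f A u ε) (hA : ∀ v, ‖v‖ ≤ ‖A v‖) :
    (Measure.euclideanHausdorffMeasure (finrank ℝ V) : Measure E) (f '' u)
      ≤ ((1 + ε : ℝ≥0) : ℝ≥0∞) ^ finrank ℝ V
        * (ENNReal.ofReal (LinearMap.normDet (A : V →ₗ[ℝ] E)) * volume u) := by
  have hinj : Function.Injective A := by
    intro x y hxy
    have := hA (x - y)
    rw [map_sub, hxy, sub_self, norm_zero] at this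
    exact sub_eq_zero.1 (norm_le_zero_iff.1 this)
  have himg : f '' u = (fun z => f (Function.invFun A z)) '' (A '' u) := by
    rw [image_image]
    simp [Function.leftInverse_invFun hinj _]
  have hlip : LipschitzOnWith (1 + ε) (fun z => f (Function.invFun A z)) (A '' u) := by
    refine LipschitzOnWith.of_dist_le_mul ?_
    rintro _ ⟨x, hx, rfl⟩ _ ⟨y, hy, rfl⟩
    simp only [Function.leftInverse_invFun hinj _]
    rw [dist_eq_norm, dist_eq_norm, ← map_sub]
    have h1 := h x hx y hy
    have h2 := hA (x - y)
    have h3 : ‖f x - f y‖ ≤ ‖f x - f y - A (x - y)‖ + ‖A (x - y)‖ := by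
      simpa using norm_add_le (f x - f y - A (x - y)) (A (x - y))
    have h4 : (ε : ℝ) * ‖x - y‖ ≤ ε * ‖A (x - y)‖ := by gcongr
    push_cast
    linarith
  rw [himg]
  refine (euclideanHausdorffMeasure_image_le_of_lipschitzOnWith hlip _).trans ?_
  gcongr
  exact (LinearMap.euclideanHausdorffMeasure_image_eq_normDet_mul_volume
    (A : V →ₗ[ℝ] E) u).le

/-- The same comparison read backwards: `A ∘ f⁻¹` is `(1 - ε)⁻¹`-Lipschitz on `f '' u`. -/
theorem le_measure_image_of_approximatesLinearOn {f : V → E} {A : V →L[ℝ] E} {u : Set V}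
    {ε : ℝ≥0} (hε : ε < 1) (h : ApproximatesLinearOn f A u ε) (hA : ∀ v, ‖v‖ ≤ ‖A v‖)
    (hf : InjOn f u) :
    ENNReal.ofReal (LinearMap.normDet (A : V →ₗ[ℝ] E)) * volume u
      ≤ (((1 - ε)⁻¹ : ℝ≥0) : ℝ≥0∞) ^ finrank ℝ V
        * (Measure.euclideanHausdorffMeasure (finrank ℝ V) : Measure E) (f '' u) := by
  have himg : A '' u = (fun z => A (Function.invFunOn f u z)) '' (f '' u) := by
    rw [image_image]
    exact image_congr fun x hx => by rw [hf.leftInvOn_invFunOn hx]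
  have hε' : (0 : ℝ) < 1 - ε := by
    have : (ε : ℝ) < 1 := by exact_mod_cast hε
    linarith
  have hlip : LipschitzOnWith (1 - ε)⁻¹ (fun z => A (Function.invFunOn f u z)) (f '' u) := by
    refine LipschitzOnWith.of_dist_le_mul ?_
    rintro _ ⟨x, hx, rfl⟩ _ ⟨y, hy, rfl⟩
    simp only [hf.leftInvOn_invFunOn hx, hf.leftInvOn_invFunOn hy]
    rw [dist_eq_norm, dist_eq_norm, ← map_sub]
    have h1 := h x hx y hy
    have h2 := hA (x - y)
    have h3 : ‖A (x - y)‖ ≤ ‖f x - f y - A (x - y)‖ + ‖f x - f y‖ := by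
      have := norm_sub_le (f x - f y) (f x - f y - A (x - y))
      rw [sub_sub_cancel] at this
      linarith
    have h4 : (ε : ℝ) * ‖x - y‖ ≤ ε * ‖A (x - y)‖ := by gcongr
    rw [NNReal.coe_inv, NNReal.coe_sub hε.le, NNReal.coe_one, ← div_eq_inv_mul, le_div_iff₀ hε']
    linarith
  have := euclideanHausdorffMeasure_image_le_of_lipschitzOnWith hlip (finrank ℝ V)
  rw [← himg] at this
  refine le_trans (le_of_eq ?_) this
  exact (LinearMap.euclideanHausdorffMeasure_image_eq_normDet_mul_volume
    (A : V →ₗ[ℝ] E) u).symm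

variable [SecondCountableTopology E]

/-- Countably many pieces suffice on which `f` is `ε`-close to its derivative at some point of `s`.
Summing the linear estimate over the pieces costs only the factor `(1 + ε)^n`, which tends to `1`.
-/
theorem measure_image_le_of_normDet_le {f : V → E} {f' : V → V →L[ℝ] E} {s : Set V}
    (hs : MeasurableSet s) (hf' : ∀ x ∈ s, HasFDerivWithinAt f (f' x) s x)
    (hexp : ∀ x ∈ s, ∀ v, ‖v‖ ≤ ‖f' x v‖) {b : ℝ}
    (hb : ∀ x ∈ s, LinearMap.normDet (f' x : V →ₗ[ℝ] E) ≤ b) :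
    (Measure.euclideanHausdorffMeasure (finrank ℝ V) : Measure E) (f '' s)
      ≤ ENNReal.ofReal b * volume s := by
  rcases s.eq_empty_or_nonempty with rfl | hne
  · simp
  have key : ∀ ε : ℝ≥0, 0 < ε →
      (Measure.euclideanHausdorffMeasure (finrank ℝ V) : Measure E) (f '' s)
        ≤ ((1 + ε : ℝ≥0) : ℝ≥0∞) ^ finrank ℝ V * (ENNReal.ofReal b * volume s) := by
    intro ε hε
    obtain ⟨t, A, t_disj, t_meas, t_cover, ht, hA⟩ :=
      exists_partition_approximatesLinearOn_of_hasFDerivWithinAt f s f' hf' (fun _ => ε)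
        fun _ => hε.ne'
    have hs_eq : s = ⋃ n, s ∩ t n := by
      rw [← inter_iUnion]
      exact (inter_eq_left.2 t_cover).symm
    calc _ = (Measure.euclideanHausdorffMeasure (finrank ℝ V) : Measure E)
            (⋃ n, f '' (s ∩ t n)) := by rw [← image_iUnion, ← hs_eq]
      _ ≤ ∑' n, (Measure.euclideanHausdorffMeasure (finrank ℝ V) : Measure E)
            (f '' (s ∩ t n)) := measure_iUnion_le _
      _ ≤ ∑' n, ((1 + ε : ℝ≥0) : ℝ≥0∞) ^ finrank ℝ V
            * (ENNReal.ofReal b * volume (s ∩ t n)) := by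
          refine ENNReal.tsum_le_tsum fun n => ?_
          obtain ⟨y, hy, hAy⟩ := hA hne n
          refine (measure_image_le_of_approximatesLinearOn (ht n)
            (by rw [hAy]; exact hexp y hy)).trans ?_
          gcongr
          rw [hAy]
          exact hb y hy
      _ = _ := by
          rw [ENNReal.tsum_mul_left, ENNReal.tsum_mul_left, ← measure_iUnion, ← hs_eq]
          · exact pairwise_disjoint_mono t_disj fun n => inter_subset_right
          · exact fun n => hs.inter (t_meas n)
  -- Multiplication by `⊤` is not continuous in the other factor, so the infinite case is set aside
  -- before `ε → 0`.
  by_cases htop : ENNReal.ofReal b * volume s = ⊤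
  · rw [htop]; exact le_top
  have hlim : Tendsto (fun ε : ℝ≥0 => ((1 + ε : ℝ≥0) : ℝ≥0∞) ^ finrank ℝ V
      * (ENNReal.ofReal b * volume s)) (𝓝[>] 0)
      (𝓝 (((1 + 0 : ℝ≥0) : ℝ≥0∞) ^ finrank ℝ V * (ENNReal.ofReal b * volume s))) := by
    refine ENNReal.Tendsto.mul_const ?_ (Or.inr htop)
    refine Tendsto.mono_left ?_ nhdsWithin_le_nhds
    refine ((ENNReal.continuous_pow _).comp
      (ENNReal.continuous_coe.comp (continuous_const.add continuous_id))).tendsto 0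
  simp only [add_zero, ENNReal.coe_one, one_pow, one_mul] at hlim
  exact ge_of_tendsto hlim (eventually_nhdsWithin_of_forall fun ε hε => key ε hε)

/-- Injectivity is essential for the lower bound: it makes the images of the pieces disjoint, and
measurable as injective continuous images of measurable sets, so that their measures add up. -/
theorem le_measure_image_of_le_normDet {f : V → E} {f' : V → V →L[ℝ] E} {s : Set V}
    (hs : MeasurableSet s) (hf' : ∀ x ∈ s, HasFDerivWithinAt f (f' x) s x)
    (hexp : ∀ x ∈ s, ∀ v, ‖v‖ ≤ ‖f' x v‖) (hf : InjOn f s) {a : ℝ}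
    (ha : ∀ x ∈ s, a ≤ LinearMap.normDet (f' x : V →ₗ[ℝ] E)) :
    ENNReal.ofReal a * volume s
      ≤ (Measure.euclideanHausdorffMeasure (finrank ℝ V) : Measure E) (f '' s) := by
  rcases s.eq_empty_or_nonempty with rfl | hne
  · simp
  have key : ∀ ε : ℝ≥0, 0 < ε → ε < 1 →
      ENNReal.ofReal a * volume s ≤ (((1 - ε)⁻¹ : ℝ≥0) : ℝ≥0∞) ^ finrank ℝ V *
        (Measure.euclideanHausdorffMeasure (finrank ℝ V) : Measure E) (f '' s) := by
    intro ε hε hε1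
    obtain ⟨t, A, t_disj, t_meas, t_cover, ht, hA⟩ :=
      exists_partition_approximatesLinearOn_of_hasFDerivWithinAt f s f' hf' (fun _ => ε)
        fun _ => hε.ne'
    have hs_eq : s = ⋃ n, s ∩ t n := by
      rw [← inter_iUnion]
      exact (inter_eq_left.2 t_cover).symm
    have hcont : ContinuousOn f s := fun x hx => (hf' x hx).continuousWithinAt
    calc _ = ∑' n, ENNReal.ofReal a * volume (s ∩ t n) := by
          rw [ENNReal.tsum_mul_left, ← measure_iUnion, ← hs_eq]
          · exact pairwise_disjoint_mono t_disj fun n => inter_subset_right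
          · exact fun n => hs.inter (t_meas n)
      _ ≤ ∑' n, (((1 - ε)⁻¹ : ℝ≥0) : ℝ≥0∞) ^ finrank ℝ V *
            (Measure.euclideanHausdorffMeasure (finrank ℝ V) : Measure E) (f '' (s ∩ t n)) := by
          refine ENNReal.tsum_le_tsum fun n => ?_
          obtain ⟨y, hy, hAy⟩ := hA hne n
          refine le_trans ?_ (le_measure_image_of_approximatesLinearOn hε1 (ht n)
            (by rw [hAy]; exact hexp y hy) (hf.mono inter_subset_left))
          gcongr
          rw [hAy]
          exact ha y hy
      _ = (((1 - ε)⁻¹ : ℝ≥0) : ℝ≥0∞) ^ finrank ℝ V *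
          (Measure.euclideanHausdorffMeasure (finrank ℝ V) : Measure E) (f '' s) := by
          rw [ENNReal.tsum_mul_left, ← measure_iUnion, ← image_iUnion, ← hs_eq]
          · intro i j hij
            exact (t_disj hij).mono inter_subset_right inter_subset_right |>.image hf
              inter_subset_left inter_subset_left
          · exact fun n => (hs.inter (t_meas n)).image_of_continuousOn_injOn
              (hcont.mono inter_subset_left) (hf.mono inter_subset_left)
  by_cases htop : (Measure.euclideanHausdorffMeasure (finrank ℝ V) : Measure E) (f '' s) = ⊤
  · rw [htop]; exact le_top
  have hlim : Tendsto (fun ε : ℝ≥0 => (((1 - ε)⁻¹ : ℝ≥0) : ℝ≥0∞) ^ finrank ℝ V *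
      (Measure.euclideanHausdorffMeasure (finrank ℝ V) : Measure E) (f '' s)) (𝓝[>] 0)
      (𝓝 ((((1 - 0)⁻¹ : ℝ≥0) : ℝ≥0∞) ^ finrank ℝ V *
        (Measure.euclideanHausdorffMeasure (finrank ℝ V) : Measure E) (f '' s))) := by
    refine ENNReal.Tendsto.mul_const ?_ (Or.inr htop)
    refine Tendsto.mono_left ?_ nhdsWithin_le_nhds
    refine (ENNReal.continuous_pow _).tendsto _ |>.comp
      (ENNReal.continuous_coe.tendsto _ |>.comp ?_)
    refine Tendsto.inv₀ ?_ (by simp)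
    exact (continuous_const.sub continuous_id).tendsto 0
  simp only [tsub_zero, inv_one, ENNReal.coe_one, one_pow, one_mul] at hlim
  refine ge_of_tendsto hlim ?_
  filter_upwards [self_mem_nhdsWithin, nhdsWithin_le_nhds (Iio_mem_nhds zero_lt_one)] with ε h h'
  exact key ε h h'

/-- Two measures which compare on level sets of `J` are related by the density `J`. -/
theorem eq_withDensity_of_forall_le {X : Type*} [MeasurableSpace X] {μ ρ : Measure X}
    [SigmaFinite μ] {J : X → ℝ} (hJ : Measurable J) (hJ0 : ∀ x, 0 ≤ J x) {D : Set X}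
    (hD : MeasurableSet D) (hμD : μ Dᶜ = 0) (hρD : ρ Dᶜ = 0)
    (hle : ∀ s ⊆ D, MeasurableSet s → ∀ b, (∀ x ∈ s, J x ≤ b) → ρ s ≤ ENNReal.ofReal b * μ s)
    (hge : ∀ s ⊆ D, MeasurableSet s → ∀ a, (∀ x ∈ s, a ≤ J x) → ENNReal.ofReal a * μ s ≤ ρ s) :
    ρ = μ.withDensity fun x => ENNReal.ofReal (J x) := by
  have hν0 : (μ.withDensity fun x => ENNReal.ofReal (J x)) Dᶜ = 0 :=
    withDensity_absolutelyContinuous _ _ hμD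
  -- on sets of finite measure inside `D`
  have main : ∀ s ⊆ D, MeasurableSet s → μ s ≠ ⊤ →
      ρ s = (μ.withDensity fun x => ENNReal.ofReal (J x)) s := by
    intro s hsD hs hfin
    have hb : ∀ ε : ℝ, 0 < ε → ρ s ≤ (μ.withDensity fun x => ENNReal.ofReal (J x)) s
          + ENNReal.ofReal ε * μ s ∧
        (μ.withDensity fun x => ENNReal.ofReal (J x)) s ≤ ρ s + ENNReal.ofReal ε * μ s := by
      intro ε hε
      -- On the `n`-th layer both measures lie between `n ε μ` and `(n + 1) ε μ`, so over all of `s`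
      -- they differ by at most `ε μ s`, which tends to zero since `μ s` is finite.
      let t : ℕ → Set X := fun n => s ∩ J ⁻¹' (Ico (n * ε) ((n + 1) * ε))
      have ht : ∀ n, MeasurableSet (t n) := fun n => hs.inter (hJ measurableSet_Ico)
      have hdisj : Pairwise (Function.onFun Disjoint t) := by
        intro i j hij
        refine Set.disjoint_left.2 fun x hx hx' => hij ?_
        obtain ⟨-, h1, h2⟩ := hx
        obtain ⟨-, h3, h4⟩ := hx'
        have e1 : (i : ℝ) < j + 1 := lt_of_mul_lt_mul_right (h1.trans_lt h4) hε.le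
        have e2 : (j : ℝ) < i + 1 := lt_of_mul_lt_mul_right (h3.trans_lt h2) hε.le
        have e3 : i < j + 1 := by exact_mod_cast e1
        have e4 : j < i + 1 := by exact_mod_cast e2
        omega
      have hun : s = ⋃ n, t n := by
        refine Subset.antisymm (fun x hx => ?_) (iUnion_subset fun n => inter_subset_left)
        refine mem_iUnion.2 ⟨⌊J x / ε⌋₊, hx, ?_, ?_⟩
        · exact (le_div_iff₀ hε).1 (Nat.floor_le (div_nonneg (hJ0 x) hε.le))
        · exact (div_lt_iff₀ hε).1 (Nat.lt_floor_add_one _)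
      have htD : ∀ n, t n ⊆ D := fun n => inter_subset_left.trans hsD
      have hsplit : ∀ n : ℕ, ENNReal.ofReal ((n + 1) * ε) * μ (t n)
          = ENNReal.ofReal (n * ε) * μ (t n) + ENNReal.ofReal ε * μ (t n) := by
        intro n
        rw [← add_mul, ← ENNReal.ofReal_add (by positivity) hε.le]
        ring_nf
      have hlow : ∀ n : ℕ, ENNReal.ofReal (n * ε) * μ (t n)
          ≤ (μ.withDensity fun x => ENNReal.ofReal (J x)) (t n) := by
        intro n
        rw [withDensity_apply _ (ht n), ← setLIntegral_const]
        exact setLIntegral_mono' (ht n) fun x hx => ENNReal.ofReal_le_ofReal hx.2.1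
      have hup : ∀ n : ℕ, (μ.withDensity fun x => ENNReal.ofReal (J x)) (t n)
          ≤ ENNReal.ofReal ((n + 1) * ε) * μ (t n) := by
        intro n
        rw [withDensity_apply _ (ht n), ← setLIntegral_const]
        exact setLIntegral_mono' (ht n) fun x hx => ENNReal.ofReal_le_ofReal hx.2.2.le
      have sumform : ∀ ν : Measure X, ν s = ∑' n, ν (t n) := by
        intro ν
        conv_lhs => rw [hun]
        exact measure_iUnion hdisj ht
      rw [sumform ρ, sumform (μ.withDensity _), sumform μ, ← ENNReal.tsum_mul_left,
        ← ENNReal.tsum_add, ← ENNReal.tsum_add]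
      constructor
      · refine ENNReal.tsum_le_tsum fun n => ?_
        refine (hle (t n) (htD n) (ht n) ((n + 1) * ε) fun x hx => hx.2.2.le).trans ?_
        rw [hsplit]
        gcongr
        exact hlow n
      · refine ENNReal.tsum_le_tsum fun n => ?_
        refine (hup n).trans ?_
        rw [hsplit]
        gcongr
        exact hge (t n) (htD n) (ht n) _ fun x hx => hx.2.1
    have hlim : ∀ c : ℝ≥0∞, Tendsto (fun ε : ℝ => c + ENNReal.ofReal ε * μ s) (𝓝[>] 0)
        (𝓝 c) := by
      intro c
      have : Tendsto (fun ε : ℝ => c + ENNReal.ofReal ε * μ s) (𝓝[>] 0)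
          (𝓝 (c + ENNReal.ofReal 0 * μ s)) := by
        refine Tendsto.mono_left ?_ nhdsWithin_le_nhds
        refine tendsto_const_nhds.add (ENNReal.Tendsto.mul_const ?_ (Or.inr hfin))
        exact ENNReal.continuous_ofReal.tendsto 0
      simpa using this
    refine le_antisymm (ge_of_tendsto (hlim _) ?_) (ge_of_tendsto (hlim _) ?_)
    · exact eventually_nhdsWithin_of_forall fun ε hε => (hb ε hε).1
    · exact eventually_nhdsWithin_of_forall fun ε hε => (hb ε hε).2
  ext s hs
  have hred : ∀ ν : Measure X, ν Dᶜ = 0 → ν s = ν (s ∩ D) := by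
    intro ν hν
    refine le_antisymm ?_ (measure_mono inter_subset_left)
    calc ν s ≤ ν (s ∩ D ∪ Dᶜ) := measure_mono fun x hx => by
          by_cases h : x ∈ D
          · exact Or.inl ⟨hx, h⟩
          · exact Or.inr h
      _ ≤ ν (s ∩ D) + ν Dᶜ := measure_union_le _ _
      _ = _ := by rw [hν, add_zero]
  rw [hred ρ hρD, hred _ hν0]
  have hun : s ∩ D = ⋃ n, (s ∩ D) ∩ disjointed (spanningSets μ) n := by
    rw [← inter_iUnion, iUnion_disjointed, iUnion_spanningSets, inter_univ]
  have hm : ∀ n, MeasurableSet ((s ∩ D) ∩ disjointed (spanningSets μ) n) := fun n =>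
    (hs.inter hD).inter (MeasurableSet.disjointed (measurableSet_spanningSets μ) n)
  have hd : Pairwise (Function.onFun Disjoint fun n => (s ∩ D) ∩ disjointed (spanningSets μ) n) :=
    pairwise_disjoint_mono (disjoint_disjointed _) fun n => inter_subset_right
  rw [hun, measure_iUnion hd hm, measure_iUnion hd hm]
  congr 1
  ext n
  refine main _ (inter_subset_left.trans inter_subset_right) (hm n) (ne_of_lt ?_)
  exact (measure_mono (inter_subset_right.trans (disjointed_subset _ _))).trans_lt
    (measure_spanningSets_lt_top μ n)

end Area

/-! ### Surface measure of Lipschitz graphs -/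

section Graph

variable {E : Type*} [NormedAddCommGroup E] [InnerProductSpace ℝ E]

open Module

/-- The point of the graph of `g` above `y`, in the direction `e`. -/
def graphMap (e : E) (g : (ℝ ∙ e)ᗮ → ℝ) (y : (ℝ ∙ e)ᗮ) : E := (y : E) + g y • e

theorem inner_orthogonal_left {e : E} (y : (ℝ ∙ e)ᗮ) : inner ℝ e (y : E) = 0 :=
  Submodule.mem_orthogonal_singleton_iff_inner_right.1 y.2

theorem norm_sq_add_smul {e : E} (he : ‖e‖ = 1) (y : (ℝ ∙ e)ᗮ) (s : ℝ) :
    ‖(y : E) + s • e‖ ^ 2 = ‖y‖ ^ 2 + s ^ 2 := by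
  rw [@norm_add_sq_real, inner_smul_right, real_inner_comm, inner_orthogonal_left, norm_smul, he]
  simp

theorem norm_le_norm_add_smul {e : E} (he : ‖e‖ = 1) (y : (ℝ ∙ e)ᗮ) (s : ℝ) :
    ‖y‖ ≤ ‖(y : E) + s • e‖ := by
  have := norm_sq_add_smul he y s
  exact le_of_sq_le_sq (by nlinarith [sq_nonneg s]) (norm_nonneg _)

theorem inner_add_smul {e : E} (he : ‖e‖ = 1) (y : (ℝ ∙ e)ᗮ) (s : ℝ) :
    inner ℝ e ((y : E) + s • e) = s := by
  rw [inner_add_right, inner_orthogonal_left, inner_smul_right, real_inner_self_eq_norm_sq, he]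
  simp

theorem graphMap_injective {e : E} (he : ‖e‖ = 1) (g : (ℝ ∙ e)ᗮ → ℝ) :
    Function.Injective (graphMap e g) := by
  intro y y' h
  have h1 : g y = g y' := by
    rw [← inner_add_smul he y (g y), ← inner_add_smul he y' (g y')]
    exact congrArg _ h
  unfold graphMap at h
  rw [h1, add_left_inj] at h
  exact Subtype.ext h

theorem graphMap_lipschitz {e : E} (he : ‖e‖ = 1) {g : (ℝ ∙ e)ᗮ → ℝ} {K : ℝ≥0}
    (hg : LipschitzWith K g) : LipschitzWith (1 + K) (graphMap e g) := by
  refine (LipschitzWith.subtype_val _).add (LipschitzWith.of_dist_le_mul fun x y => ?_)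
  rw [dist_eq_norm, ← sub_smul, norm_smul, he, mul_one, ← dist_eq_norm]
  exact hg.dist_le_mul x y

theorem hasFDerivAt_graphMap {e : E} {g : (ℝ ∙ e)ᗮ → ℝ} {y : (ℝ ∙ e)ᗮ}
    (hg : DifferentiableAt ℝ g y) :
    HasFDerivAt (graphMap e g) ((ℝ ∙ e)ᗮ.subtypeL + (fderiv ℝ g y).smulRight e) y :=
  (ℝ ∙ e)ᗮ.subtypeL.hasFDerivAt.add (hg.hasFDerivAt.smul_const e)

variable [FiniteDimensional ℝ E]

/-- In an orthonormal basis of the hyperplane the Gram matrix of the map is the identity plus the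
rank-one matrix `a aᵀ`, because `e` is a unit vector orthogonal to the hyperplane. The matrix
determinant lemma evaluates it. -/
theorem normDet_subtype_add_smulRight {e : E} (he : ‖e‖ = 1) (a : (ℝ ∙ e)ᗮ →L[ℝ] ℝ) :
    LinearMap.normDet (((ℝ ∙ e)ᗮ.subtypeL + a.smulRight e : (ℝ ∙ e)ᗮ →L[ℝ] E) :
      (ℝ ∙ e)ᗮ →ₗ[ℝ] E) = √(1 + ‖a‖ ^ 2) := by
  have hsq := LinearMap.normDet_sq_eq_det_gram
    (((ℝ ∙ e)ᗮ.subtypeL + a.smulRight e : (ℝ ∙ e)ᗮ →L[ℝ] E) : (ℝ ∙ e)ᗮ →ₗ[ℝ] E)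
    (stdOrthonormalBasis ℝ (ℝ ∙ e)ᗮ)
  set b := stdOrthonormalBasis ℝ (ℝ ∙ e)ᗮ with hb
  have hgram : (Matrix.gram ℝ fun i => (((ℝ ∙ e)ᗮ.subtypeL + a.smulRight e :
      (ℝ ∙ e)ᗮ →L[ℝ] E) : (ℝ ∙ e)ᗮ →ₗ[ℝ] E) (b i))
      = 1 + Matrix.replicateCol Unit (fun i => a (b i)) * Matrix.replicateRow Unit
        (fun i => a (b i)) := by
    ext i j
    have h1 : inner ℝ ((b i : (ℝ ∙ e)ᗮ) : E) ((b j : (ℝ ∙ e)ᗮ) : E) = if i = j then 1 else 0 := by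
      rw [← Submodule.coe_inner]
      exact orthonormal_iff_ite.1 b.orthonormal i j
    simp only [Matrix.gram_apply, ContinuousLinearMap.coe_coe, add_apply,
      Submodule.subtypeL_apply, ContinuousLinearMap.smulRight_apply, Matrix.add_apply,
      Matrix.mul_apply, Matrix.replicateCol_apply, Matrix.replicateRow_apply, Finset.univ_unique,
      Finset.sum_singleton, inner_add_left, inner_add_right, inner_smul_left, inner_smul_right,
      h1, inner_orthogonal_left, real_inner_comm e, real_inner_self_eq_norm_sq, he, Matrix.one_apply]
    simp [mul_comm]
  have hnorm : ∑ i, a (b i) * a (b i) = ‖a‖ ^ 2 := by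
    have h1 : ∀ i, a (b i) = inner ℝ ((InnerProductSpace.toDual ℝ _).symm a) (b i) := fun i => by
      rw [InnerProductSpace.toDual_symm_apply]
    have h2 := b.sum_inner_mul_inner ((InnerProductSpace.toDual ℝ _).symm a)
      ((InnerProductSpace.toDual ℝ _).symm a)
    rw [real_inner_self_eq_norm_sq, LinearIsometryEquiv.norm_map] at h2
    rw [← h2]
    refine Finset.sum_congr rfl fun i _ => ?_
    rw [h1, real_inner_comm (b i)]
  have hdet : (Matrix.gram ℝ fun i => (((ℝ ∙ e)ᗮ.subtypeL + a.smulRight e :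
      (ℝ ∙ e)ᗮ →L[ℝ] E) : (ℝ ∙ e)ᗮ →ₗ[ℝ] E) (b i)).det = 1 + ‖a‖ ^ 2 := by
    rw [hgram, Matrix.det_one_add_replicateCol_mul_replicateRow, ← hnorm]
    rfl
  rw [← hdet, ← hsq]
  exact (Real.sqrt_sq (LinearMap.normDet_nonneg _)).symm

variable [MeasurableSpace E] [BorelSpace E]

/-- The surface measure of a Lipschitz graph has density `√(1 + |∇g|²)`. -/
theorem restrict_range_graphMap {e : E} (he : ‖e‖ = 1) {g : (ℝ ∙ e)ᗮ → ℝ} {K : ℝ≥0}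
    (hg : LipschitzWith K g) :
    (Measure.euclideanHausdorffMeasure (finrank ℝ (ℝ ∙ e)ᗮ) : Measure E).restrict
        (range (graphMap e g))
      = (volume.withDensity fun y => ENNReal.ofReal √(1 + ‖fderiv ℝ g y‖ ^ 2)).map
          (graphMap e g) := by
  set γ := graphMap e g
  set n := finrank ℝ (ℝ ∙ e)ᗮ
  have hγ : MeasurableEmbedding γ :=
    (graphMap_lipschitz he hg).continuous.measurableEmbedding (graphMap_injective he g)
  have hcomap : (Measure.euclideanHausdorffMeasure n : Measure E).comap γ
      = volume.withDensity fun y => ENNReal.ofReal √(1 + ‖fderiv ℝ g y‖ ^ 2) := by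
    -- By Rademacher's theorem the points of non-differentiability form a null set, and the
    -- Lipschitz map `γ` sends it to a null set. On the rest the derivative of `γ` is expanding,
    -- since adding a multiple of `e` to a vector of the hyperplane only lengthens it.
    have hD : MeasurableSet {y | DifferentiableAt ℝ g y} :=
      measurableSet_of_differentiableAt ℝ g
    have hμD : volume {y | DifferentiableAt ℝ g y}ᶜ = 0 := hg.ae_differentiableAt
    have hexp : ∀ y, ∀ v, ‖v‖ ≤ ‖((ℝ ∙ e)ᗮ.subtypeL + (fderiv ℝ g y).smulRight e) v‖ :=
      fun y v => norm_le_norm_add_smul he v _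
    have hderiv : ∀ s ⊆ {y | DifferentiableAt ℝ g y}, ∀ x ∈ s,
        HasFDerivWithinAt γ ((ℝ ∙ e)ᗮ.subtypeL + (fderiv ℝ g x).smulRight e) s x :=
      fun s hs x hx => (hasFDerivAt_graphMap (hs hx)).hasFDerivWithinAt
    refine eq_withDensity_of_forall_le ?_ (fun _ => Real.sqrt_nonneg _) hD hμD ?_ ?_ ?_
    · exact (measurable_const.add ((measurable_fderiv ℝ g).norm.pow_const 2)).sqrt
    · rw [hγ.comap_apply]
      refine le_antisymm ?_ bot_le
      refine (euclideanHausdorffMeasure_image_le_of_lipschitzOnWith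
        (graphMap_lipschitz he hg).lipschitzOnWith n).trans ?_
      rw [InnerProductSpace.euclideanHausdorffMeasure_eq_volume, hμD, mul_zero]
    · intro s hsD hs b hb
      rw [hγ.comap_apply]
      exact measure_image_le_of_normDet_le hs (hderiv s hsD) (fun x _ => hexp x)
        fun x hx => (normDet_subtype_add_smulRight he _).trans_le (hb x hx)
    · intro s hsD hs a ha
      rw [hγ.comap_apply]
      exact le_measure_image_of_le_normDet hs (hderiv s hsD) (fun x _ => hexp x)
        (graphMap_injective he g).injOn
        fun x hx => (ha x hx).trans_eq (normDet_subtype_add_smulRight he _).symm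
  rw [← hcomap, hγ.map_comap]

end Graph

/-! ### Lipschitz bounds on layers parallel to a graph -/

section Epigraph

variable {E : Type*} [NormedAddCommGroup E] [InnerProductSpace ℝ E] [FiniteDimensional ℝ E]
  [MeasurableSpace E] [BorelSpace E]

open Module

theorem measurePreserving_add_smul {e : E} (he : ‖e‖ = 1) :
    MeasurePreserving (fun q : (ℝ ∙ e)ᗮ × ℝ => (q.1 : E) + q.2 • e) := by
  have h1 := ((ℝ ∙ e).measurePreserving_measurableEquivProd (0 : E)).symm
  rw [InnerProductSpace.euclideanHausdorffMeasure_eq_volume] at h1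
  have h2 : MeasurePreserving (LinearIsometryEquiv.toSpanUnitSingleton (𝕜 := ℝ) e he) :=
    LinearIsometryEquiv.measurePreserving _
  have h3 := (h2.prod (MeasurePreserving.id (volume : Measure (ℝ ∙ e)ᗮ))).comp
    (Measure.measurePreserving_swap (μ := (volume : Measure (ℝ ∙ e)ᗮ)) (ν := (volume : Measure ℝ)))
  have h4 := h1.comp h3
  convert! h4 using 1
  ext q
  simp [add_comm]

variable {e : E} {g : (ℝ ∙ e)ᗮ → ℝ} {K C : ℝ≥0} {F : E → ℝ} {r : ℝ}

/-- The gradient of `F` is bounded only above the graph, and the segment joining two points of the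
layer may dip below it. The detour goes up by `h`, across, and down by `h`, staying above the graph
throughout. Its three legs have length at most `h`, `‖y - y'‖ + h` and `h`, whence the constant `1 +
3K`. -/
theorem lipschitzWith_epigraph_layer (he : ‖e‖ = 1) (hg : LipschitzWith K g)
    (hdiff : ∀ (y : (ℝ ∙ e)ᗮ) (s : ℝ), g y < s → DifferentiableAt ℝ F ((y : E) + s • e))
    (hbound : ∀ (y : (ℝ ∙ e)ᗮ) (s : ℝ), g y < s → ‖fderiv ℝ F ((y : E) + s • e)‖ ≤ C)
    {σ : ℝ} (hσ : 0 < σ) :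
    LipschitzWith (C * (1 + 3 * K)) fun y : (ℝ ∙ e)ᗮ => F ((y : E) + (g y + σ) • e) := by
  have hseg : ∀ (y y' : (ℝ ∙ e)ᗮ) (a b : ℝ),
      (∀ t ∈ Icc (0 : ℝ) 1, g ((1 - t) • y + t • y') < (1 - t) * a + t * b) →
      |F ((y : E) + a • e) - F ((y' : E) + b • e)|
        ≤ C * ‖((y : E) + a • e) - ((y' : E) + b • e)‖ := by
    intro y y' a b h
    have hmem : ∀ x ∈ segment ℝ ((y' : E) + b • e) ((y : E) + a • e),
        ∃ (z : (ℝ ∙ e)ᗮ) (s : ℝ), g z < s ∧ x = (z : E) + s • e := by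
      rintro x ⟨α, β, hα, hβ, hαβ, rfl⟩
      obtain rfl : β = 1 - α := by linarith
      refine ⟨(1 - α) • y + α • y', (1 - α) * a + α * b, h α ⟨hα, by linarith⟩, ?_⟩
      simp only [Submodule.coe_add, Submodule.coe_smul]
      module
    rw [← Real.norm_eq_abs]
    refine Convex.norm_image_sub_le_of_norm_fderiv_le (𝕜 := ℝ) (fun x hx => ?_) (fun x hx => ?_)
      (convex_segment ((y' : E) + b • e) ((y : E) + a • e)) (left_mem_segment _ _ _)
      (right_mem_segment _ _ _)
    · obtain ⟨z, s, hs, rfl⟩ := hmem x hx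
      exact hdiff z s hs
    · obtain ⟨z, s, hs, rfl⟩ := hmem x hx
      exact hbound z s hs
  refine LipschitzWith.of_dist_le_mul fun y y' => ?_
  -- The height `h` is the largest amount by which `g` can vary along the segment from `y` to `y'`.
  set h : ℝ := K * ‖y - y'‖ with hh
  have h0 : 0 ≤ h := by positivity
  have hvert : ∀ z : (ℝ ∙ e)ᗮ, |F ((z : E) + (g z + σ) • e) - F ((z : E) + (g z + σ + h) • e)|
      ≤ C * h := by
    intro z
    refine (hseg z z _ _ fun t ht => ?_).trans_eq ?_
    · rw [← add_smul, sub_add_cancel, one_smul]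
      nlinarith [ht.1, mul_nonneg ht.1 h0]
    · rw [add_sub_add_left_eq_sub, ← sub_smul, norm_smul, he, mul_one, Real.norm_eq_abs,
        sub_add_cancel_left, abs_neg, abs_of_nonneg h0]
  have hlipg : ∀ z z' : (ℝ ∙ e)ᗮ, g z ≤ g z' + K * ‖z - z'‖ := fun z z' => by
    have := (abs_le.1 (hg.dist_le_mul z z')).2
    rw [dist_eq_norm] at this
    linarith
  -- Along the segment `g` is at most both `g y + h` and `g y' + h`, hence at most their convex
  -- combination. The margin `σ` makes the inequality strict.
  have hhor := hseg y y' (g y + σ + h) (g y' + σ + h) fun t ht => by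
    have e1 := hlipg ((1 - t) • y + t • y') y
    have e2 := hlipg ((1 - t) • y + t • y') y'
    have n1 : ‖(1 - t) • y + t • y' - y‖ ≤ ‖y - y'‖ := by
      rw [show (1 - t) • y + t • y' - y = (-t) • (y - y') by module, norm_smul, norm_neg,
        Real.norm_of_nonneg ht.1]
      exact mul_le_of_le_one_left (norm_nonneg _) ht.2
    have n2 : ‖(1 - t) • y + t • y' - y'‖ ≤ ‖y - y'‖ := by
      rw [show (1 - t) • y + t • y' - y' = (1 - t) • (y - y') by module, norm_smul,
        Real.norm_of_nonneg (by linarith [ht.2])]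
      exact mul_le_of_le_one_left (norm_nonneg _) (by linarith [ht.1])
    have e3 : g ((1 - t) • y + t • y') ≤ g y + h :=
      e1.trans (by rw [hh]; gcongr)
    have e4 : g ((1 - t) • y + t • y') ≤ g y' + h :=
      e2.trans (by rw [hh]; gcongr)
    nlinarith [ht.1, ht.2]
  have hnorm : ‖((y : E) + (g y + σ + h) • e) - ((y' : E) + (g y' + σ + h) • e)‖
      ≤ ‖y - y'‖ + h := by
    rw [show ((y : E) + (g y + σ + h) • e) - ((y' : E) + (g y' + σ + h) • e)
      = ((y - y' : (ℝ ∙ e)ᗮ) : E) + (g y - g y') • e by push_cast; module]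
    refine (norm_add_le _ _).trans ?_
    rw [norm_smul, he, mul_one]
    gcongr
    · exact le_rfl
    · rw [hh, ← dist_eq_norm, ← dist_eq_norm]; exact hg.dist_le_mul y y'
  have hv := hvert y
  have hv' := hvert y'
  rw [dist_eq_norm, dist_eq_norm, Real.norm_eq_abs]
  have htri : |F ((y : E) + (g y + σ) • e) - F ((y' : E) + (g y' + σ) • e)| ≤ C * h + C *
      (‖y - y'‖ + h) + C * h := by
    have h3 : (C : ℝ) * ‖((y : E) + (g y + σ + h) • e) - ((y' : E) + (g y' + σ + h) • e)‖
      ≤ C * (‖y - y'‖ + h) := by gcongr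
    have h4 := hhor.trans h3
    rw [abs_le] at *
    constructor <;> linarith [hv.1, hv.2, hv'.1, hv'.2, h4.1, h4.2]
  refine htri.trans_eq ?_
  push_cast
  rw [hh]
  ring

end Epigraph

/-! ### Divergence theorem above a Lipschitz graph -/

section Epigraph

variable {E : Type*} [NormedAddCommGroup E] [InnerProductSpace ℝ E] [FiniteDimensional ℝ E]
  [MeasurableSpace E] [BorelSpace E]

open Module

variable {e : E} {g : (ℝ ∙ e)ᗮ → ℝ} {K C : ℝ≥0} {F : E → ℝ} {r : ℝ}

/-- Integration by parts for Lipschitz functions, against the constant function `1`. -/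
theorem integral_lineDeriv_eq_zero {V : Type*} [NormedAddCommGroup V] [NormedSpace ℝ V]
    [MeasurableSpace V] [BorelSpace V] [FiniteDimensional ℝ V] {μ : Measure V}
    [μ.IsAddHaarMeasure] {f : V → ℝ} {L : ℝ≥0}
    (hf : LipschitzWith L f) (hsupp : HasCompactSupport f) (w : V) :
    ∫ y, lineDeriv ℝ f y w ∂μ = 0 := by
  have := (LipschitzWith.const (α := V) (1 : ℝ)).integral_lineDeriv_mul_eq (μ := μ) hf hsupp (-w)
  have h0 : ∀ x v : V, lineDeriv ℝ (fun _ : V => (1 : ℝ)) x v = 0 := fun x v => by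
    simp [lineDeriv]
  simpa [h0] using this.symm

theorem orthogonalProjection_add_inner_smul (he : ‖e‖ = 1) (x : E) :
    x = ((ℝ ∙ e)ᗮ.orthogonalProjectionOnto x : E) + inner ℝ e x • e := by
  have h1 := Submodule.starProjection_add_starProjection_orthogonal (K := (ℝ ∙ e)) x
  rw [Submodule.starProjection_unit_singleton ℝ he] at h1
  conv_lhs => rw [← h1, add_comm]
  rfl

theorem orthogonalProjection_add_smul (he : ‖e‖ = 1) (y : (ℝ ∙ e)ᗮ) (s : ℝ) :
    (ℝ ∙ e)ᗮ.orthogonalProjectionOnto ((y : E) + s • e) = y := by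
  have h := orthogonalProjection_add_inner_smul he ((y : E) + s • e)
  rw [inner_add_smul he, add_left_inj] at h
  exact (Subtype.ext h).symm

theorem fderiv_eq_zero_of_epigraph (he : ‖e‖ = 1) (hg : Continuous g)
    (hsupp : ∀ (y : (ℝ ∙ e)ᗮ) (s : ℝ), g y < s → r < ‖(y : E) + s • e‖ → F ((y : E) + s • e) = 0)
    {y : (ℝ ∙ e)ᗮ} {s : ℝ} (hs : g y < s) (hr : r < ‖(y : E) + s • e‖) :
    fderiv ℝ F ((y : E) + s • e) = 0 := by
  have hproj : Continuous fun x : E => (ℝ ∙ e)ᗮ.orthogonalProjectionOnto x := by fun_prop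
  have hdec := orthogonalProjection_add_inner_smul he
  have hev : F =ᶠ[𝓝 ((y : E) + s • e)] fun _ => 0 := by
    have hopen : IsOpen {x : E | g ((ℝ ∙ e)ᗮ.orthogonalProjectionOnto x) < inner ℝ e x ∧ r < ‖x‖} :=
      (isOpen_lt (hg.comp hproj) (by fun_prop)).inter (isOpen_lt continuous_const continuous_norm)
    have hmem : (y : E) + s • e ∈
        {x : E | g ((ℝ ∙ e)ᗮ.orthogonalProjectionOnto x) < inner ℝ e x ∧ r < ‖x‖} := by
      refine ⟨?_, hr⟩
      rw [inner_add_smul he, orthogonalProjection_add_smul he]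
      exact hs
    filter_upwards [hopen.mem_nhds hmem] with x hx
    rw [hdec x]
    exact hsupp _ _ hx.1 (by rw [← hdec x]; exact hx.2)
  rw [hev.fderiv_eq]
  simp

/-- Divergence theorem on the epigraph of a Lipschitz function. -/
theorem integral_fderiv_epigraph (he : ‖e‖ = 1) (hg : LipschitzWith K g)
    (hdiff : ∀ (y : (ℝ ∙ e)ᗮ) (s : ℝ), g y < s → DifferentiableAt ℝ F ((y : E) + s • e))
    (hbound : ∀ (y : (ℝ ∙ e)ᗮ) (s : ℝ), g y < s → ‖fderiv ℝ F ((y : E) + s • e)‖ ≤ C)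
    (hcont : ∀ y : (ℝ ∙ e)ᗮ, ContinuousWithinAt (fun s => F ((y : E) + s • e)) (Ici (g y)) (g y))
    (hsupp : ∀ (y : (ℝ ∙ e)ᗮ) (s : ℝ), g y < s → r < ‖(y : E) + s • e‖ → F ((y : E) + s • e) = 0)
    (w : (ℝ ∙ e)ᗮ) (c : ℝ) :
    ∫ y : (ℝ ∙ e)ᗮ, ∫ σ in Ioi (0 : ℝ),
        fderiv ℝ F ((y : E) + (g y + σ) • e) ((w : E) + c • e)
      = ∫ y : (ℝ ∙ e)ᗮ, F (graphMap e g y) * (fderiv ℝ g y w - c) := by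
  set Ψ : E → (ℝ ∙ e)ᗮ → ℝ → ℝ := fun v y σ => fderiv ℝ F ((y : E) + (g y + σ) • e) v with hΨ
  have hpt : Continuous fun q : (ℝ ∙ e)ᗮ × ℝ => (q.1 : E) + (g q.1 + q.2) • e := by
    have := hg.continuous
    fun_prop
  have hmeas : ∀ v, Measurable fun q : (ℝ ∙ e)ᗮ × ℝ => Ψ v q.1 q.2 := fun v =>
    (measurable_fderiv_apply_const ℝ F v).comp hpt.measurable
  have hzero : ∀ (y : (ℝ ∙ e)ᗮ) (σ : ℝ), 0 < σ → r < ‖(y : E) + (g y + σ) • e‖ →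
      fderiv ℝ F ((y : E) + (g y + σ) • e) = 0 := fun y σ hσ hr =>
    fderiv_eq_zero_of_epigraph he hg.continuous hsupp (by linarith) hr
  -- In the coordinates `(y, σ)`, with `σ` the height above the graph, the support of `F` lies in
  -- the box `‖y‖ ≤ r`, `σ ≤ r + G`. A constant on this box is the integrable majorant of the
  -- derivatives.
  obtain ⟨G, hG⟩ : ∃ G : ℝ, ∀ y : (ℝ ∙ e)ᗮ, ‖y‖ ≤ r → |g y| ≤ G := by
    refine ⟨|g 0| + K * r, fun y hy => ?_⟩
    have h1 := hg.dist_le_mul y 0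
    rw [dist_zero_right, Real.dist_eq] at h1
    have h2 : (K : ℝ) * ‖y‖ ≤ K * r := by gcongr
    have h3 := abs_sub_abs_le_abs_sub (g y) (g 0)
    linarith
  have habs : ∀ (y : (ℝ ∙ e)ᗮ) (s : ℝ), |s| ≤ ‖(y : E) + s • e‖ := fun y s => by
    have := norm_sq_add_smul he y s
    exact abs_le_of_sq_le_sq (by nlinarith [sq_nonneg ‖y‖]) (norm_nonneg _)
  have hout : ∀ (y : (ℝ ∙ e)ᗮ) (σ : ℝ), 0 < σ → ¬ (‖y‖ ≤ r ∧ σ ≤ r + G) →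
      r < ‖(y : E) + (g y + σ) • e‖ := by
    intro y σ hσ h
    by_contra! hcon
    refine h ⟨(norm_le_norm_add_smul he y _).trans hcon, ?_⟩
    have h1 := (habs y (g y + σ)).trans hcon
    have h2 := hG y ((norm_le_norm_add_smul he y _).trans hcon)
    linarith [(abs_le.1 h1).2, (abs_le.1 h2).1]
  -- joint integrability
  have hint : ∀ v, Integrable (fun q : (ℝ ∙ e)ᗮ × ℝ => Ψ v q.1 q.2)
      (volume.prod (volume.restrict (Ioi 0))) := by
    intro v
    have hbox : Integrable ((Metric.closedBall (0 : (ℝ ∙ e)ᗮ) r ×ˢ Icc 0 (r + G)).indicator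
        fun _ => (C : ℝ) * ‖v‖) (volume.prod (volume.restrict (Ioi (0 : ℝ)))) := by
      rw [integrable_indicator_iff (measurableSet_closedBall.prod measurableSet_Icc)]
      refine integrableOn_const ?_ (by finiteness)
      rw [Measure.prod_prod]
      refine ENNReal.mul_ne_top measure_closedBall_lt_top.ne ?_
      exact ((Measure.restrict_apply_le _ _).trans_lt measure_Icc_lt_top).ne
    refine hbox.mono' (hmeas v).aestronglyMeasurable ?_
    have : ∀ᵐ q : (ℝ ∙ e)ᗮ × ℝ ∂(volume.prod (volume.restrict (Ioi (0 : ℝ)))), 0 < q.2 :=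
      Measure.quasiMeasurePreserving_snd.ae (ae_restrict_mem measurableSet_Ioi)
    filter_upwards [this] with q hq
    by_cases hb : ‖q.1‖ ≤ r ∧ q.2 ≤ r + G
    · rw [indicator_of_mem (by exact ⟨by simpa using hb.1, hq.le, hb.2⟩)]
      refine (ContinuousLinearMap.le_opNorm _ _).trans ?_
      gcongr
      exact hbound _ _ (by linarith)
    · simp only [hΨ]
      rw [hzero _ _ hq (hout _ _ hq hb)]
      simpa using indicator_nonneg (fun _ _ => by positivity) _
  have hpt_deriv : ∀ (y : (ℝ ∙ e)ᗮ) (σ : ℝ),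
      HasDerivAt (fun σ : ℝ => (y : E) + (g y + σ) • e) e σ := by
    intro y σ
    have := (((hasDerivAt_id σ).const_add (g y)).smul_const e).const_add (y : E)
    simpa using this
  -- vertical direction
  have hvert : ∀ y, IntegrableOn (Ψ e y) (Ioi 0) → ∫ σ in Ioi (0 : ℝ), Ψ e y σ
      = - F (graphMap e g y) := by
    intro y hy
    have := integral_Ioi_of_hasDerivAt_of_tendsto
      (f := fun σ => F ((y : E) + (g y + σ) • e)) (f' := Ψ e y) (a := 0) (m := 0) ?_ ?_ hy ?_
    · simpa [graphMap] using this
    · have h1 : ContinuousWithinAt (fun σ : ℝ => g y + σ) (Ici 0) 0 := by fun_prop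
      have h2 : MapsTo (fun σ : ℝ => g y + σ) (Ici 0) (Ici (g y)) := fun σ hσ => by
        simpa using hσ
      have := ContinuousWithinAt.comp (t := Ici (g y)) (x := (0 : ℝ)) (f := fun σ => g y + σ)
        (g := fun s => F ((y : E) + s • e)) (by simpa using hcont y) h1 h2
      exact this
    · intro σ hσ
      exact (hdiff y _ (by simpa using hσ)).hasFDerivAt.comp_hasDerivAt σ (hpt_deriv y σ)
    · refine tendsto_const_nhds.congr' ?_
      filter_upwards [eventually_gt_atTop (max 0 (r + G))] with σ hσ
      have h0 : 0 < σ := (le_max_left _ _).trans_lt hσ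
      refine (hsupp y _ (by linarith) (hout y σ h0 fun h => ?_)).symm
      exact absurd h.2 (not_le.2 ((le_max_right _ _).trans_lt hσ))
  -- tangential direction, on one layer
  have hlayer : ∀ σ, 0 < σ → Integrable (fun y => Ψ w y σ) → Integrable (fun y => Ψ e y σ) →
      ∫ y, Ψ w y σ = - ∫ y, fderiv ℝ g y w * Ψ e y σ := by
    intro σ hσ hw he'
    have hlip := lipschitzWith_epigraph_layer he hg hdiff hbound hσ
    have hcs : HasCompactSupport fun y : (ℝ ∙ e)ᗮ => F ((y : E) + (g y + σ) • e) := by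
      refine HasCompactSupport.of_support_subset_isCompact (isCompact_closedBall 0 r) ?_
      intro y hy
      by_contra hcon
      rw [mem_closedBall_zero_iff, not_le] at hcon
      exact hy (hsupp y _ (by linarith) (hcon.trans_le (norm_le_norm_add_smul he y _)))
    have h0 := integral_lineDeriv_eq_zero (μ := volume) hlip hcs w
    -- Chain rule at the points where `g` is differentiable: moving by `w` along the layer also
    -- moves vertically at the rate `fderiv ℝ g y w`. The integral of the total derivative is zero,
    -- which expresses the tangential derivative by the vertical one.
    have hae : (fun y => lineDeriv ℝ (fun y : (ℝ ∙ e)ᗮ => F ((y : E) + (g y + σ) • e)) y w)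
        =ᵐ[volume] fun y => Ψ w y σ + fderiv ℝ g y w * Ψ e y σ := by
      filter_upwards [hg.ae_differentiableAt (μ := volume)] with y hy
      have h1 : HasFDerivAt (fun y : (ℝ ∙ e)ᗮ => (y : E) + (g y + σ) • e)
          ((ℝ ∙ e)ᗮ.subtypeL + (fderiv ℝ g y).smulRight e) y :=
        (ℝ ∙ e)ᗮ.subtypeL.hasFDerivAt.add ((hy.hasFDerivAt.add_const σ).smul_const e)
      have h2 := ((hdiff y _ (by linarith)).hasFDerivAt.comp y h1).hasLineDerivAt w
      refine h2.lineDeriv.trans ?_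
      simp [hΨ]
    rw [integral_congr_ae hae, integral_add hw] at h0
    · linarith
    · refine he'.bdd_mul (c := K * ‖w‖) (measurable_fderiv_apply_const ℝ g w).aestronglyMeasurable
        (ae_of_all _ fun y => ?_)
      exact (ContinuousLinearMap.le_opNorm _ _).trans
        (by gcongr; exact norm_fderiv_le_of_lipschitz ℝ hg)
  -- assemble
  have hfst : ∀ v, ∀ᵐ y : (ℝ ∙ e)ᗮ, IntegrableOn (Ψ v y) (Ioi 0) := fun v =>
    (hint v).prod_right_ae
  have hsnd : ∀ v, ∀ᵐ σ ∂(volume.restrict (Ioi (0 : ℝ))), Integrable (fun y => Ψ v y σ) :=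
    fun v => (hint v).prod_left_ae
  have hinte : Integrable (fun q : (ℝ ∙ e)ᗮ × ℝ => fderiv ℝ g q.1 w * Ψ e q.1 q.2)
      (volume.prod (volume.restrict (Ioi 0))) := by
    refine (hint e).bdd_mul (c := K * ‖w‖)
      ((measurable_fderiv_apply_const ℝ g w).comp measurable_fst).aestronglyMeasurable
      (ae_of_all _ fun q => ?_)
    exact (ContinuousLinearMap.le_opNorm _ _).trans
      (by gcongr; exact norm_fderiv_le_of_lipschitz ℝ hg)
  -- Fubini twice: the layer identity is used for fixed `σ`, and the resulting vertical derivative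
  -- is then integrated for fixed `y`, where it gives the boundary value of `F`.
  have hW : ∫ y, ∫ σ in Ioi (0 : ℝ), Ψ w y σ = ∫ y, fderiv ℝ g y w * F (graphMap e g y) := by
    calc ∫ y, ∫ σ in Ioi (0 : ℝ), Ψ w y σ = ∫ σ in Ioi (0 : ℝ), ∫ y, Ψ w y σ :=
          integral_integral_swap (hint w)
      _ = ∫ σ in Ioi (0 : ℝ), - ∫ y, fderiv ℝ g y w * Ψ e y σ := by
          refine integral_congr_ae ?_
          filter_upwards [hsnd w, hsnd e, ae_restrict_mem measurableSet_Ioi] with σ h1 h2 h3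
          exact hlayer σ h3 h1 h2
      _ = - ∫ y, ∫ σ in Ioi (0 : ℝ), fderiv ℝ g y w * Ψ e y σ := by
          rw [integral_neg, ← integral_integral_swap hinte]
      _ = ∫ y, fderiv ℝ g y w * F (graphMap e g y) := by
          rw [← integral_neg]
          refine integral_congr_ae ?_
          filter_upwards [hfst e] with y hy
          rw [integral_const_mul, hvert y hy]
          ring
  have hEe : ∫ y, ∫ σ in Ioi (0 : ℝ), Ψ e y σ = - ∫ y, F (graphMap e g y) := by
    rw [← integral_neg]
    refine integral_congr_ae ?_
    filter_upwards [hfst e] with y hy using hvert y hy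
  have hIe : Integrable fun y => F (graphMap e g y) := by
    have := (hint e).integral_prod_left.neg
    refine this.congr ?_
    filter_upwards [hfst e] with y hy
    simp only [Pi.neg_apply]
    rw [hvert y hy, neg_neg]
  have hIw : Integrable fun y => fderiv ℝ g y w * F (graphMap e g y) := by
    refine hIe.bdd_mul (c := K * ‖w‖) (measurable_fderiv_apply_const ℝ g w).aestronglyMeasurable
      (ae_of_all _ fun y => ?_)
    exact (ContinuousLinearMap.le_opNorm _ _).trans
      (by gcongr; exact norm_fderiv_le_of_lipschitz ℝ hg)
  calc _ = ∫ y : (ℝ ∙ e)ᗮ, (∫ σ in Ioi (0 : ℝ), Ψ w y σ) + c * ∫ σ in Ioi (0 : ℝ), Ψ e y σ := by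
        refine integral_congr_ae ?_
        filter_upwards [hfst e, hfst w] with y h1 h2
        rw [← integral_const_mul, ← integral_add h2 (h1.const_mul c)]
        simp [hΨ]
    _ = (∫ y, fderiv ℝ g y w * F (graphMap e g y)) - c * ∫ y, F (graphMap e g y) := by
        rw [integral_add (hint w).integral_prod_left ((hint e).integral_prod_left.const_mul c),
          integral_const_mul, hW, hEe]
        ring
    _ = _ := by
        rw [← integral_const_mul, ← integral_sub hIw (hIe.const_mul c)]
        congr 1
        ext y
        ring

end Epigraph

/-! ### The outer normal -/

section Normal

variable {d : ℕ} {Ω : Set (E d)}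

/-- If `n` and `n'` differed, a short step from `x` in the direction `n' - n` would enter `Ω`
according to `n` and leave its closure according to `n'`. -/
theorem IsOuterNormal.eq {x n n' : E d} (h : IsOuterNormal Ω x n) (h' : IsOuterNormal Ω x n') :
    n = n' := by
  by_contra hne
  have hlt : inner ℝ n n' < 1 := inner_lt_one_iff_real_of_norm_eq_one h.1 h'.1 |>.2 hne
  set w : E d := n' - n with hw
  have hw0 : w ≠ 0 := sub_ne_zero.2 (Ne.symm hne)
  have h1 : inner ℝ n w = inner ℝ n n' - 1 := by
    rw [hw, inner_sub_right, real_inner_self_eq_norm_sq, h.1]; ring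
  have h2 : inner ℝ n' w = 1 - inner ℝ n n' := by
    rw [hw, inner_sub_right, real_inner_self_eq_norm_sq, h'.1, real_inner_comm]; ring
  -- Chosen so that `ε‖w‖` is half of `1 - ⟪n, n'⟫`, the size of the inner products of `w` with the
  -- two normals; both strict inequalities then hold.
  set ε : ℝ := (1 - inner ℝ n n') / (2 * ‖w‖) with hε
  have hwpos : 0 < ‖w‖ := norm_pos_iff.2 hw0
  have hεpos : 0 < ε := div_pos (by linarith) (by positivity)
  have hεw : ε * ‖w‖ = (1 - inner ℝ n n') / 2 := by
    rw [hε]; field_simp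
  have htend : Tendsto (fun s : ℝ => x + s • w) (𝓝[>] 0) (𝓝 x) := by
    refine Tendsto.mono_left ?_ nhdsWithin_le_nhds
    have : Continuous fun s : ℝ => x + s • w := by fun_prop
    simpa using this.tendsto 0
  obtain ⟨s, ⟨h3, h4⟩, hs⟩ := ((htend.eventually ((h.2 ε hεpos).and (h'.2 ε hεpos))).and
    self_mem_nhdsWithin).exists
  have hs0 : (0 : ℝ) < s := hs
  have hnorm : ε * ‖x + s • w - x‖ = s * ((1 - inner ℝ n n') / 2) := by
    rw [add_sub_cancel_left, norm_smul, Real.norm_of_nonneg hs0.le, ← hεw]; ring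
  refine h4.2 ?_ (subset_closure (h3.1 ?_))
  · rw [hnorm, add_sub_cancel_left, inner_smul_right, h2]
    nlinarith
  · rw [hnorm, add_sub_cancel_left, inner_smul_right, h1]
    nlinarith

theorem IsOuterNormal.outerNormal_eq {x n : E d} (h : IsOuterNormal Ω x n) :
    outerNormal Ω x = n := by
  have hex : ∃ n, IsOuterNormal Ω x n := ⟨n, h⟩
  rw [outerNormal, dif_pos hex]
  exact hex.choose_spec.eq h

theorem norm_outerNormal_le (x : E d) : ‖outerNormal Ω x‖ ≤ 1 := by
  by_cases hex : ∃ n, IsOuterNormal Ω x n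
  · rw [hex.choose_spec.outerNormal_eq]
    exact hex.choose_spec.1.le
  · rw [outerNormal, dif_neg hex, norm_zero]
    exact zero_le_one

/-- The quantifiers over `ε` and over the radius of the neighbourhood can be restricted to the
countably many values `1/(k+1)` and `1/(l+1)`. For fixed values the condition, being imposed for
every `y`, is an intersection of closed conditions on the pair `(x, n)`. No regularity of `Ω`
enters. -/
theorem measurableSet_isOuterNormal (Ω : Set (E d)) :
    MeasurableSet {q : E d × E d | IsOuterNormal Ω q.1 q.2} := by
  have hclosed : ∀ ε δ : ℝ, IsClosed {q : E d × E d | ∀ y, dist y q.1 < δ →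
      (inner ℝ q.2 (y - q.1) < -(ε * ‖y - q.1‖) → y ∈ Ω) ∧
      (ε * ‖y - q.1‖ < inner ℝ q.2 (y - q.1) → y ∉ closure Ω)} := by
    intro ε δ
    simp only [ofPred_forall]
    refine isClosed_iInter fun y => ?_
    have hopen : ∀ p : Prop, ∀ A B : E d × E d → ℝ, Continuous A → Continuous B →
        IsClosed {q : E d × E d | dist y q.1 < δ → A q < B q → p} := by
      intro p A B hA hB
      by_cases hp : p
      · simp [hp]
      · have : {q : E d × E d | dist y q.1 < δ → A q < B q → p}
            = ({q | dist y q.1 < δ} ∩ {q | A q < B q})ᶜ := by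
          ext q; simp [hp]
        rw [this]
        exact ((isOpen_lt (by fun_prop) continuous_const).inter (isOpen_lt hA hB)).isClosed_compl
    have h1 := hopen (y ∈ Ω) (fun q => inner ℝ q.2 (y - q.1)) (fun q => -(ε * ‖y - q.1‖))
      (by fun_prop) (by fun_prop)
    have h2 := hopen (y ∉ closure Ω) (fun q => ε * ‖y - q.1‖) (fun q => inner ℝ q.2 (y - q.1))
      (by fun_prop) (by fun_prop)
    convert! h1.inter h2 using 1
    ext q
    simp only [mem_ofPred_eq, mem_inter_iff]
    tauto
  have hset : {q : E d × E d | IsOuterNormal Ω q.1 q.2} = {q | ‖q.2‖ = 1} ∩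
      ⋂ k : ℕ, ⋃ l : ℕ, {q : E d × E d | ∀ y, dist y q.1 < 1 / ((l : ℝ) + 1) →
      (inner ℝ q.2 (y - q.1) < -(1 / ((k : ℝ) + 1) * ‖y - q.1‖) → y ∈ Ω) ∧
      (1 / ((k : ℝ) + 1) * ‖y - q.1‖ < inner ℝ q.2 (y - q.1) → y ∉ closure Ω)} := by
    ext ⟨x, n⟩
    simp only [IsOuterNormal, mem_ofPred_eq, mem_inter_iff, mem_iInter, mem_iUnion]
    refine and_congr_right fun _ => ⟨fun h k => ?_, fun h ε hε => ?_⟩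
    · obtain ⟨δ, hδ, hb⟩ := Metric.eventually_nhds_iff.1 (h (1 / ((k : ℝ) + 1)) (by positivity))
      obtain ⟨l, hl⟩ := exists_nat_one_div_lt hδ
      exact ⟨l, fun y hy => hb (hy.trans hl)⟩
    · obtain ⟨k, hk⟩ := exists_nat_one_div_lt hε
      obtain ⟨l, hl⟩ := h k
      refine Metric.eventually_nhds_iff.2 ⟨1 / ((l : ℝ) + 1), by positivity, fun y hy => ?_⟩
      have hle : 1 / ((k : ℝ) + 1) * ‖y - x‖ ≤ ε * ‖y - x‖ := by gcongr
      exact ⟨fun h1 => (hl y hy).1 (by linarith), fun h1 => (hl y hy).2 (by linarith)⟩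
  rw [hset]
  refine (measurableSet_eq_fun (by fun_prop) measurable_const).inter ?_
  exact MeasurableSet.iInter fun k => MeasurableSet.iUnion fun l => (hclosed _ _).measurableSet

/-- The pairs of a point and its normal form a Borel set on which, by uniqueness, the first
projection is injective. Injective Borel images are Borel (Lusin–Souslin), so preimages under
`outerNormal` are too, with the points having no normal treated separately. -/
theorem measurable_outerNormal (Ω : Set (E d)) : Measurable (outerNormal Ω) := by
  have himg : ∀ B : Set (E d), MeasurableSet B →
      MeasurableSet (Prod.fst '' ({q : E d × E d | IsOuterNormal Ω q.1 q.2} ∩ Prod.snd ⁻¹' B)) := by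
    intro B hB
    refine ((measurableSet_isOuterNormal Ω).inter (measurable_snd hB)).image_of_measurable_injOn
      measurable_fst ?_
    rintro ⟨x, n⟩ hq ⟨x', n'⟩ hq' (rfl : x = x')
    exact Prod.ext rfl (hq.1.eq hq'.1)
  intro B hB
  have hdom := himg univ MeasurableSet.univ
  have hpre : outerNormal Ω ⁻¹' B
      = (Prod.fst '' ({q : E d × E d | IsOuterNormal Ω q.1 q.2} ∩ Prod.snd ⁻¹' B)) ∪
        ((Prod.fst '' ({q : E d × E d | IsOuterNormal Ω q.1 q.2} ∩ Prod.snd ⁻¹' univ))ᶜ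
          ∩ {_x | (0 : E d) ∈ B}) := by
    ext x
    by_cases hex : ∃ n, IsOuterNormal Ω x n
    · obtain ⟨n, hn⟩ := hex
      simp only [mem_preimage, hn.outerNormal_eq, mem_union, mem_image, mem_inter_iff,
        mem_ofPred_eq, mem_compl_iff, Prod.exists, exists_and_right, exists_eq_right, mem_univ,
        and_true]
      constructor
      · exact fun h => Or.inl ⟨n, hn, h⟩
      · rintro (⟨n', hn', h⟩ | ⟨h, -⟩)
        · rwa [hn.eq hn']
        · exact absurd ⟨n, hn⟩ h
    · have h0 : outerNormal Ω x = 0 := by rw [outerNormal, dif_neg hex]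
      simp only [mem_preimage, h0, mem_union, mem_image, mem_inter_iff,
        mem_ofPred_eq, mem_compl_iff, Prod.exists, exists_and_right, exists_eq_right, mem_univ,
        and_true]
      constructor
      · exact fun h => Or.inr ⟨hex, h⟩
      · rintro (⟨n', hn', h⟩ | ⟨-, h⟩)
        · exact absurd ⟨n', hn'⟩ hex
        · exact h
  rw [hpre]
  exact (himg B hB).union (hdom.compl.inter (MeasurableSet.const _))

end Normal

/-! ### Boundary charts of Lipschitz domains -/

section Chart

variable {d : ℕ} {Ω : Set (E d)}

/-- Near `x₀` the set `Ω` is the strict epigraph of the Lipschitz function `g` in direction `e`. -/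
structure IsBoundaryChart (Ω : Set (E d)) (x₀ : E d) (ρ : ℝ) (e : E d) (K : ℝ≥0)
    (g : (ℝ ∙ e)ᗮ → ℝ) : Prop where
  pos : 0 < ρ
  unit : ‖e‖ = 1
  lip : LipschitzWith K g
  mem_iff : ∀ (y : (ℝ ∙ e)ᗮ) (s : ℝ), (y : E d) + s • e ∈ Metric.ball x₀ ρ →
    ((y : E d) + s • e ∈ Ω ↔ g y < s)

theorem IsBoundedLipschitzDomain.exists_chart (h : IsBoundedLipschitzDomain Ω) {x₀ : E d}
    (hx : x₀ ∈ frontier Ω) : ∃ ρ e K g, IsBoundaryChart Ω x₀ ρ e K g := by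
  obtain ⟨ρ, hρ, e, he, K, g, hg, hmem⟩ := h.graph x₀ hx
  refine ⟨ρ, e, K, fun y => g y, hρ, he, ?_, fun y s hys => ?_⟩
  · have := hg.comp (LipschitzWith.subtype_val ((ℝ ∙ e)ᗮ : Set (E d)))
    rw [mul_one] at this
    exact this
  · rw [hmem _ hys, inner_add_smul he, add_sub_cancel_right]

variable {x₀ e : E d} {ρ : ℝ} {K : ℝ≥0} {g : (ℝ ∙ e)ᗮ → ℝ}

theorem tendsto_add_smul_right (y : (ℝ ∙ e)ᗮ) (s : ℝ) :
    Tendsto (fun s' : ℝ => (y : E d) + s' • e) (𝓝 s) (𝓝 ((y : E d) + s • e)) := by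
  have : Continuous fun s' : ℝ => (y : E d) + s' • e := by fun_prop
  exact this.tendsto s

theorem tendsto_coords (h : IsBoundaryChart Ω x₀ ρ e K g) (y : (ℝ ∙ e)ᗮ) (s : ℝ) :
    Tendsto (fun x : E d => ((ℝ ∙ e)ᗮ.orthogonalProjectionOnto x, inner ℝ e x))
      (𝓝 ((y : E d) + s • e)) (𝓝 (y, s)) := by
  have hc : Continuous fun x : E d => ((ℝ ∙ e)ᗮ.orthogonalProjectionOnto x, inner ℝ e x) := by
    fun_prop
  have := hc.tendsto ((y : E d) + s • e)
  simpa only [orthogonalProjection_add_smul h.unit, inner_add_smul h.unit] using this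

theorem IsBoundaryChart.mem_iff' (h : IsBoundaryChart Ω x₀ ρ e K g) {x : E d}
    (hx : x ∈ Metric.ball x₀ ρ) :
    x ∈ Ω ↔ g ((ℝ ∙ e)ᗮ.orthogonalProjectionOnto x) < inner ℝ e x := by
  have hdec := orthogonalProjection_add_inner_smul h.unit x
  have := h.mem_iff ((ℝ ∙ e)ᗮ.orthogonalProjectionOnto x) (inner ℝ e x) (by rwa [← hdec])
  rwa [← hdec] at this

theorem IsBoundaryChart.mem_closure_iff (h : IsBoundaryChart Ω x₀ ρ e K g) {y : (ℝ ∙ e)ᗮ} {s : ℝ}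
    (hys : (y : E d) + s • e ∈ Metric.ball x₀ ρ) :
    (y : E d) + s • e ∈ closure Ω ↔ g y ≤ s := by
  have hball := Metric.isOpen_ball.mem_nhds hys
  constructor
  · intro hcl
    by_contra! hlt
    have hev : ∀ᶠ x in 𝓝 ((y : E d) + s • e), x ∉ Ω := by
      have hlt' : ∀ᶠ q : (ℝ ∙ e)ᗮ × ℝ in 𝓝 (y, s), q.2 < g q.1 := by
        have hc : Continuous fun q : (ℝ ∙ e)ᗮ × ℝ => g q.1 := h.lip.continuous.comp continuous_fst
        exact (isOpen_lt continuous_snd hc).mem_nhds hlt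
      filter_upwards [(tendsto_coords h y s).eventually hlt', hball] with x hx hxb
      rw [h.mem_iff' hxb]
      exact not_lt.2 hx.le
    exact (mem_closure_iff_frequently.1 hcl) hev
  · intro hle
    rw [mem_closure_iff_frequently]
    have htend : Tendsto (fun s' : ℝ => (y : E d) + s' • e) (𝓝[>] s) (𝓝 ((y : E d) + s • e)) :=
      (tendsto_add_smul_right y s).mono_left nhdsWithin_le_nhds
    refine htend.frequently (Eventually.frequently ?_)
    filter_upwards [htend.eventually hball, self_mem_nhdsWithin] with s' hs' hlt
    exact (h.mem_iff y s' hs').2 (lt_of_le_of_lt hle hlt)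

theorem IsBoundaryChart.mem_frontier_iff (h : IsBoundaryChart Ω x₀ ρ e K g) (hΩ : IsOpen Ω)
    {y : (ℝ ∙ e)ᗮ} {s : ℝ} (hys : (y : E d) + s • e ∈ Metric.ball x₀ ρ) :
    (y : E d) + s • e ∈ frontier Ω ↔ s = g y := by
  rw [hΩ.frontier_eq, Set.mem_sdiff, h.mem_closure_iff hys, h.mem_iff y s hys, not_lt]
  exact ⟨fun h => le_antisymm h.2 h.1, fun h => ⟨h.ge, h.le⟩⟩

theorem IsBoundaryChart.frontier_inter_ball (h : IsBoundaryChart Ω x₀ ρ e K g) (hΩ : IsOpen Ω) :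
    frontier Ω ∩ Metric.ball x₀ ρ = range (graphMap e g) ∩ Metric.ball x₀ ρ := by
  ext x
  refine and_congr_left fun hx => ?_
  have hdec := orthogonalProjection_add_inner_smul h.unit x
  rw [hdec] at hx ⊢
  rw [h.mem_frontier_iff hΩ hx]
  constructor
  · intro hs
    exact ⟨_, by rw [graphMap, ← hs]⟩
  · rintro ⟨y, hy⟩
    have h1 := congrArg (fun x => inner ℝ e x) hy
    have h2 := congrArg (fun x => (ℝ ∙ e)ᗮ.orthogonalProjectionOnto x) hy
    simp only [graphMap, inner_add_smul h.unit, orthogonalProjection_add_smul h.unit] at h1 h2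
    rw [← h1, h2]

/-- The set `Ω` lies above the graph, so the downward vector `∇g - e` points outwards; it has length
`√(1 + |∇g|²)`. The height of a nearby point over the tangent plane decides on which side of the
graph it is, up to the linearisation error of `g`. -/
theorem IsBoundaryChart.isOuterNormal (h : IsBoundaryChart Ω x₀ ρ e K g)
    {y : (ℝ ∙ e)ᗮ} (hy : graphMap e g y ∈ Metric.ball x₀ ρ) (hg : DifferentiableAt ℝ g y) :
    IsOuterNormal Ω (graphMap e g y)
      ((√(1 + ‖fderiv ℝ g y‖ ^ 2))⁻¹ •
        (((InnerProductSpace.toDual ℝ _).symm (fderiv ℝ g y) : (ℝ ∙ e)ᗮ) - e)) := by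
  set a : (ℝ ∙ e)ᗮ := (InnerProductSpace.toDual ℝ _).symm (fderiv ℝ g y) with ha
  have hna : ‖a‖ = ‖fderiv ℝ g y‖ := LinearIsometryEquiv.norm_map _ _
  have hinner : ∀ w : (ℝ ∙ e)ᗮ, inner ℝ (a : E d) (w : E d) = fderiv ℝ g y w := fun w => by
    rw [← Submodule.coe_inner, ha, InnerProductSpace.toDual_symm_apply]
  set J := √(1 + ‖fderiv ℝ g y‖ ^ 2) with hJ
  have hJ1 : 1 ≤ J := Real.one_le_sqrt.2 (by nlinarith [sq_nonneg ‖fderiv ℝ g y‖])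
  have hJ0 : 0 < J := by linarith
  have hnorm : ‖(a : E d) - e‖ = J := by
    have := norm_sq_add_smul h.unit a (-1)
    rw [neg_one_smul, ← sub_eq_add_neg, hna] at this
    rw [hJ, ← Real.sqrt_sq (norm_nonneg ((a : E d) - e)), this]
    ring_nf
  refine ⟨by rw [norm_smul, hnorm, norm_inv, Real.norm_of_nonneg hJ0.le, inv_mul_cancel₀ hJ0.ne'],
    fun ε hε => ?_⟩
  have hlin : ∀ᶠ y' in 𝓝 y, ‖g y' - g y - fderiv ℝ g y (y' - y)‖ ≤ ε * ‖y' - y‖ :=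
    hg.hasFDerivAt.isLittleO.def hε
  have hlin' := (tendsto_fst.comp (nhds_prod_eq (x := y) (y := g y) ▸
    tendsto_coords h y (g y))).eventually hlin
  filter_upwards [hlin', Metric.isOpen_ball.mem_nhds hy] with p hp hpb
  simp only [Function.comp] at hp
  set y' := (ℝ ∙ e)ᗮ.orthogonalProjectionOnto p with hy'
  set s := inner ℝ e p with hs
  have hdec : p = (y' : E d) + s • e := orthogonalProjection_add_inner_smul h.unit p
  have hdiff : p - graphMap e g y = ((y' - y : (ℝ ∙ e)ᗮ) : E d) + (s - g y) • e := by
    rw [hdec, graphMap]; push_cast; module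
  have hle : ‖y' - y‖ ≤ ‖p - graphMap e g y‖ := by
    rw [hdiff]; exact norm_le_norm_add_smul h.unit _ _
  have hip : inner ℝ (J⁻¹ • ((a : E d) - e)) (p - graphMap e g y)
      = J⁻¹ * (fderiv ℝ g y (y' - y) - (s - g y)) := by
    rw [inner_smul_left, hdiff, inner_sub_left, inner_add_right, hinner, inner_add_smul h.unit,
      inner_smul_right, real_inner_comm, inner_orthogonal_left]
    simp
  rw [hip]
  rw [Real.norm_eq_abs, abs_le] at hp
  -- The error in the horizontal variable is dominated by the distance in space, and `1 ≤ J` absorbs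
  -- the normalising factor.
  have h1 : ε * ‖y' - y‖ ≤ J * (ε * ‖p - graphMap e g y‖) := by
    calc ε * ‖y' - y‖ ≤ ε * ‖p - graphMap e g y‖ := by gcongr
      _ ≤ J * (ε * ‖p - graphMap e g y‖) := le_mul_of_one_le_left (by positivity) hJ1
  constructor
  · intro hlt
    rw [← div_eq_inv_mul, div_lt_iff₀ hJ0] at hlt
    rw [h.mem_iff' hpb]
    linarith [hp.2]
  · intro hlt
    rw [← div_eq_inv_mul, lt_div_iff₀ hJ0] at hlt
    rw [hdec, h.mem_closure_iff (by rwa [← hdec]), not_le]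
    linarith [hp.1]

/-- Near a boundary point `Ω` contains the open vertical cone of slope `K` with vertex there. A
convex set with interior points determines derivatives at the points of its closure, so derivatives
within `closure Ω` are meaningful up to the boundary. -/
theorem IsBoundaryChart.uniqueDiffWithinAt (h : IsBoundaryChart Ω x₀ ρ e K g)
    (hx : x₀ ∈ frontier Ω) : UniqueDiffWithinAt ℝ (closure Ω) x₀ := by
  set y₀ := (ℝ ∙ e)ᗮ.orthogonalProjectionOnto x₀ with hy₀
  set s₀ : ℝ := inner ℝ e x₀ with hs₀
  have hdec : x₀ = (y₀ : E d) + s₀ • e := orthogonalProjection_add_inner_smul h.unit x₀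
  have hle : g y₀ ≤ s₀ := by
    rw [← h.mem_closure_iff (by rw [← hdec]; exact Metric.mem_ball_self h.pos), ← hdec]
    exact frontier_subset_closure hx
  let C : Set (E d) := Metric.ball x₀ ρ ∩
    {p | K * ‖(ℝ ∙ e)ᗮ.orthogonalProjectionOnto p - y₀‖ < inner ℝ e p - s₀}
  have hopen : IsOpen C := Metric.isOpen_ball.inter (isOpen_lt (by fun_prop) (by fun_prop))
  have hconv : Convex ℝ C := by
    refine (convex_ball _ _).inter fun p hp q hq α β hα hβ hαβ => ?_
    simp only [mem_ofPred_eq] at hp hq ⊢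
    have h1 : (ℝ ∙ e)ᗮ.orthogonalProjectionOnto (α • p + β • q) - y₀
        = α • ((ℝ ∙ e)ᗮ.orthogonalProjectionOnto p - y₀)
          + β • ((ℝ ∙ e)ᗮ.orthogonalProjectionOnto q - y₀) := by
      obtain rfl : β = 1 - α := by linarith
      rw [map_add, map_smul, map_smul]; module
    have h2 : inner ℝ e (α • p + β • q) - s₀
        = α * (inner ℝ e p - s₀) + β * (inner ℝ e q - s₀) := by
      obtain rfl : β = 1 - α := by linarith
      rw [inner_add_right, inner_smul_right, inner_smul_right]; ring
    rw [h1, h2]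
    have h3 := norm_add_le (α • ((ℝ ∙ e)ᗮ.orthogonalProjectionOnto p - y₀))
      (β • ((ℝ ∙ e)ᗮ.orthogonalProjectionOnto q - y₀))
    rw [norm_smul, norm_smul, Real.norm_of_nonneg hα, Real.norm_of_nonneg hβ] at h3
    have h4 : (K : ℝ) * ‖α • ((ℝ ∙ e)ᗮ.orthogonalProjectionOnto p - y₀)
        + β • ((ℝ ∙ e)ᗮ.orthogonalProjectionOnto q - y₀)‖
        ≤ α * (K * ‖(ℝ ∙ e)ᗮ.orthogonalProjectionOnto p - y₀‖)
          + β * (K * ‖(ℝ ∙ e)ᗮ.orthogonalProjectionOnto q - y₀‖) := by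
      calc _ ≤ (K : ℝ) * (α * ‖(ℝ ∙ e)ᗮ.orthogonalProjectionOnto p - y₀‖
            + β * ‖(ℝ ∙ e)ᗮ.orthogonalProjectionOnto q - y₀‖) := by gcongr
        _ = _ := by ring
    rcases hα.eq_or_lt with rfl | hα'
    · obtain rfl : β = 1 := by linarith
      linarith
    · have : α * (K * ‖(ℝ ∙ e)ᗮ.orthogonalProjectionOnto p - y₀‖)
          < α * (inner ℝ e p - s₀) := by gcongr
      have : β * (K * ‖(ℝ ∙ e)ᗮ.orthogonalProjectionOnto q - y₀‖)
          ≤ β * (inner ℝ e q - s₀) := by gcongr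
      linarith
  have hsub : C ⊆ closure Ω := by
    rintro p ⟨hpb, hp⟩
    refine subset_closure ((h.mem_iff' hpb).2 ?_)
    have := (abs_le.1 (h.lip.dist_le_mul ((ℝ ∙ e)ᗮ.orthogonalProjectionOnto p) y₀)).2
    rw [dist_eq_norm] at this
    simp only [mem_ofPred_eq] at hp
    linarith
  have hmem : ∀ᶠ s in 𝓝[>] s₀, (y₀ : E d) + s • e ∈ C := by
    have htend : Tendsto (fun s' : ℝ => (y₀ : E d) + s' • e) (𝓝[>] s₀) (𝓝 x₀) := by
      conv in 𝓝 x₀ => rw [hdec]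
      exact (tendsto_add_smul_right y₀ s₀).mono_left nhdsWithin_le_nhds
    filter_upwards [htend.eventually (Metric.ball_mem_nhds x₀ h.pos), self_mem_nhdsWithin]
      with s h1 h2
    refine ⟨h1, ?_⟩
    simp only [mem_ofPred_eq, orthogonalProjection_add_smul h.unit, inner_add_smul h.unit, sub_self,
      norm_zero, mul_zero, sub_pos]
    exact h2
  have hclos : x₀ ∈ closure C := by
    have htend : Tendsto (fun s' : ℝ => (y₀ : E d) + s' • e) (𝓝[>] s₀) (𝓝 x₀) := by
      conv in 𝓝 x₀ => rw [hdec]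
      exact (tendsto_add_smul_right y₀ s₀).mono_left nhdsWithin_le_nhds
    exact mem_closure_of_tendsto htend hmem
  refine (uniqueDiffWithinAt_convex hconv ?_ hclos).mono hsub
  rw [hopen.interior_eq]
  obtain ⟨s, hs⟩ := hmem.exists
  exact ⟨_, hs⟩

theorem IsBoundedLipschitzDomain.uniqueDiffOn (h : IsBoundedLipschitzDomain Ω) :
    UniqueDiffOn ℝ (closure Ω) := by
  intro x hx
  by_cases hΩ : x ∈ Ω
  · exact (h.isOpen.uniqueDiffWithinAt hΩ).mono subset_closure
  · obtain ⟨ρ, e, K, g, hc⟩ := h.exists_chart (x₀ := x) (by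
      rw [h.isOpen.frontier_eq]; exact ⟨hx, hΩ⟩)
    exact hc.uniqueDiffWithinAt (by rw [h.isOpen.frontier_eq]; exact ⟨hx, hΩ⟩)

end Chart

/-! ### Surface measure in a boundary chart -/

section Surface

variable {d : ℕ} {Ω : Set (E d)} {x₀ e : E d} {ρ : ℝ} {K : ℝ≥0} {g : (ℝ ∙ e)ᗮ → ℝ}

open Module

theorem finrank_orthogonal_of_norm_eq_one (he : ‖e‖ = 1) : finrank ℝ (ℝ ∙ e)ᗮ = d - 1 := by
  have h := Submodule.finrank_add_finrank_orthogonal (ℝ ∙ e)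
  rw [finrank_span_singleton (by rintro rfl; simp at he), finrank_euclideanSpace_fin] at h
  omega

theorem IsBoundaryChart.surfaceMeasure_restrict (h : IsBoundaryChart Ω x₀ ρ e K g)
    (hΩ : IsOpen Ω) :
    (surfaceMeasure Ω).restrict (Metric.ball x₀ ρ)
      = ((volume.withDensity fun y => ENNReal.ofReal √(1 + ‖fderiv ℝ g y‖ ^ 2)).map
          (graphMap e g)).restrict (Metric.ball x₀ ρ) := by
  rw [← restrict_range_graphMap h.unit h.lip, surfaceMeasure,
    Measure.restrict_restrict Metric.isOpen_ball.measurableSet,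
    Measure.restrict_restrict Metric.isOpen_ball.measurableSet, inter_comm, inter_comm _ (range _),
    h.frontier_inter_ball hΩ, finrank_orthogonal_of_norm_eq_one h.unit]

/-- The density of the surface measure is at most `√(1 + K²)`, and the projection of the ball to the
hyperplane is bounded. -/
theorem IsBoundaryChart.surfaceMeasure_ball_lt_top (h : IsBoundaryChart Ω x₀ ρ e K g)
    (hΩ : IsOpen Ω) : surfaceMeasure Ω (Metric.ball x₀ ρ) < ⊤ := by
  have hball := Metric.isOpen_ball.measurableSet (s := Metric.ball x₀ ρ)
  rw [← Measure.restrict_apply_self, h.surfaceMeasure_restrict hΩ, Measure.restrict_apply_self]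
  have hγ := (graphMap_lipschitz h.unit h.lip).continuous.measurable
  rw [Measure.map_apply hγ hball, withDensity_apply _ (hγ hball)]
  have hsub : graphMap e g ⁻¹' Metric.ball x₀ ρ ⊆
      Metric.closedBall (0 : (ℝ ∙ e)ᗮ) (‖x₀‖ + ρ) := by
    intro y hy
    rw [mem_closedBall_zero_iff]
    refine (norm_le_norm_add_smul h.unit y (g y)).trans ?_
    have h1 : ‖graphMap e g y - x₀‖ < ρ := mem_ball_iff_norm.1 hy
    have h2 := norm_add_le x₀ (graphMap e g y - x₀)
    rw [add_sub_cancel] at h2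
    exact h2.trans (by linarith)
  calc _ ≤ ∫⁻ _ in graphMap e g ⁻¹' Metric.ball x₀ ρ, ENNReal.ofReal √(1 + (K : ℝ) ^ 2) := by
        refine lintegral_mono fun y => ENNReal.ofReal_le_ofReal (Real.sqrt_le_sqrt ?_)
        gcongr
        exact norm_fderiv_le_of_lipschitz ℝ h.lip
    _ ≤ ENNReal.ofReal √(1 + (K : ℝ) ^ 2) 
        * volume (Metric.closedBall (0 : (ℝ ∙ e)ᗮ) (‖x₀‖ + ρ)) := by
        rw [setLIntegral_const]
        gcongr
    _ < ⊤ := ENNReal.mul_lt_top ENNReal.ofReal_lt_top measure_closedBall_lt_top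

theorem IsBoundedLipschitzDomain.isCompact_closure (h : IsBoundedLipschitzDomain Ω) :
    IsCompact (closure Ω) := h.isBounded.isCompact_closure

theorem IsBoundedLipschitzDomain.isFiniteMeasure_surfaceMeasure
    (h : IsBoundedLipschitzDomain Ω) : IsFiniteMeasure (surfaceMeasure Ω) := by
  refine ⟨?_⟩
  have hc : IsCompact (frontier Ω) :=
    h.isCompact_closure.of_isClosed_subset isClosed_frontier frontier_subset_closure
  have h1 : surfaceMeasure Ω (frontier Ω) < ⊤ := by
    refine hc.measure_lt_top_of_nhdsWithin fun x hx => ?_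
    obtain ⟨ρ, e, K, g, hch⟩ := h.exists_chart hx
    exact ⟨Metric.ball x ρ, mem_nhdsWithin_of_mem_nhds (Metric.ball_mem_nhds x hch.pos),
      hch.surfaceMeasure_ball_lt_top h.isOpen⟩
  have h2 : surfaceMeasure Ω univ = surfaceMeasure Ω (frontier Ω) := by
    rw [surfaceMeasure, Measure.restrict_apply_univ, Measure.restrict_apply_self]
  rwa [h2]

/-- The surface integral in a boundary chart. -/
theorem IsBoundaryChart.integral_surfaceMeasure (h : IsBoundaryChart Ω x₀ ρ e K g)
    (hΩ : IsOpen Ω) {f : E d → ℝ} (hf : ∀ x ∉ Metric.ball x₀ ρ, f x = 0) (w : (ℝ ∙ e)ᗮ) (c : ℝ) :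
    ∫ x, f x * inner ℝ (outerNormal Ω x) ((w : E d) + c • e) ∂(surfaceMeasure Ω)
      = ∫ y, f (graphMap e g y) * (fderiv ℝ g y w - c) := by
  have hball := Metric.isOpen_ball.measurableSet (s := Metric.ball x₀ ρ)
  have hγ : MeasurableEmbedding (graphMap e g) :=
    (graphMap_lipschitz h.unit h.lip).continuous.measurableEmbedding
      (graphMap_injective h.unit g)
  rw [← setIntegral_eq_integral_of_forall_compl_eq_zero (s := Metric.ball x₀ ρ)
    fun x hx => by rw [hf x hx, zero_mul], h.surfaceMeasure_restrict hΩ,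
    hγ.setIntegral_map, setIntegral_withDensity_eq_setIntegral_toReal_smul]
  · rw [← setIntegral_eq_integral_of_forall_compl_eq_zero
      (s := graphMap e g ⁻¹' Metric.ball x₀ ρ)
      (f := fun y => f (graphMap e g y) * (fderiv ℝ g y w - c))
      fun x hx => by rw [hf _ hx, zero_mul]]
    refine setIntegral_congr_ae (hγ.measurable hball) ?_
    filter_upwards [h.lip.ae_differentiableAt (μ := volume)] with y hy hyb
    -- The area density cancels the normalising factor of the normal, leaving the inner product of
    -- the unnormalised vector `∇g - e` with `w + c e`.
    have hJ : 0 < √(1 + ‖fderiv ℝ g y‖ ^ 2) := Real.sqrt_pos.2 (by positivity)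
    rw [(h.isOuterNormal hyb hy).outerNormal_eq, inner_smul_left, smul_eq_mul,
      ENNReal.toReal_ofReal hJ.le, inner_sub_left, inner_add_smul h.unit, inner_add_right,
      inner_smul_right, real_inner_comm e, inner_orthogonal_left, ← Submodule.coe_inner,
      InnerProductSpace.toDual_symm_apply]
    simp only [mul_zero, add_zero, map_inv₀, conj_trivial]
    field_simp
  · exact ((measurable_const.add ((measurable_fderiv ℝ g).norm.pow_const 2)).sqrt).ennreal_ofReal
  · exact ae_of_all _ fun _ => ENNReal.ofReal_lt_top
  · exact hγ.measurable hball

/-- Integration over the epigraph in coordinates. -/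
theorem setIntegral_epigraph {E : Type*} [NormedAddCommGroup E] [InnerProductSpace ℝ E]
    [FiniteDimensional ℝ E] [MeasurableSpace E] [BorelSpace E] {e : E} (he : ‖e‖ = 1)
    {g : (ℝ ∙ e)ᗮ → ℝ} (hg : Continuous g) {f : E → ℝ}
    (hf : IntegrableOn f {x | g ((ℝ ∙ e)ᗮ.orthogonalProjectionOnto x) < inner ℝ e x}) :
    ∫ x in {x | g ((ℝ ∙ e)ᗮ.orthogonalProjectionOnto x) < inner ℝ e x}, f x
      = ∫ y : (ℝ ∙ e)ᗮ, ∫ σ in Ioi (0 : ℝ), f ((y : E) + (g y + σ) • e) := by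
  have hm : MeasurableSet {x : E | g ((ℝ ∙ e)ᗮ.orthogonalProjectionOnto x) < inner ℝ e x} :=
    (isOpen_lt (hg.comp (by fun_prop)) (by fun_prop)).measurableSet
  have hmp := measurePreserving_add_smul he
  have hemb : MeasurableEmbedding (fun q : (ℝ ∙ e)ᗮ × ℝ => (q.1 : E) + q.2 • e) := by
    refine Continuous.measurableEmbedding (by fun_prop) fun q q' hq => ?_
    have h1 := congrArg (fun x => inner ℝ e x) hq
    have h2 := congrArg (fun x => (ℝ ∙ e)ᗮ.orthogonalProjectionOnto x) hq
    simp only [inner_add_smul he, orthogonalProjection_add_smul he] at h1 h2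
    exact Prod.ext h2 h1
  rw [← integral_indicator hm, ← hmp.integral_comp hemb, Measure.volume_eq_prod, integral_prod]
  · refine integral_congr_ae (ae_of_all _ fun y => ?_)
    have hind : ∀ s : ℝ, {x : E | g ((ℝ ∙ e)ᗮ.orthogonalProjectionOnto x) < inner ℝ e x}.indicator f
        ((y : E) + s • e) = (Ioi (g y)).indicator (fun s => f ((y : E) + s • e)) s := by
      intro s
      simp only [indicator, mem_ofPred_eq, orthogonalProjection_add_smul he, inner_add_smul he,
        mem_Ioi]
    simp only [hind]
    rw [← integral_add_left_eq_self _ (g y), ← integral_indicator measurableSet_Ioi]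
    refine integral_congr_ae (ae_of_all _ fun σ => ?_)
    simp [indicator]
  · rw [← Measure.volume_eq_prod]
    exact (hmp.integrable_comp_emb hemb).2 ((integrable_indicator_iff hm).2 hf)

end Surface

/-! ### Gauss–Green formula on Lipschitz domains -/

section GaussGreen

variable {d : ℕ} {Ω : Set (E d)} {x₀ e : E d} {ρ : ℝ} {K : ℝ≥0} {g : (ℝ ∙ e)ᗮ → ℝ}

theorem IsBoundedLipschitzDomain.exists_bound_fderivWithin (h : IsBoundedLipschitzDomain Ω)
    {f : E d → ℝ} (hf : ContDiffOn ℝ 1 f (closure Ω)) :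
    ∃ C : ℝ≥0, ∀ x ∈ closure Ω, ‖fderivWithin ℝ f (closure Ω) x‖ ≤ C := by
  obtain ⟨C, hC⟩ := h.isCompact_closure.exists_bound_of_continuousOn
    (hf.continuousOn_fderivWithin h.uniqueDiffOn le_rfl)
  exact ⟨C.toNNReal, fun x hx => (hC x hx).trans (Real.le_coe_toNNReal C)⟩

theorem fderivWithin_closure_eq (hΩ : IsOpen Ω) {f : E d → ℝ} {x : E d} (hx : x ∈ Ω) :
    fderivWithin ℝ f (closure Ω) x = fderiv ℝ f x :=
  fderivWithin_of_mem_nhds (mem_of_superset (hΩ.mem_nhds hx) subset_closure)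

/-- Localised form of the formula: inside the ball `Ω` coincides with the epigraph of `g`, and
outside it the function vanishes, so both integrals may be computed for the epigraph. -/
theorem IsBoundaryChart.integral_fderivWithin (h : IsBoundaryChart Ω x₀ ρ e K g)
    (hΩ : IsBoundedLipschitzDomain Ω) {f : E d → ℝ} (hf : ContDiffOn ℝ 1 f (closure Ω))
    (hsupp : tsupport f ⊆ Metric.ball x₀ ρ) (v : E d) :
    ∫ x in Ω, fderivWithin ℝ f (closure Ω) x v
      = ∫ x, f x * inner ℝ (outerNormal Ω x) v ∂(surfaceMeasure Ω) := by
  obtain ⟨C, hC⟩ := hΩ.exists_bound_fderivWithin hf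
  have hf0 : ∀ x ∉ Metric.ball x₀ ρ, f =ᶠ[𝓝 x] fun _ => 0 := fun x hx =>
    notMem_tsupport_iff_eventuallyEq.1 fun hx' => hx (hsupp hx')
  set F : E d → ℝ := (closure Ω).indicator f with hF
  have hF0 : ∀ x ∉ Metric.ball x₀ ρ, F =ᶠ[𝓝 x] fun _ => 0 := fun x hx => by
    filter_upwards [hf0 x hx] with y hy
    simp [hF, indicator, hy]
  have hFΩ : ∀ x ∈ Ω, F =ᶠ[𝓝 x] f := fun x hx => by
    filter_upwards [hΩ.isOpen.mem_nhds hx] with y hy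
    rw [hF, indicator_of_mem (subset_closure hy)]
  have hFd0 : ∀ x ∉ Metric.ball x₀ ρ, fderiv ℝ F x = 0 := fun x hx => by
    rw [(hF0 x hx).fderiv_eq]; simp
  have hFdΩ : ∀ x ∈ Ω, fderiv ℝ F x = fderivWithin ℝ f (closure Ω) x := fun x hx => by
    rw [(hFΩ x hx).fderiv_eq, fderivWithin_closure_eq hΩ.isOpen hx]
  -- At every point of the epigraph `F` either agrees locally with `f`, inside `Ω`, or vanishes
  -- locally, off the ball. This yields differentiability and the gradient bound on the whole
  -- epigraph.
  have hcase : ∀ (y : (ℝ ∙ e)ᗮ) (s : ℝ), g y < s →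
      (y : E d) + s • e ∈ Ω ∨ (y : E d) + s • e ∉ Metric.ball x₀ ρ := fun y s hs => by
    by_cases hb : (y : E d) + s • e ∈ Metric.ball x₀ ρ
    · exact Or.inl ((h.mem_iff y s hb).2 hs)
    · exact Or.inr hb
  have hdiff : ∀ (y : (ℝ ∙ e)ᗮ) (s : ℝ), g y < s → DifferentiableAt ℝ F ((y : E d) + s • e) := by
    intro y s hs
    rcases hcase y s hs with hx | hx
    · refine DifferentiableAt.congr_of_eventuallyEq ?_ (hFΩ _ hx)
      exact (hf.differentiableOn one_ne_zero _ (subset_closure hx)).differentiableAt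
        (mem_of_superset (hΩ.isOpen.mem_nhds hx) subset_closure)
    · exact (differentiableAt_const (0 : ℝ)).congr_of_eventuallyEq (hF0 _ hx)
  have hbound : ∀ x, x ∈ Ω ∨ x ∉ Metric.ball x₀ ρ → ‖fderiv ℝ F x‖ ≤ C := by
    rintro x (hx | hx)
    · rw [hFdΩ _ hx]; exact hC _ (subset_closure hx)
    · rw [hFd0 _ hx, norm_zero]; exact C.2
  have hcont : ∀ y : (ℝ ∙ e)ᗮ,
      ContinuousWithinAt (fun s => F ((y : E d) + s • e)) (Ici (g y)) (g y) := by
    intro y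
    by_cases hb : (y : E d) + g y • e ∈ Metric.ball x₀ ρ
    · have hcl : (y : E d) + g y • e ∈ closure Ω := (h.mem_closure_iff hb).2 le_rfl
      have h1 : ContinuousWithinAt F (closure Ω) ((y : E d) + g y • e) :=
        ((hf.continuousOn _ hcl).congr (fun x hx => by rw [hF, indicator_of_mem hx])
          (by rw [hF, indicator_of_mem hcl]))
      have h2 : Tendsto (fun s : ℝ => (y : E d) + s • e) (𝓝[≥] (g y))
          (𝓝[closure Ω] ((y : E d) + g y • e)) := by
        refine tendsto_nhdsWithin_iff.2
          ⟨(tendsto_add_smul_right y (g y)).mono_left nhdsWithin_le_nhds, ?_⟩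
        filter_upwards [((tendsto_add_smul_right y (g y)).mono_left
          nhdsWithin_le_nhds).eventually (Metric.isOpen_ball.mem_nhds hb), self_mem_nhdsWithin]
          with s hs hs'
        exact (h.mem_closure_iff hs).2 hs'
      exact h1.tendsto.comp h2
    · have h1 : ContinuousAt F ((y : E d) + g y • e) :=
        continuousAt_const.congr (hF0 _ hb).symm
      exact (h1.tendsto.comp (tendsto_add_smul_right y (g y))).mono_left nhdsWithin_le_nhds
  have hFsupp : ∀ (y : (ℝ ∙ e)ᗮ) (s : ℝ), g y < s → ‖x₀‖ + ρ < ‖(y : E d) + s • e‖ →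
      F ((y : E d) + s • e) = 0 := by
    intro y s _ hr
    refine (hF0 _ fun hb => ?_).eq_of_nhds
    have h1 := mem_ball_iff_norm.1 hb
    have h2 := norm_add_le x₀ ((y : E d) + s • e - x₀)
    rw [add_sub_cancel] at h2
    linarith
  have key := integral_fderiv_epigraph h.unit h.lip hdiff (fun y s hs => hbound _ (hcase y s hs))
    hcont hFsupp ((ℝ ∙ e)ᗮ.orthogonalProjectionOnto v) (inner ℝ e v)
  rw [← orthogonalProjection_add_inner_smul h.unit v] at key
  set U : Set (E d) := {x | g ((ℝ ∙ e)ᗮ.orthogonalProjectionOnto x) < inner ℝ e x} with hU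
  have hUm : MeasurableSet U :=
    (isOpen_lt (h.lip.continuous.comp (by fun_prop)) (by fun_prop)).measurableSet
  have hbm := Metric.isOpen_ball.measurableSet (s := Metric.ball x₀ ρ)
  have hinter : Ω ∩ Metric.ball x₀ ρ = U ∩ Metric.ball x₀ ρ := by
    ext x
    exact and_congr_left fun hx => h.mem_iff' hx
  have hintU : IntegrableOn (fun x => fderiv ℝ F x v) U := by
    have h1 : IntegrableOn (fun x => fderiv ℝ F x v) (U ∩ Metric.ball x₀ ρ) := by
      refine IntegrableOn.of_bound (measure_lt_top_of_subset inter_subset_right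
        measure_ball_lt_top.ne) (measurable_fderiv_apply_const ℝ F v).aestronglyMeasurable
        (C * ‖v‖) ?_
      filter_upwards [ae_restrict_mem (hUm.inter hbm)] with x hx
      rw [← hinter] at hx
      exact (ContinuousLinearMap.le_opNorm _ _).trans (by gcongr; exact hbound x (Or.inl hx.1))
    refine h1.of_forall_sdiff_eq_zero hUm fun x hx => ?_
    rw [hFd0 x fun hb => hx.2 ⟨hx.1, hb⟩]; rfl
  calc ∫ x in Ω, fderivWithin ℝ f (closure Ω) x v = ∫ x in Ω, fderiv ℝ F x v :=
        setIntegral_congr_fun hΩ.isOpen.measurableSet fun x hx => by simp only [hFdΩ x hx]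
    _ = ∫ x in Ω ∩ Metric.ball x₀ ρ, fderiv ℝ F x v := by
        refine setIntegral_eq_of_subset_of_forall_sdiff_eq_zero hΩ.isOpen.measurableSet
          inter_subset_left fun x hx => ?_
        rw [hFd0 x fun hb => hx.2 ⟨hx.1, hb⟩]; rfl
    _ = ∫ x in U, fderiv ℝ F x v := by
        rw [hinter]
        refine (setIntegral_eq_of_subset_of_forall_sdiff_eq_zero hUm
          inter_subset_left fun x hx => ?_).symm
        rw [hFd0 x fun hb => hx.2 ⟨hx.1, hb⟩]; rfl
    _ = _ := by
        rw [setIntegral_epigraph h.unit h.lip.continuous hintU, key]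
        have hs := h.integral_surfaceMeasure hΩ.isOpen (f := f)
          (fun x hx => (hf0 x hx).eq_of_nhds) ((ℝ ∙ e)ᗮ.orthogonalProjectionOnto v) (inner ℝ e v)
        rw [← orthogonalProjection_add_inner_smul h.unit v] at hs
        rw [hs]
        refine integral_congr_ae (ae_of_all _ fun y => ?_)
        by_cases hb : graphMap e g y ∈ Metric.ball x₀ ρ
        · simp only [hF]
          rw [indicator_of_mem (show graphMap e g y ∈ closure Ω from (h.mem_closure_iff hb).2 le_rfl)]
        · simp only [(hF0 _ hb).eq_of_nhds, (hf0 _ hb).eq_of_nhds]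

/-- The interior case of the localisation, where both sides vanish: `f` is `C¹` with compact support
on the whole space, and it is zero on the boundary. -/
theorem integral_fderivWithin_of_tsupport_subset (hΩ : IsBoundedLipschitzDomain Ω) {f : E d → ℝ}
    (hf : ContDiffOn ℝ 1 f (closure Ω)) (hsupp : tsupport f ⊆ Ω) (v : E d) :
    ∫ x in Ω, fderivWithin ℝ f (closure Ω) x v
      = ∫ x, f x * inner ℝ (outerNormal Ω x) v ∂(surfaceMeasure Ω) := by
  have hf0 : ∀ x ∉ Ω, f =ᶠ[𝓝 x] fun _ => 0 := fun x hx =>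
    notMem_tsupport_iff_eventuallyEq.1 fun hx' => hx (hsupp hx')
  have hcd : ContDiff ℝ 1 f := by
    refine contDiff_iff_contDiffAt.2 fun x => ?_
    by_cases hx : x ∈ Ω
    · exact (hf x (subset_closure hx)).contDiffAt
        (mem_of_superset (hΩ.isOpen.mem_nhds hx) subset_closure)
    · exact contDiffAt_const.congr_of_eventuallyEq (hf0 x hx)
  have hcs : HasCompactSupport f :=
    hΩ.isCompact_closure.of_isClosed_subset (isClosed_tsupport f) (hsupp.trans subset_closure)
  obtain ⟨L, hL⟩ := hcd.lipschitzWith_of_hasCompactSupport hcs one_ne_zero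
  have h0 := integral_lineDeriv_eq_zero (μ := volume) hL hcs v
  have h1 : ∀ x, lineDeriv ℝ f x v = fderiv ℝ f x v := fun x =>
    (hcd.differentiable one_ne_zero x).lineDeriv_eq_fderiv
  simp only [h1] at h0
  have h2 : ∫ x, f x * inner ℝ (outerNormal Ω x) v ∂(surfaceMeasure Ω) = 0 := by
    rw [surfaceMeasure]
    refine setIntegral_eq_zero_of_forall_eq_zero fun x hx => ?_
    rw [(hf0 x fun h => ?_).eq_of_nhds, zero_mul]
    rw [hΩ.isOpen.frontier_eq] at hx
    exact hx.2 h
  rw [h2, ← h0, ← setIntegral_eq_integral_of_forall_compl_eq_zero (s := Ω)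
    (f := fun x => fderiv ℝ f x v) fun x hx => ?_]
  · exact setIntegral_congr_fun hΩ.isOpen.measurableSet fun x hx => by
      simp only [fderivWithin_closure_eq hΩ.isOpen hx]
  · rw [(hf0 x hx).fderiv_eq]; simp

/-- **Gauss–Green formula** on a bounded Lipschitz domain. -/
theorem integral_fderivWithin_eq_surface (hΩ : IsBoundedLipschitzDomain Ω) {f : E d → ℝ}
    (hf : ContDiffOn ℝ 1 f (closure Ω)) (v : E d) :
    ∫ x in Ω, fderivWithin ℝ f (closure Ω) x v
      = ∫ x, f x * inner ℝ (outerNormal Ω x) v ∂(surfaceMeasure Ω) := by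
  classical
  have hfin := hΩ.isFiniteMeasure_surfaceMeasure
  -- a finite cover by `Ω` and boundary charts
  have hcov : ∀ x : E d, ∃ U : Set (E d), IsOpen U ∧ (x ∈ closure Ω → x ∈ U) ∧
      ∀ f : E d → ℝ, ContDiffOn ℝ 1 f (closure Ω) → tsupport f ⊆ U →
        ∫ x in Ω, fderivWithin ℝ f (closure Ω) x v
          = ∫ x, f x * inner ℝ (outerNormal Ω x) v ∂(surfaceMeasure Ω) := by
    intro x
    by_cases hx : x ∈ frontier Ω
    · obtain ⟨ρ, e, K, g, hch⟩ := hΩ.exists_chart hx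
      exact ⟨Metric.ball x ρ, Metric.isOpen_ball, fun _ => Metric.mem_ball_self hch.pos,
        fun f hf hs => hch.integral_fderivWithin hΩ hf hs v⟩
    · refine ⟨Ω, hΩ.isOpen, fun hcl => ?_,
        fun f hf hs => integral_fderivWithin_of_tsupport_subset hΩ hf hs v⟩
      by_contra hΩ'
      exact hx (by rw [hΩ.isOpen.frontier_eq]; exact ⟨hcl, hΩ'⟩)
  choose U hUo hUx hU using hcov
  obtain ⟨t, ht⟩ := hΩ.isCompact_closure.elim_finite_subcover U hUo
    fun x hx => mem_iUnion.2 ⟨x, hUx x hx⟩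
  -- The functions sum to one on the closure of `Ω`, hence also on the boundary, so both sides of
  -- the formula split into localised pieces.
  obtain ⟨ψ, hψ⟩ := SmoothPartitionOfUnity.exists_isSubordinate
    (modelWithCornersSelf ℝ (E d)) isClosed_closure (fun i : t => U i) (fun i => hUo i)
    (by simpa [iUnion_subtype] using ht)
  have hψs : ∀ i, ContDiff ℝ 1 (ψ i) := fun i =>
    ((ψ i).contMDiff.contDiff).of_le (by exact_mod_cast le_top)
  have hψf : ∀ i, ContDiffOn ℝ 1 (fun x => ψ i x * f x) (closure Ω) := fun i =>
    (hψs i).contDiffOn.mul hf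
  have hsum : ∀ x ∈ closure Ω, ∑ i, ψ i x * f x = f x := by
    intro x hx
    rw [← Finset.sum_mul, ← finsum_eq_sum_of_fintype, ψ.sum_eq_one hx, one_mul]
  have hloc : ∀ i, ∫ x in Ω, fderivWithin ℝ (fun x => ψ i x * f x) (closure Ω) x v
      = ∫ x, (ψ i x * f x) * inner ℝ (outerNormal Ω x) v ∂(surfaceMeasure Ω) := by
    intro i
    refine hU i _ (hψf i) ?_
    refine (closure_mono fun x hx => ?_).trans (hψ i)
    exact left_ne_zero_of_mul hx
  have hL : ∫ x in Ω, fderivWithin ℝ f (closure Ω) x v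
      = ∑ i, ∫ x in Ω, fderivWithin ℝ (fun x => ψ i x * f x) (closure Ω) x v := by
    rw [← integral_finsetSum]
    · refine setIntegral_congr_fun hΩ.isOpen.measurableSet fun x hx => ?_
      have hx' := subset_closure hx
      have h1 := fderivWithin_congr (𝕜 := ℝ) (fun y hy => (hsum y hy).symm) (hsum x hx').symm
      simp only [h1]
      rw [fderivWithin_fun_sum (hΩ.uniqueDiffOn x hx') fun i _ =>
        (hψf i).differentiableOn one_ne_zero x hx']
      simp
    · intro i _
      have hc : ContinuousOn (fun x => fderivWithin ℝ (fun x => ψ i x * f x) (closure Ω) x v)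
          (closure Ω) :=
        ((hψf i).continuousOn_fderivWithin hΩ.uniqueDiffOn le_rfl).clm_apply continuousOn_const
      exact (hc.integrableOn_compact hΩ.isCompact_closure).mono_set subset_closure
  have hR : ∫ x, f x * inner ℝ (outerNormal Ω x) v ∂(surfaceMeasure Ω)
      = ∑ i, ∫ x, (ψ i x * f x) * inner ℝ (outerNormal Ω x) v ∂(surfaceMeasure Ω) := by
    rw [← integral_finsetSum]
    · refine integral_congr_ae ?_
      have hmem : ∀ᵐ x ∂(surfaceMeasure Ω), x ∈ frontier Ω :=
        ae_restrict_mem isClosed_frontier.measurableSet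
      filter_upwards [hmem] with x hx
      rw [← Finset.sum_mul, hsum x (frontier_subset_closure hx)]
    · intro i _
      have hc := (hψf i).continuousOn
      obtain ⟨M, hM⟩ := hΩ.isCompact_closure.exists_bound_of_continuousOn hc
      have hmem : ∀ᵐ x ∂(surfaceMeasure Ω), x ∈ frontier Ω :=
        ae_restrict_mem isClosed_frontier.measurableSet
      have hm1 : AEStronglyMeasurable (fun x => ψ i x * f x) (surfaceMeasure Ω) :=
        (hc.mono frontier_subset_closure).aestronglyMeasurable isClosed_frontier.measurableSet
      have hm2 : Measurable fun x => inner ℝ (outerNormal Ω x) v :=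
        (measurable_outerNormal Ω).inner measurable_const
      refine Integrable.of_bound (C := M * ‖v‖) (hm1.mul hm2.aestronglyMeasurable) ?_
      filter_upwards [hmem] with x hx
      have h1 := hM x (frontier_subset_closure hx)
      rw [norm_mul]
      have h2 : ‖inner ℝ (outerNormal Ω x) v‖ ≤ ‖v‖ :=
        (norm_inner_le_norm _ _).trans
          (mul_le_of_le_one_left (norm_nonneg _) (norm_outerNormal_le x))
      gcongr
      exact (norm_nonneg _).trans h1
  rw [hL, hR]
  exact Finset.sum_congr rfl fun i _ => hloc i

end GaussGreen

/-! ### Differentiation under the integral sign within a convex set -/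

section ParametricIntegral

variable {X : Type*} [NormedAddCommGroup X] [NormedSpace ℝ X]
  {Y : Type*} [NormedAddCommGroup Y] [NormedSpace ℝ Y] {S : Set X}

theorem continuousOn_integral_Icc {Y : Type*} [NormedAddCommGroup Y]
    [NormedSpace ℝ Y] {X : Type*} [TopologicalSpace X] {S : Set X} {f : X → ℝ → Y}
    (hf : ContinuousOn (fun p : X × ℝ => f p.1 p.2) (S ×ˢ Icc 0 1)) :
    ContinuousOn (fun x => ∫ s in (0 : ℝ)..1, f x s) S := by
  have hslice : ∀ x ∈ S, IntervalIntegrable (f x) volume 0 1 := fun x hx => by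
    refine ContinuousOn.intervalIntegrable ?_
    rw [uIcc_of_le zero_le_one]
    exact hf.comp (f := fun s : ℝ => (x, s)) (by fun_prop) fun s hs => ⟨hx, hs⟩
  intro x hx
  rw [ContinuousWithinAt, Metric.tendsto_nhds]
  intro ε hε
  obtain ⟨v, hv, hvε⟩ := isCompact_Icc.mem_uniformity_of_prod (f := f) hf hx
    (Metric.dist_mem_uniformity (half_pos hε))
  filter_upwards [hv, self_mem_nhdsWithin] with y hy hyS
  rw [dist_eq_norm, ← intervalIntegral.integral_sub (hslice y hyS) (hslice x hx)]
  refine lt_of_le_of_lt (intervalIntegral.norm_integral_le_of_norm_le_const (C := ε / 2)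
    fun s hs => ?_) (by simp; linarith)
  rw [uIoc_of_le zero_le_one] at hs
  have := hvε y hy s (Ioc_subset_Icc_self hs)
  rw [← dist_eq_norm]
  exact le_of_lt this

/-- Compactness of the interval makes `f'` close to its value at `x` uniformly in the parameter. The
mean value inequality on the convex set `ball ∩ S` turns this into a uniform first-order estimate,
valid also at boundary points of `S`. -/
theorem hasFDerivWithinAt_integral_Icc [CompleteSpace Y] (hS : Convex ℝ S) {f : X → ℝ → Y}
    {f' : X → ℝ → X →L[ℝ] Y}
    (hf : ContinuousOn (fun p : X × ℝ => f p.1 p.2) (S ×ˢ Icc 0 1))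
    (hf' : ContinuousOn (fun p : X × ℝ => f' p.1 p.2) (S ×ˢ Icc 0 1))
    (hd : ∀ x ∈ S, ∀ s ∈ Icc (0 : ℝ) 1, HasFDerivWithinAt (fun y => f y s) (f' x s) S x)
    {x : X} (hx : x ∈ S) :
    HasFDerivWithinAt (fun x => ∫ s in (0 : ℝ)..1, f x s) (∫ s in (0 : ℝ)..1, f' x s) S x := by
  have hslice : ∀ x ∈ S, IntervalIntegrable (f x) volume 0 1 := fun x hx => by
    refine ContinuousOn.intervalIntegrable ?_
    rw [uIcc_of_le zero_le_one]
    exact hf.comp (f := fun s : ℝ => (x, s)) (by fun_prop) fun s hs => ⟨hx, hs⟩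
  have hslice' : IntervalIntegrable (f' x) volume 0 1 := by
    refine ContinuousOn.intervalIntegrable ?_
    rw [uIcc_of_le zero_le_one]
    exact hf'.comp (f := fun s : ℝ => (x, s)) (by fun_prop) fun s hs => ⟨hx, hs⟩
  refine HasFDerivWithinAt.of_isLittleO (Asymptotics.isLittleO_iff.2 fun ε hε => ?_)
  obtain ⟨v, hv, hvε⟩ := isCompact_Icc.mem_uniformity_of_prod (f := f') hf' hx
    (Metric.dist_mem_uniformity hε)
  obtain ⟨δ, hδ, hball⟩ := Metric.mem_nhdsWithin_iff.1 hv
  filter_upwards [self_mem_nhdsWithin, mem_nhdsWithin_of_mem_nhds (Metric.ball_mem_nhds x hδ)]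
    with y hyS hyb
  have hconv : Convex ℝ (Metric.ball x δ ∩ S) := (convex_ball x δ).inter hS
  have happ : (∫ s in (0 : ℝ)..1, f' x s) (y - x) = ∫ s in (0 : ℝ)..1, f' x s (y - x) :=
    ContinuousLinearMap.intervalIntegral_apply hslice' _
  rw [happ,
    ← intervalIntegral.integral_sub (hslice y hyS) (hslice x hx),
    ← intervalIntegral.integral_sub ((hslice y hyS).sub (hslice x hx))
      ⟨hslice'.1.apply_continuousLinearMap _, hslice'.2.apply_continuousLinearMap _⟩]
  refine (intervalIntegral.norm_integral_le_of_norm_le_const (C := ε * ‖y - x‖)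
    fun s hs => ?_).trans (by simp)
  rw [uIoc_of_le zero_le_one] at hs
  have hs' := Ioc_subset_Icc_self hs
  refine hconv.norm_image_sub_le_of_norm_hasFDerivWithin_le' (f := fun y => f y s)
    (f' := fun y => f' y s) (φ := f' x s)
    (fun w hw => (hd w hw.2 s hs').mono inter_subset_right) (fun w hw => ?_)
    ⟨Metric.mem_ball_self hδ, hx⟩ ⟨hyb, hyS⟩
  rw [← dist_eq_norm]
  exact le_of_lt (hvε w (hball hw) s hs')

theorem hasFDerivWithinAt_partial {f : X → ℝ → Y} {I : Set ℝ}
    {x : X} {s : ℝ} (hs : s ∈ I)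
    (hf : DifferentiableWithinAt ℝ (fun p : X × ℝ => f p.1 p.2) (S ×ˢ I) (x, s)) :
    HasFDerivWithinAt (fun y => f y s)
      ((fderivWithin ℝ (fun p : X × ℝ => f p.1 p.2) (S ×ˢ I) (x, s)).comp
        (ContinuousLinearMap.inl ℝ X ℝ)) S x := by
  have h1 : HasFDerivWithinAt (fun y : X => (y, s)) (ContinuousLinearMap.inl ℝ X ℝ) S x :=
    (hasFDerivAt_prodMk_left x s).hasFDerivWithinAt
  exact HasFDerivWithinAt.comp (f := fun y : X => (y, s)) (t := S ×ˢ I) x hf.hasFDerivWithinAt h1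
    fun y hy => ⟨hy, hs⟩

theorem contDiffOn_one_integral_Icc [CompleteSpace Y] (hS : Convex ℝ S)
    (hS' : UniqueDiffOn ℝ S) {f : X → ℝ → Y}
    (hf : ContDiffOn ℝ 1 (fun p : X × ℝ => f p.1 p.2) (S ×ˢ Icc 0 1)) :
    ContDiffOn ℝ 1 (fun x => ∫ s in (0 : ℝ)..1, f x s) S ∧
    ∀ x ∈ S, fderivWithin ℝ (fun x => ∫ s in (0 : ℝ)..1, f x s) S x
      = ∫ s in (0 : ℝ)..1, (fderivWithin ℝ (fun p : X × ℝ => f p.1 p.2) (S ×ˢ Icc 0 1)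
          (x, s)).comp (ContinuousLinearMap.inl ℝ X ℝ) := by
  have hu : UniqueDiffOn ℝ (S ×ˢ Icc (0 : ℝ) 1) := hS'.prod (uniqueDiffOn_Icc zero_lt_one)
  have hc := (hf.continuousOn_fderivWithin hu le_rfl).clm_comp
    (continuousOn_const (c := ContinuousLinearMap.inl ℝ X ℝ))
  have hd : ∀ x ∈ S, HasFDerivWithinAt (fun x => ∫ s in (0 : ℝ)..1, f x s) _ S x := fun x hx =>
    hasFDerivWithinAt_integral_Icc hS hf.continuousOn (f' := fun x s =>
      (fderivWithin ℝ (fun p : X × ℝ => f p.1 p.2) (S ×ˢ Icc 0 1) (x, s)).comp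
        (ContinuousLinearMap.inl ℝ X ℝ)) hc
      (fun x hx s hs => hasFDerivWithinAt_partial hs
        (hf.differentiableOn one_ne_zero _ ⟨hx, hs⟩)) hx
  refine ⟨(contDiffOn_succ_iff_fderivWithin (n := 0) hS').2
    ⟨fun x hx => (hd x hx).differentiableWithinAt, by simp, ?_⟩,
    fun x hx => (hd x hx).fderivWithin (hS' x hx)⟩
  rw [contDiffOn_zero]
  refine (continuousOn_integral_Icc (f := fun x s =>
      (fderivWithin ℝ (fun p : X × ℝ => f p.1 p.2) (S ×ˢ Icc 0 1) (x, s)).comp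
        (ContinuousLinearMap.inl ℝ X ℝ)) hc).congr fun x hx => (hd x hx).fderivWithin (hS' x hx)

/-- The derivative of the integral is again a parametric integral, with a `C¹` integrand, so the
first-order result applies a second time. -/
theorem contDiffOn_two_integral_Icc [CompleteSpace Y] (hS : Convex ℝ S)
    (hS' : UniqueDiffOn ℝ S) {f : X → ℝ → Y}
    (hf : ContDiffOn ℝ 2 (fun p : X × ℝ => f p.1 p.2) (S ×ˢ Icc 0 1)) :
    ContDiffOn ℝ 2 (fun x => ∫ s in (0 : ℝ)..1, f x s) S := by
  have hu : UniqueDiffOn ℝ (S ×ˢ Icc (0 : ℝ) 1) := hS'.prod (uniqueDiffOn_Icc zero_lt_one)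
  obtain ⟨h1, h2⟩ := contDiffOn_one_integral_Icc hS hS' (hf.of_le one_le_two)
  refine (contDiffOn_succ_iff_fderivWithin (n := 1) hS').2
    ⟨h1.differentiableOn one_ne_zero, by simp, ?_⟩
  refine ContDiffOn.congr (contDiffOn_one_integral_Icc hS hS' (f := fun x s =>
      (fderivWithin ℝ (fun p : X × ℝ => f p.1 p.2) (S ×ˢ Icc 0 1) (x, s)).comp
        (ContinuousLinearMap.inl ℝ X ℝ)) ?_).1 h2
  exact (hf.fderivWithin (m := 1) hu (by norm_num)).clm_comp contDiffOn_const

end ParametricIntegral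

/-! ### Cones in the plane -/

section Cones

variable {J : Set ℝ} {b₁ b₂ : ℝ}

theorem mk_mem_slopeCone {p : ℝ × ℝ} (hp : p ∈ slopeCone J) {s : ℝ} (hs : 0 < s) :
    (s, s * (p.2 / p.1)) ∈ slopeCone J :=
  ⟨hs, by rw [mul_div_cancel_left₀ _ (ne_of_gt hs)]; exact hp.2⟩

theorem convex_slopeCone (hJ : Convex ℝ J) : Convex ℝ (slopeCone J) := by
  rintro ⟨r, z⟩ ⟨hr, hz⟩ ⟨r', z'⟩ ⟨hr', hz'⟩ a b ha hb hab
  simp only [slopeCone, mem_ofPred_eq, Prod.smul_mk, smul_eq_mul, Prod.mk_add_mk] at *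
  have h0 : 0 < a * r + b * r' := by
    rcases ha.eq_or_lt with rfl | ha
    · have : b = 1 := by linarith
      subst this; linarith
    · have := mul_pos ha hr
      have := mul_nonneg hb hr'.le
      linarith
  refine ⟨h0, ?_⟩
  have := hJ hz hz' (a := a * r / (a * r + b * r')) (b := b * r' / (a * r + b * r'))
    (by positivity) (by positivity) (by rw [← add_div, div_self h0.ne'])
  simp only [smul_eq_mul] at this
  convert this using 1
  field_simp

theorem isOpen_coneO : IsOpen (coneO b₁ b₂) :=
  (isOpen_lt (f := fun p : ℝ × ℝ => b₁ * p.1) (g := fun p => p.2) (by fun_prop)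
    (by fun_prop)).inter
    (isOpen_lt (f := fun p : ℝ × ℝ => p.2) (g := fun p => b₂ * p.1) (by fun_prop) (by fun_prop))

theorem coneO_subset_slopeCone (hb : b₁ < b₂) (hJ : Ioo b₁ b₂ ⊆ J) :
    coneO b₁ b₂ ⊆ slopeCone J := by
  rintro ⟨r, z⟩ ⟨h1, h2⟩
  simp only at h1 h2
  have hr : 0 < r := by nlinarith
  exact ⟨hr, hJ ⟨(lt_div_iff₀ hr).2 h1, (div_lt_iff₀ hr).2 h2⟩⟩

theorem closure_coneO (hb : b₁ < b₂) :
    closure (coneO b₁ b₂) = {p : ℝ × ℝ | b₁ * p.1 ≤ p.2 ∧ p.2 ≤ b₂ * p.1} := by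
  apply Subset.antisymm
  · refine closure_minimal (fun p hp => ⟨hp.1.le, hp.2.le⟩) ?_
    exact (isClosed_le (f := fun p : ℝ × ℝ => b₁ * p.1) (g := fun p => p.2) (by fun_prop)
      (by fun_prop)).inter
      (isClosed_le (f := fun p : ℝ × ℝ => p.2) (g := fun p => b₂ * p.1) (by fun_prop)
        (by fun_prop))
  · rintro ⟨r, z⟩ ⟨h1, h2⟩
    simp only at h1 h2
    -- Moving in the direction with the middle slope makes both inequalities strict.
    have ht : Tendsto (fun ε : ℝ => (r + ε, z + ε * ((b₁ + b₂) / 2))) (𝓝[>] 0) (𝓝 (r, z)) := by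
      have : Continuous fun ε : ℝ => (r + ε, z + ε * ((b₁ + b₂) / 2)) := by fun_prop
      simpa using (this.tendsto 0).mono_left nhdsWithin_le_nhds
    refine mem_closure_of_tendsto ht ?_
    filter_upwards [self_mem_nhdsWithin] with ε hε
    have hε : 0 < ε := hε
    constructor <;> simp only <;> nlinarith

theorem slopeCone_subset_closure (hb : b₁ < b₂) (hJ : J ⊆ Icc b₁ b₂) :
    slopeCone J ⊆ closure (coneO b₁ b₂) := by
  rintro ⟨r, z⟩ ⟨hr, hz⟩
  rw [closure_coneO hb]
  exact ⟨(le_div_iff₀ hr).1 (hJ hz).1, (div_le_iff₀ hr).1 (hJ hz).2⟩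

theorem mem_slopeCone_Icc (hb : b₁ < b₂) {p : ℝ × ℝ} (hp : p ∈ closure (coneO b₁ b₂))
    (h0 : 0 < p.1) : p ∈ slopeCone (Icc b₁ b₂) := by
  rw [closure_coneO hb] at hp
  exact ⟨h0, (le_div_iff₀ h0).2 hp.1, (div_le_iff₀ h0).2 hp.2⟩

/-- An edge whose slope is not in `J` has a slope different from that of `p`, and slopes vary
continuously away from the vertex. So near `p` the closed cone has no points outside `slopeCone J`,
and derivatives taken within either set are the same. -/
theorem nhdsWithin_closure_coneO (hb : b₁ < b₂) (hJ₁ : Ioo b₁ b₂ ⊆ J) (hJ₂ : J ⊆ Icc b₁ b₂)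
    {p : ℝ × ℝ} (hp : p ∈ slopeCone J) :
    𝓝[slopeCone J] p = 𝓝[closure (coneO b₁ b₂)] p := by
  refine le_antisymm (nhdsWithin_mono _ (slopeCone_subset_closure hb hJ₂)) ?_
  refine nhdsWithin_le_iff.2 ?_
  have hcont : ContinuousAt (fun q : ℝ × ℝ => q.2 / q.1) p :=
    continuous_snd.continuousAt.div continuous_fst.continuousAt hp.1.ne'
  have hne : ∀ b, b ∉ J → ∀ᶠ q : ℝ × ℝ in 𝓝 p, q.2 / q.1 ≠ b := fun b hbJ =>
    hcont.eventually_ne fun h => hbJ (h ▸ hp.2)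
  have h1 : ∀ b, ∀ᶠ q : ℝ × ℝ in 𝓝 p, q.2 / q.1 = b → b ∈ J := fun b => by
    by_cases hbJ : b ∈ J
    · exact Eventually.of_forall fun _ _ => hbJ
    · exact (hne b hbJ).mono fun q hq hq' => absurd hq' hq
  filter_upwards [mem_nhdsWithin_of_mem_nhds (h1 b₁), mem_nhdsWithin_of_mem_nhds (h1 b₂),
    mem_nhdsWithin_of_mem_nhds (continuous_fst.continuousAt.eventually (lt_mem_nhds hp.1)),
    self_mem_nhdsWithin] with q hq1 hq2 hq0 hqK
  have hI := (mem_slopeCone_Icc hb hqK hq0).2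
  refine ⟨hq0, ?_⟩
  rcases hI.1.eq_or_lt with h | h
  · rw [← h]; exact hq1 h.symm
  rcases hI.2.eq_or_lt with h' | h'
  · rw [h']; exact hq2 h'
  exact hJ₁ ⟨h, h'⟩

theorem ordConnected_of_Ioo_subset (hJ₁ : Ioo b₁ b₂ ⊆ J) (hJ₂ : J ⊆ Icc b₁ b₂) :
    OrdConnected J := by
  refine ⟨fun x hx y hy t ht => ?_⟩
  rcases ht.1.eq_or_lt with rfl | h1
  · exact hx
  rcases ht.2.eq_or_lt with rfl | h2
  · exact hy
  exact hJ₁ ⟨(hJ₂ hx).1.trans_lt h1, h2.trans_le (hJ₂ hy).2⟩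

theorem coneO_nonempty (hb : b₁ < b₂) : (coneO b₁ b₂).Nonempty :=
  ⟨(1, (b₁ + b₂) / 2), by constructor <;> simp only <;> linarith⟩

theorem uniqueDiffOn_slopeCone (hb : b₁ < b₂) (hJ₁ : Ioo b₁ b₂ ⊆ J) (hJ₂ : J ⊆ Icc b₁ b₂) :
    UniqueDiffOn ℝ (slopeCone J) :=
  uniqueDiffOn_convex (convex_slopeCone (ordConnected_of_Ioo_subset hJ₁ hJ₂).convex)
    ((coneO_nonempty hb).mono
      (interior_maximal (coneO_subset_slopeCone hb hJ₁) isOpen_coneO))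

theorem convex_coneO : Convex ℝ (coneO b₁ b₂) := by
  rintro ⟨r, z⟩ ⟨h1, h2⟩ ⟨r', z'⟩ ⟨h1', h2'⟩ a b ha hb hab
  simp only [coneO, mem_ofPred_eq, Prod.smul_mk, smul_eq_mul, Prod.mk_add_mk] at *
  rcases ha.eq_or_lt with rfl | ha
  · have : b = 1 := by linarith
    subst this; constructor <;> linarith
  · constructor <;> nlinarith

theorem uniqueDiffOn_closure_coneO (hb : b₁ < b₂) : UniqueDiffOn ℝ (closure (coneO b₁ b₂)) :=
  uniqueDiffOn_convex convex_coneO.closure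
    ((coneO_nonempty hb).mono (interior_maximal subset_closure isOpen_coneO))

end Cones

/-! ### The Helmholtz function -/

section Helmholtz

variable {J : Set ℝ} {b₁ b₂ : ℝ} {P : ℝ × ℝ → ℝ}

/-- The substitution `s = 1 + θ (R - 1)` moves the dependence on `R` from the endpoint into the
integrand, so that regularity of `H` follows from differentiation under the integral. -/
theorem helmholtz_eq_integral_unit (P : ℝ × ℝ → ℝ) (p : ℝ × ℝ) :
    helmholtz P p = p.1 * ((p.1 - 1) * ∫ θ in (0 : ℝ)..1,
      P (1 + θ * (p.1 - 1), (1 + θ * (p.1 - 1)) * (p.2 / p.1)) / (1 + θ * (p.1 - 1)) ^ 2) := by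
  rw [helmholtz]
  have := intervalIntegral.mul_integral_comp_add_mul (a := 0) (b := 1)
    (f := fun s => P (s, s * (p.2 / p.1)) / s ^ 2) (p.1 - 1) 1
  simp only [mul_zero, add_zero, mul_one, add_sub_cancel] at this
  rw [← this]
  simp only [mul_comm (p.1 - 1) _]

theorem one_add_mul_sub_one_pos {R θ : ℝ} (hR : 0 < R) (hθ : θ ∈ Icc (0 : ℝ) 1) :
    0 < 1 + θ * (R - 1) := by
  rcases hθ.2.eq_or_lt with h | h
  · rw [h]; linarith
  · nlinarith [hθ.1]

theorem contDiffOn_helmholtz_integrand {n : ℕ∞} (hP : ContDiffOn ℝ n P (slopeCone J)) :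
    ContDiffOn ℝ n (fun q : (ℝ × ℝ) × ℝ =>
      P (1 + q.2 * (q.1.1 - 1), (1 + q.2 * (q.1.1 - 1)) * (q.1.2 / q.1.1))
        / (1 + q.2 * (q.1.1 - 1)) ^ 2) (slopeCone J ×ˢ Icc 0 1) := by
  have hs : ContDiffOn ℝ n (fun q : (ℝ × ℝ) × ℝ => 1 + q.2 * (q.1.1 - 1))
      (slopeCone J ×ˢ Icc 0 1) := by fun_prop
  have hd : ContDiffOn ℝ n (fun q : (ℝ × ℝ) × ℝ => q.1.2 / q.1.1) (slopeCone J ×ˢ Icc 0 1) :=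
    ContDiffOn.div (by fun_prop) (by fun_prop) fun q hq => hq.1.1.ne'
  refine ContDiffOn.div ?_ (hs.pow 2) fun q hq =>
    (pow_pos (one_add_mul_sub_one_pos hq.1.1 hq.2) 2).ne'
  exact hP.comp (hs.prodMk (hs.mul hd)) fun q hq =>
    mk_mem_slopeCone hq.1 (one_add_mul_sub_one_pos hq.1.1 hq.2)

theorem contDiffOn_helmholtz (hJ : Convex ℝ J) (hu : UniqueDiffOn ℝ (slopeCone J))
    (hP : ContDiffOn ℝ 2 P (slopeCone J)) : ContDiffOn ℝ 2 (helmholtz P) (slopeCone J) := by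
  have := contDiffOn_two_integral_Icc (convex_slopeCone hJ) hu
    (f := fun p θ => P (1 + θ * (p.1 - 1), (1 + θ * (p.1 - 1)) * (p.2 / p.1))
      / (1 + θ * (p.1 - 1)) ^ 2) (contDiffOn_helmholtz_integrand (n := 2) hP)
  rw [funext (helmholtz_eq_integral_unit P)]
  exact contDiffOn_fst.mul ((contDiffOn_fst.sub contDiffOn_const).mul this)

theorem continuousOn_helmholtz (hP : ContinuousOn P (slopeCone J)) :
    ContinuousOn (helmholtz P) (slopeCone J) := by
  have := continuousOn_integral_Icc
    (f := fun (p : ℝ × ℝ) θ => P (1 + θ * (p.1 - 1), (1 + θ * (p.1 - 1)) * (p.2 / p.1))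
      / (1 + θ * (p.1 - 1)) ^ 2)
    (contDiffOn_helmholtz_integrand (n := 0) (contDiffOn_zero.2 hP)).continuousOn
  rw [funext (helmholtz_eq_integral_unit P)]
  exact continuousOn_fst.mul ((continuousOn_fst.sub continuousOn_const).mul this)

/-- Along the ray through `p` the slope is constant, so `H` depends on the scale only through the
prefactor and the upper limit of the integral. Differentiating there by the product rule and the
fundamental theorem gives the right side; the chain rule gives the left. -/
theorem euler_helmholtz (hP : ContinuousOn P (slopeCone J)) {p : ℝ × ℝ} (hp : p ∈ slopeCone J)
    (hd : DifferentiableWithinAt ℝ (helmholtz P) (slopeCone J) p) :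
    fderivWithin ℝ (helmholtz P) (slopeCone J) p p = helmholtz P p + P p := by
  have hp1 : 0 < p.1 := hp.1
  have h1 : HasDerivAt (fun l : ℝ => helmholtz P (l • p))
      (fderivWithin ℝ (helmholtz P) (slopeCone J) p p) 1 := by
    have hray : HasDerivWithinAt (fun l : ℝ => l • p) p (Ioi 0) 1 := by
      simpa using ((hasDerivAt_id (1 : ℝ)).smul_const p).hasDerivWithinAt
    have hd' : HasFDerivWithinAt (helmholtz P) (fderivWithin ℝ (helmholtz P) (slopeCone J) p)
        (slopeCone J) ((1 : ℝ) • p) := by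
      rw [one_smul]; exact hd.hasFDerivWithinAt
    refine (hd'.comp_hasDerivWithinAt 1 hray fun l hl => ?_).hasDerivAt (Ioi_mem_nhds one_pos)
    have hl : (0 : ℝ) < l := hl
    refine ⟨mul_pos hl hp1, ?_⟩
    simp only [Prod.smul_fst, Prod.smul_snd, smul_eq_mul]
    rw [mul_div_mul_left _ _ hl.ne']
    exact hp.2
  set G : ℝ → ℝ := fun s => P (s, s * (p.2 / p.1)) / s ^ 2 with hG
  have hGc : ContinuousOn G (Ioi 0) := by
    refine ContinuousOn.div (hP.comp (f := fun s : ℝ => (s, s * (p.2 / p.1))) (by fun_prop)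
      fun s hs => mk_mem_slopeCone hp hs) (by fun_prop) fun s hs => (pow_pos hs 2).ne'
  have h2 : HasDerivAt (fun l : ℝ => helmholtz P (l • p)) (helmholtz P p + P p) 1 := by
    have hFTC : HasDerivAt (fun R : ℝ => ∫ s in (1 : ℝ)..R, G s) (G p.1) p.1 := by
      refine intervalIntegral.integral_hasDerivAt_right ?_
        (hGc.stronglyMeasurableAtFilter isOpen_Ioi _ hp1) (hGc.continuousAt (Ioi_mem_nhds hp1))
      refine (hGc.mono fun s hs => ?_).intervalIntegrable
      exact lt_of_lt_of_le (lt_min one_pos hp1) hs.1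
    have hl : HasDerivAt (fun l : ℝ => l * p.1) p.1 1 := by
      simpa using (hasDerivAt_id (1 : ℝ)).mul_const p.1
    have hc : HasDerivAt (fun l : ℝ => ∫ s in (1 : ℝ)..(l * p.1), G s) (G p.1 * p.1) 1 := by
      exact HasDerivAt.comp (h₂ := fun R : ℝ => ∫ s in (1 : ℝ)..R, G s) (1 : ℝ)
        (by rw [one_mul]; exact hFTC) hl
    have := hl.mul hc
    refine (this.congr_of_eventuallyEq ?_).congr_deriv ?_
    · filter_upwards [Ioi_mem_nhds (one_pos : (0 : ℝ) < 1)] with l hl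
      have hl : (0 : ℝ) < l := hl
      simp only [helmholtz, Prod.smul_fst, Prod.smul_snd, smul_eq_mul,
        mul_div_mul_left _ _ hl.ne', Pi.mul_apply, hG]
    · simp only [helmholtz, hG, one_mul]
      have : p.1 * (p.2 / p.1) = p.2 := by field_simp
      rw [this, Prod.mk.eta]
      congr 1
      field_simp
  exact h1.unique h2

end Helmholtz

/-! ### Partial derivatives on the cone, pressure relations and bounds near the vertex -/

section ConeDerivatives

variable {J : Set ℝ} {b₁ b₂ : ℝ} {P F : ℝ × ℝ → ℝ}

theorem fderivWithin_closure_coneO (hb : b₁ < b₂) (hJ₁ : Ioo b₁ b₂ ⊆ J) (hJ₂ : J ⊆ Icc b₁ b₂)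
    {p : ℝ × ℝ} (hp : p ∈ slopeCone J) :
    fderivWithin ℝ F (closure (coneO b₁ b₂)) p = fderivWithin ℝ F (slopeCone J) p :=
  fderivWithin_congr_set
    (nhdsWithin_eq_iff_eventuallyEq.1 (nhdsWithin_closure_coneO hb hJ₁ hJ₂ hp).symm)

theorem hasFDerivWithinAt_slopeCone (hb : b₁ < b₂) (hJ₁ : Ioo b₁ b₂ ⊆ J) (hJ₂ : J ⊆ Icc b₁ b₂)
    {p : ℝ × ℝ} (hp : p ∈ slopeCone J) (hF : DifferentiableWithinAt ℝ F (slopeCone J) p) :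
    HasFDerivWithinAt F (dR (closure (coneO b₁ b₂)) F p • ContinuousLinearMap.fst ℝ ℝ ℝ
      + dZ (closure (coneO b₁ b₂)) F p • ContinuousLinearMap.snd ℝ ℝ ℝ) (slopeCone J) p := by
  refine hF.hasFDerivWithinAt.congr_fderiv ?_
  rw [dR, dZ, fderivWithin_closure_coneO hb hJ₁ hJ₂ hp]
  ext <;> simp

theorem eq_dR_dZ (hb : b₁ < b₂) (hJ₁ : Ioo b₁ b₂ ⊆ J) (hJ₂ : J ⊆ Icc b₁ b₂)
    {p : ℝ × ℝ} (hp : p ∈ slopeCone J) {a c : ℝ}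
    (hF : HasFDerivWithinAt F (a • ContinuousLinearMap.fst ℝ ℝ ℝ
      + c • ContinuousLinearMap.snd ℝ ℝ ℝ) (slopeCone J) p) :
    dR (closure (coneO b₁ b₂)) F p = a ∧ dZ (closure (coneO b₁ b₂)) F p = c := by
  rw [dR, dZ, fderivWithin_closure_coneO hb hJ₁ hJ₂ hp,
    hF.fderivWithin (uniqueDiffOn_slopeCone hb hJ₁ hJ₂ p hp)]
  simp

theorem contDiffOn_dR (hb : b₁ < b₂) (hJ₁ : Ioo b₁ b₂ ⊆ J) (hJ₂ : J ⊆ Icc b₁ b₂)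
    {m n : WithTop ℕ∞} (hF : ContDiffOn ℝ n F (slopeCone J)) (hmn : m + 1 ≤ n) :
    ContDiffOn ℝ m (dR (closure (coneO b₁ b₂)) F) (slopeCone J) :=
  ((hF.fderivWithin (uniqueDiffOn_slopeCone hb hJ₁ hJ₂) hmn).clm_apply
    (contDiffOn_const (c := ((1 : ℝ), (0 : ℝ))))).congr fun p hp => by
      rw [dR, fderivWithin_closure_coneO hb hJ₁ hJ₂ hp]

theorem contDiffOn_dZ (hb : b₁ < b₂) (hJ₁ : Ioo b₁ b₂ ⊆ J) (hJ₂ : J ⊆ Icc b₁ b₂)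
    {m n : WithTop ℕ∞} (hF : ContDiffOn ℝ n F (slopeCone J)) (hmn : m + 1 ≤ n) :
    ContDiffOn ℝ m (dZ (closure (coneO b₁ b₂)) F) (slopeCone J) :=
  ((hF.fderivWithin (uniqueDiffOn_slopeCone hb hJ₁ hJ₂) hmn).clm_apply
    (contDiffOn_const (c := ((0 : ℝ), (1 : ℝ))))).congr fun p hp => by
      rw [dZ, fderivWithin_closure_coneO hb hJ₁ hJ₂ hp]

/-- Symmetry of the second derivative persists on the edges, because every point of the cone is a
limit of interior points. -/
theorem dZ_dR_comm (hb : b₁ < b₂) (hJ₁ : Ioo b₁ b₂ ⊆ J) (hJ₂ : J ⊆ Icc b₁ b₂)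
    {p : ℝ × ℝ} (hp : p ∈ slopeCone J) (hF : ContDiffOn ℝ 2 F (slopeCone J)) :
    dZ (closure (coneO b₁ b₂)) (dR (closure (coneO b₁ b₂)) F) p
      = dR (closure (coneO b₁ b₂)) (dZ (closure (coneO b₁ b₂)) F) p := by
  have hu := uniqueDiffOn_slopeCone hb hJ₁ hJ₂
  have hsymm : IsSymmSndFDerivWithinAt ℝ F (slopeCone J) p := by
    refine (hF p hp).isSymmSndFDerivWithinAt (by simp) hu ?_ hp
    exact closure_mono (interior_maximal (coneO_subset_slopeCone hb hJ₁) isOpen_coneO)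
      (slopeCone_subset_closure hb hJ₂ hp)
  have hd : DifferentiableWithinAt ℝ (fderivWithin ℝ F (slopeCone J)) (slopeCone J) p :=
    (hF.fderivWithin (m := 1) hu (by norm_num)).differentiableOn one_ne_zero p hp
  have key : ∀ v w : ℝ × ℝ, fderivWithin ℝ
      (fun q => fderivWithin ℝ F (closure (coneO b₁ b₂)) q v) (closure (coneO b₁ b₂)) p w
      = fderivWithin ℝ (fderivWithin ℝ F (slopeCone J)) (slopeCone J) p w v := by
    intro v w
    rw [fderivWithin_closure_coneO hb hJ₁ hJ₂ hp]
    have : fderivWithin ℝ (fun q => fderivWithin ℝ F (closure (coneO b₁ b₂)) q v)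
        (slopeCone J) p = fderivWithin ℝ (fun q => fderivWithin ℝ F (slopeCone J) q v)
        (slopeCone J) p :=
      fderivWithin_congr (fun q hq => by rw [fderivWithin_closure_coneO hb hJ₁ hJ₂ hq])
        (by rw [fderivWithin_closure_coneO hb hJ₁ hJ₂ hp])
    rw [this, fderivWithin_clm_apply (hu p hp) hd (by fun_prop)]
    simp
  exact (key _ _).trans ((hsymm _ _).trans (key _ _).symm)

/-- The Helmholtz relation `R ∂_R H + Z ∂_Z H = H + P`. -/
theorem helmholtz_relation (hb : b₁ < b₂) (hJ₁ : Ioo b₁ b₂ ⊆ J) (hJ₂ : J ⊆ Icc b₁ b₂)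
    (hP : ContDiffOn ℝ 2 P (slopeCone J)) {p : ℝ × ℝ} (hp : p ∈ slopeCone J) :
    p.1 * dR (closure (coneO b₁ b₂)) (helmholtz P) p
      + p.2 * dZ (closure (coneO b₁ b₂)) (helmholtz P) p = helmholtz P p + P p := by
  have hH := contDiffOn_helmholtz (ordConnected_of_Ioo_subset hJ₁ hJ₂).convex
    (uniqueDiffOn_slopeCone hb hJ₁ hJ₂) hP
  have hd := hH.differentiableOn two_ne_zero p hp
  rw [← euler_helmholtz hP.continuousOn hp hd,
    (hasFDerivWithinAt_slopeCone hb hJ₁ hJ₂ hp hd).fderivWithin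
      (uniqueDiffOn_slopeCone hb hJ₁ hJ₂ p hp)]
  simp
  ring

/-- Differentiating the Helmholtz relation, the first derivatives of `H` cancel and only second
derivatives remain. -/
theorem dR_dZ_pressure (hb : b₁ < b₂) (hJ₁ : Ioo b₁ b₂ ⊆ J) (hJ₂ : J ⊆ Icc b₁ b₂)
    (hP : ContDiffOn ℝ 2 P (slopeCone J)) {p : ℝ × ℝ} (hp : p ∈ slopeCone J) :
    dR (closure (coneO b₁ b₂)) P p
      = p.1 * dR (closure (coneO b₁ b₂)) (dR (closure (coneO b₁ b₂)) (helmholtz P)) p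
        + p.2 * dR (closure (coneO b₁ b₂)) (dZ (closure (coneO b₁ b₂)) (helmholtz P)) p ∧
    dZ (closure (coneO b₁ b₂)) P p
      = p.1 * dR (closure (coneO b₁ b₂)) (dZ (closure (coneO b₁ b₂)) (helmholtz P)) p
        + p.2 * dZ (closure (coneO b₁ b₂)) (dZ (closure (coneO b₁ b₂)) (helmholtz P)) p := by
  have hu := uniqueDiffOn_slopeCone hb hJ₁ hJ₂
  have hH := contDiffOn_helmholtz (ordConnected_of_Ioo_subset hJ₁ hJ₂).convex hu hP
  set K := closure (coneO b₁ b₂) with hK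
  have h0 := hasFDerivWithinAt_slopeCone hb hJ₁ hJ₂ hp (hH.differentiableOn two_ne_zero p hp)
  have h1 := hasFDerivWithinAt_slopeCone hb hJ₁ hJ₂ hp
    ((contDiffOn_dR (m := 1) hb hJ₁ hJ₂ hH (by norm_num)).differentiableOn one_ne_zero p hp)
  have h2 := hasFDerivWithinAt_slopeCone hb hJ₁ hJ₂ hp
    ((contDiffOn_dZ (m := 1) hb hJ₁ hJ₂ hH (by norm_num)).differentiableOn one_ne_zero p hp)
  rw [dZ_dR_comm hb hJ₁ hJ₂ hp hH] at h1
  rw [← hK] at h0 h1 h2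
  have hf : HasFDerivWithinAt (Prod.fst : ℝ × ℝ → ℝ) (ContinuousLinearMap.fst ℝ ℝ ℝ)
      (slopeCone J) p := hasFDerivWithinAt_fst
  have hs : HasFDerivWithinAt (Prod.snd : ℝ × ℝ → ℝ) (ContinuousLinearMap.snd ℝ ℝ ℝ)
      (slopeCone J) p := hasFDerivWithinAt_snd
  have h3 := ((hf.mul h1).add (hs.mul h2)).sub h0
  refine eq_dR_dZ hb hJ₁ hJ₂ hp ((h3.congr_fderiv ?_).congr (fun q hq => ?_) ?_)
  · ext <;> simp <;> ring
  · have := helmholtz_relation hb hJ₁ hJ₂ hP hq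
    simp only [Pi.sub_apply, Pi.add_apply, Pi.mul_apply]
    linarith
  · have := helmholtz_relation hb hJ₁ hJ₂ hP hp
    simp only [Pi.sub_apply, Pi.add_apply, Pi.mul_apply]
    linarith

/-- On bounded parts of the cone, a `C¹` function vanishing at the vertex is `O(R)`. -/
theorem exists_bound_pressure (hb₁ : 0 < b₁) (hb : b₁ < b₂)
    (hP : ContDiffOn ℝ 1 P (closure (coneO b₁ b₂))) (hP₀ : P (0, 0) = 0) (M : ℝ) :
    ∃ C, 0 ≤ C ∧ ∀ q ∈ closure (coneO b₁ b₂), q.1 ≤ M → |P q| ≤ C * q.1 := by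
  set K := closure (coneO b₁ b₂) with hK
  have hKeq : K = {p : ℝ × ℝ | b₁ * p.1 ≤ p.2 ∧ p.2 ≤ b₂ * p.1} := closure_coneO hb
  have hpos : ∀ q ∈ K, 0 ≤ q.1 := fun q hq => by
    rw [hKeq] at hq; nlinarith [hq.1, hq.2]
  set N : Set (ℝ × ℝ) := K ∩ {q | q.1 ≤ M} with hN
  have hNconv : Convex ℝ N := convex_coneO.closure.inter
    (convex_halfSpace_le (f := fun q : ℝ × ℝ => q.1) ⟨fun _ _ => rfl, fun _ _ => rfl⟩ M)
  have hNcpt : IsCompact N := by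
    refine (isCompact_Icc (a := ((0 : ℝ), (0 : ℝ))) (b := (M, b₂ * M))).of_isClosed_subset
      (isClosed_closure.inter (isClosed_le continuous_fst continuous_const)) ?_
    rintro ⟨r, z⟩ ⟨hq, hM⟩
    have h0 := hpos _ hq
    rw [hKeq] at hq
    obtain ⟨h1, h2⟩ := hq
    simp only [mem_ofPred_eq] at h0 h1 h2 hM
    exact ⟨⟨h0, by nlinarith⟩, ⟨hM, by nlinarith⟩⟩
  obtain ⟨C, hC⟩ := hNcpt.exists_bound_of_continuousOn
    ((hP.continuousOn_fderivWithin (uniqueDiffOn_closure_coneO hb) le_rfl).mono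
      inter_subset_left)
  -- The truncated cone `N` is compact and convex and contains the vertex, so the mean value
  -- inequality starts from `P (0, 0) = 0`. The factor `max 1 b₂` compares the sup norm of `(R, Z)`
  -- with `R`.
  refine ⟨|C| * max 1 b₂, by positivity, fun q hq hqM => ?_⟩
  have h0 := hpos q hq
  have h0K : ((0 : ℝ), (0 : ℝ)) ∈ N := by
    refine ⟨?_, h0.trans hqM⟩
    rw [hKeq]; simp
  have := hNconv.norm_image_sub_le_of_norm_hasFDerivWithin_le (f := P)
    (f' := fderivWithin ℝ P K) (C := |C|)
    (fun x hx => ((hP.differentiableOn one_ne_zero x hx.1).hasFDerivWithinAt).mono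
      inter_subset_left) (fun x hx => (hC x hx).trans (le_abs_self C)) h0K ⟨hq, hqM⟩
  rw [hP₀, sub_zero, Real.norm_eq_abs] at this
  refine this.trans ?_
  rw [mul_assoc]
  refine mul_le_mul_of_nonneg_left ?_ (abs_nonneg _)
  rw [hKeq] at hq
  have h2 := hq.1
  have h3 := hq.2
  rw [Prod.norm_def]
  simp only [Prod.fst_sub, Prod.snd_sub, sub_zero, Real.norm_eq_abs]
  have h4 : 0 ≤ q.2 := (mul_nonneg hb₁.le h0).trans h2
  rw [abs_of_nonneg h0, abs_of_nonneg h4]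
  refine max_le ?_ (h3.trans ?_)
  · exact le_mul_of_one_le_left h0 (le_max_left _ _)
  · exact mul_le_mul_of_nonneg_right (le_max_right _ _) h0

/-- Since `P` is `O(s)` along rays, the integrand is `O(1/s)`. Bounding `1/s` by `1/min 1 R` is
enough, because the prefactor `R` in `H` compensates it as `R → 0`. -/
theorem exists_bound_helmholtz (hb₁ : 0 < b₁) (hb : b₁ < b₂)
    (hP : ContDiffOn ℝ 1 P (closure (coneO b₁ b₂))) (hP₀ : P (0, 0) = 0) (M : ℝ) :
    ∃ C, ∀ q ∈ closure (coneO b₁ b₂), q.1 ≤ M → |helmholtz P q| ≤ C := by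
  obtain ⟨C, hC0, hC⟩ := exists_bound_pressure hb₁ hb hP hP₀ (max 1 M)
  refine ⟨C * (max 1 M) * (max 1 M + 1), fun q hq hqM => ?_⟩
  have hpos : 0 ≤ q.1 := by
    rw [closure_coneO hb] at hq; nlinarith [hq.1, hq.2]
  have hM : 1 ≤ max 1 M := le_max_left _ _
  rcases hpos.eq_or_lt with h0 | h0
  · rw [helmholtz, ← h0, zero_mul, abs_zero]; positivity
  have hint : ‖∫ s in (1 : ℝ)..q.1, P (s, s * (q.2 / q.1)) / s ^ 2‖
      ≤ C / min 1 q.1 * |q.1 - 1| := by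
    refine intervalIntegral.norm_integral_le_of_norm_le_const fun s hs => ?_
    have hs1 : min 1 q.1 < s := hs.1
    have hs2 : s ≤ max 1 M := hs.2.trans (max_le_max le_rfl hqM)
    have hmin : 0 < min 1 q.1 := lt_min one_pos h0
    have hs0 : 0 < s := hmin.trans hs1
    have hmem : (s, s * (q.2 / q.1)) ∈ closure (coneO b₁ b₂) :=
      slopeCone_subset_closure hb Subset.rfl (mk_mem_slopeCone (mem_slopeCone_Icc hb hq h0) hs0)
    rw [norm_div, Real.norm_eq_abs, norm_pow, Real.norm_eq_abs, abs_of_pos hs0,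
      div_le_div_iff₀ (by positivity) hmin]
    have h1 := hC _ hmem hs2
    simp only at h1
    calc |P (s, s * (q.2 / q.1))| * min 1 q.1 ≤ C * s * s := by gcongr
      _ = C * s ^ 2 := by ring
  rw [helmholtz, abs_mul, abs_of_pos h0]
  have hq' : q.1 / min 1 q.1 ≤ max 1 M := by
    rw [div_le_iff₀ (lt_min one_pos h0)]
    rcases le_total 1 q.1 with h | h
    · rw [min_eq_left h]; linarith [le_max_right 1 M]
    · rw [min_eq_right h]; nlinarith
  have hab : |q.1 - 1| ≤ max 1 M + 1 := by
    rw [abs_le]; constructor <;> linarith [le_max_right 1 M]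
  calc q.1 * |∫ s in (1 : ℝ)..q.1, P (s, s * (q.2 / q.1)) / s ^ 2|
      ≤ q.1 * (C / min 1 q.1 * |q.1 - 1|) := by gcongr; exact hint
    _ = C * (q.1 / min 1 q.1) * |q.1 - 1| := by ring
    _ ≤ _ := by gcongr

/-- Along a continuous field with values in the closed cone, the Helmholtz function is measurable. -/
theorem measurable_helmholtz_comp {X : Type*} [TopologicalSpace X] [MeasurableSpace X]
    [OpensMeasurableSpace X] (hb : b₁ < b₂)
    (hP : ContinuousOn P (closure (coneO b₁ b₂))) {f : X → ℝ × ℝ} (hf : Continuous f)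
    (hfK : ∀ x, f x ∈ closure (coneO b₁ b₂)) : Measurable fun x => helmholtz P (f x) := by
  classical
  have hU : IsOpen {x | 0 < (f x).1} := isOpen_lt continuous_const (by fun_prop)
  have hc : ContinuousOn (fun x => helmholtz P (f x)) {x | 0 < (f x).1} :=
    (continuousOn_helmholtz (J := Icc b₁ b₂)
      (hP.mono (slopeCone_subset_closure hb Subset.rfl))).comp hf.continuousOn
      fun x hx => mem_slopeCone_Icc hb (hfK x) hx
  have := hc.measurable_piecewise (continuousOn_const (c := (0 : ℝ))
    (s := {x | 0 < (f x).1}ᶜ)) hU.measurableSet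
  convert this using 1
  ext x
  by_cases hx : 0 < (f x).1
  · rw [piecewise_eq_of_mem _ _ _ (show x ∈ {x | 0 < (f x).1} from hx)]
  · rw [piecewise_eq_of_notMem _ _ _ (show x ∉ {x | 0 < (f x).1} from hx)]
    have h := hfK x
    rw [closure_coneO hb] at h
    have : (f x).1 = 0 := le_antisymm (not_lt.1 hx) (by nlinarith [h.1, h.2])
    rw [helmholtz, this, zero_mul]

end ConeDerivatives

/-! ### Calculus on the closed cylinder -/

section Cylinder

variable {d : ℕ} {T : ℝ} {Ω : Set (E d)} {F : Type*} [NormedAddCommGroup F] [NormedSpace ℝ F]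

theorem dt_eq_of_hasFDerivWithinAt (hT : 0 < T) {φ : ℝ → E d → F} {φ' : ℝ × E d →L[ℝ] F}
    {t : ℝ} {x : E d} (ht : t ∈ Icc 0 T) (hx : x ∈ closure Ω)
    (h : HasFDerivWithinAt (fun p : ℝ × E d => φ p.1 p.2) φ' (Icc 0 T ×ˢ closure Ω) (t, x)) :
    dt T φ t x = φ' (1, 0) := by
  have h1 : HasDerivWithinAt (fun s : ℝ => (s, x)) ((1 : ℝ), (0 : E d)) (Icc 0 T) t :=
    ((hasDerivAt_id t).prodMk (hasDerivAt_const t x)).hasDerivWithinAt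
  have h2 := HasFDerivWithinAt.comp_hasDerivWithinAt (t := Icc 0 T ×ˢ closure Ω) t h h1
    fun s hs => ⟨hs, hx⟩
  exact HasDerivWithinAt.derivWithin h2 (uniqueDiffOn_Icc hT t ht)

theorem fderivWithin_eq_of_hasFDerivWithinAt (hu : UniqueDiffOn ℝ (closure Ω))
    {φ : ℝ → E d → F} {φ' : ℝ × E d →L[ℝ] F} {t : ℝ} {x : E d} (ht : t ∈ Icc 0 T)
    (hx : x ∈ closure Ω)
    (h : HasFDerivWithinAt (fun p : ℝ × E d => φ p.1 p.2) φ' (Icc 0 T ×ˢ closure Ω) (t, x))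
    (v : E d) : fderivWithin ℝ (φ t) (closure Ω) x v = φ' (0, v) := by
  have h1 : HasFDerivWithinAt (fun y : E d => (t, y)) (ContinuousLinearMap.inr ℝ ℝ (E d))
    (closure Ω) x := (hasFDerivAt_prodMk_right t x).hasFDerivWithinAt
  have h2 := HasFDerivWithinAt.comp (f := fun y : E d => (t, y)) x h h1 fun y hy => ⟨ht, hy⟩
  have h3 := HasFDerivWithinAt.fderivWithin (f := φ t) h2 (hu x hx)
  rw [h3]; simp

theorem pd_eq_of_hasFDerivWithinAt (hu : UniqueDiffOn ℝ (closure Ω))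
    {φ : ℝ → E d → ℝ} {φ' : ℝ × E d →L[ℝ] ℝ} {t : ℝ} {x : E d} (ht : t ∈ Icc 0 T)
    (hx : x ∈ closure Ω)
    (h : HasFDerivWithinAt (fun p : ℝ × E d => φ p.1 p.2) φ' (Icc 0 T ×ˢ closure Ω) (t, x))
    (j : Fin d) : pd Ω j (φ t) x = φ' (0, EuclideanSpace.single j 1) :=
  fderivWithin_eq_of_hasFDerivWithinAt hu ht hx h _

theorem IsC1.hasFDerivWithinAt {φ : ℝ → E d → F} (h : IsC1 T Ω φ) {t : ℝ} {x : E d}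
    (ht : t ∈ Icc 0 T) (hx : x ∈ closure Ω) :
    HasFDerivWithinAt (fun p : ℝ × E d => φ p.1 p.2)
      (fderivWithin ℝ (fun p : ℝ × E d => φ p.1 p.2) (Icc 0 T ×ˢ closure Ω) (t, x))
      (Icc 0 T ×ˢ closure Ω) (t, x) :=
  (h.differentiableOn one_ne_zero _ ⟨ht, hx⟩).hasFDerivWithinAt

theorem IsC1.component {φ : ℝ → E d → E d} (h : IsC1 T Ω φ) (i : Fin d) :
    IsC1 T Ω fun t x => φ t x i :=
  (EuclideanSpace.proj i : E d →L[ℝ] ℝ).contDiff.comp_contDiffOn h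

theorem IsC1.continuousOn {φ : ℝ → E d → F} (h : IsC1 T Ω φ) :
    ContinuousOn (fun p : ℝ × E d => φ p.1 p.2) (Icc 0 T ×ˢ closure Ω) :=
  ContDiffOn.continuousOn h

theorem IsC1.slice {φ : ℝ → E d → F} (h : IsC1 T Ω φ) {t : ℝ} (ht : t ∈ Icc 0 T) :
    ContDiffOn ℝ 1 (φ t) (closure Ω) :=
  ContDiffOn.comp (g := fun p : ℝ × E d => φ p.1 p.2) (f := fun x : E d => (t, x)) h
    (by fun_prop) fun x hx => ⟨ht, hx⟩

theorem isC1_const {f : E d → F} (h : ContDiff ℝ 1 f) : IsC1 T Ω fun _ x => f x :=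
  (h.comp contDiff_snd).contDiffOn

theorem IsC1.continuousOn_dt (hT : 0 < T) (hu : UniqueDiffOn ℝ (closure Ω)) {φ : ℝ → E d → F}
    (h : IsC1 T Ω φ) :
    ContinuousOn (fun p : ℝ × E d => dt T φ p.1 p.2) (Icc 0 T ×ˢ closure Ω) := by
  have := (ContDiffOn.continuousOn_fderivWithin h ((uniqueDiffOn_Icc hT).prod hu) le_rfl).clm_apply
    (continuousOn_const (c := ((1 : ℝ), (0 : E d))))
  exact this.congr fun p hp =>
    dt_eq_of_hasFDerivWithinAt hT hp.1 hp.2 (h.hasFDerivWithinAt hp.1 hp.2)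

theorem IsC1.continuousOn_pd (hT : 0 < T) (hu : UniqueDiffOn ℝ (closure Ω)) {φ : ℝ → E d → ℝ}
    (h : IsC1 T Ω φ) (j : Fin d) :
    ContinuousOn (fun p : ℝ × E d => pd Ω j (φ p.1) p.2) (Icc 0 T ×ˢ closure Ω) := by
  have := (ContDiffOn.continuousOn_fderivWithin h ((uniqueDiffOn_Icc hT).prod hu) le_rfl).clm_apply
    (continuousOn_const (c := ((0 : ℝ), (EuclideanSpace.single j (1 : ℝ) : E d))))
  exact this.congr fun p hp =>
    pd_eq_of_hasFDerivWithinAt hu hp.1 hp.2 (h.hasFDerivWithinAt hp.1 hp.2) j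

theorem IsC1.continuousOn_jac (hT : 0 < T) (hu : UniqueDiffOn ℝ (closure Ω))
    {φ : ℝ → E d → E d} (h : IsC1 T Ω φ) (i j : Fin d) :
    ContinuousOn (fun p : ℝ × E d => jac Ω (φ p.1) p.2 i j) (Icc 0 T ×ˢ closure Ω) :=
  (h.component i).continuousOn_pd hT hu j

theorem dt_apply (hT : 0 < T) {φ : ℝ → E d → E d}
    {t : ℝ} {x : E d} (h : IsC1 T Ω φ) (ht : t ∈ Icc 0 T) (hx : x ∈ closure Ω) (i : Fin d) :
    dt T φ t x i = dt T (fun s y => φ s y i) t x := by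
  have h1 := h.hasFDerivWithinAt ht hx
  rw [dt_eq_of_hasFDerivWithinAt hT ht hx h1,
    dt_eq_of_hasFDerivWithinAt hT ht hx (φ := fun s y => φ s y i)
      (HasFDerivAt.comp_hasFDerivWithinAt (t, x) (g := (EuclideanSpace.proj i : E d →L[ℝ] ℝ))
        (ContinuousLinearMap.hasFDerivAt _) h1)]
  rfl

/-- A scalar `C¹` field on the cylinder together with its derivatives at a point. -/
structure HasCylDeriv (T : ℝ) (Ω : Set (E d)) (φ : ℝ → E d → ℝ) (t : ℝ) (x : E d) (a : ℝ)
    (b : Fin d → ℝ) : Prop where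
  diff : DifferentiableWithinAt ℝ (fun p : ℝ × E d => φ p.1 p.2) (Icc 0 T ×ˢ closure Ω) (t, x)
  time : dt T φ t x = a
  space : ∀ j, pd Ω j (φ t) x = b j

section

variable {φ ψ : ℝ → E d → ℝ} {t : ℝ} {x : E d} {a a' : ℝ} {b b' : Fin d → ℝ}

theorem IsC1.hasCylDeriv (h : IsC1 T Ω φ) (ht : t ∈ Icc 0 T) (hx : x ∈ closure Ω) :
    HasCylDeriv T Ω φ t x (dt T φ t x) (fun j => pd Ω j (φ t) x) :=
  ⟨h.differentiableOn one_ne_zero _ ⟨ht, hx⟩, rfl, fun _ => rfl⟩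

theorem HasCylDeriv.of_hasFDerivWithinAt (hT : 0 < T) (hu : UniqueDiffOn ℝ (closure Ω))
    (ht : t ∈ Icc 0 T) (hx : x ∈ closure Ω) {φ' : ℝ × E d →L[ℝ] ℝ}
    (h : HasFDerivWithinAt (fun p : ℝ × E d => φ p.1 p.2) φ' (Icc 0 T ×ˢ closure Ω) (t, x)) :
    HasCylDeriv T Ω φ t x (φ' (1, 0)) fun j => φ' (0, EuclideanSpace.single j 1) :=
  ⟨h.differentiableWithinAt, dt_eq_of_hasFDerivWithinAt hT ht hx h,
    pd_eq_of_hasFDerivWithinAt hu ht hx h⟩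

theorem HasCylDeriv.exists_hasFDerivWithinAt (hT : 0 < T) (hu : UniqueDiffOn ℝ (closure Ω))
    (ht : t ∈ Icc 0 T) (hx : x ∈ closure Ω) (h : HasCylDeriv T Ω φ t x a b) :
    ∃ φ' : ℝ × E d →L[ℝ] ℝ,
      HasFDerivWithinAt (fun p : ℝ × E d => φ p.1 p.2) φ' (Icc 0 T ×ˢ closure Ω) (t, x) ∧
      φ' (1, 0) = a ∧ ∀ j, φ' (0, EuclideanSpace.single j 1) = b j :=
  ⟨_, h.diff.hasFDerivWithinAt,
    (dt_eq_of_hasFDerivWithinAt hT ht hx h.diff.hasFDerivWithinAt).symm.trans h.time,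
    fun j => (pd_eq_of_hasFDerivWithinAt hu ht hx h.diff.hasFDerivWithinAt j).symm.trans
      (h.space j)⟩

theorem HasCylDeriv.congr_deriv (h : HasCylDeriv T Ω φ t x a b) (ha : a = a')
    (hb : ∀ j, b j = b' j) : HasCylDeriv T Ω φ t x a' b' :=
  ⟨h.diff, h.time.trans ha, fun j => (h.space j).trans (hb j)⟩

theorem HasCylDeriv.add (hT : 0 < T) (hu : UniqueDiffOn ℝ (closure Ω))
    (ht : t ∈ Icc 0 T) (hx : x ∈ closure Ω) (h : HasCylDeriv T Ω φ t x a b)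
    (h' : HasCylDeriv T Ω ψ t x a' b') :
    HasCylDeriv T Ω (fun s y => φ s y + ψ s y) t x (a + a') fun j => b j + b' j := by
  obtain ⟨f, hf, hf1, hf2⟩ := h.exists_hasFDerivWithinAt hT hu ht hx
  obtain ⟨g, hg, hg1, hg2⟩ := h'.exists_hasFDerivWithinAt hT hu ht hx
  refine (HasCylDeriv.of_hasFDerivWithinAt hT hu ht hx (hf.add hg)).congr_deriv ?_ fun j => ?_
  · simp [hf1, hg1]
  · simp [hf2, hg2]

theorem HasCylDeriv.sub (hT : 0 < T) (hu : UniqueDiffOn ℝ (closure Ω))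
    (ht : t ∈ Icc 0 T) (hx : x ∈ closure Ω) (h : HasCylDeriv T Ω φ t x a b)
    (h' : HasCylDeriv T Ω ψ t x a' b') :
    HasCylDeriv T Ω (fun s y => φ s y - ψ s y) t x (a - a') fun j => b j - b' j := by
  obtain ⟨f, hf, hf1, hf2⟩ := h.exists_hasFDerivWithinAt hT hu ht hx
  obtain ⟨g, hg, hg1, hg2⟩ := h'.exists_hasFDerivWithinAt hT hu ht hx
  refine (HasCylDeriv.of_hasFDerivWithinAt hT hu ht hx (hf.sub hg)).congr_deriv ?_ fun j => ?_
  · simp [hf1, hg1]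
  · simp [hf2, hg2]

theorem HasCylDeriv.mul (hT : 0 < T) (hu : UniqueDiffOn ℝ (closure Ω))
    (ht : t ∈ Icc 0 T) (hx : x ∈ closure Ω) (h : HasCylDeriv T Ω φ t x a b)
    (h' : HasCylDeriv T Ω ψ t x a' b') :
    HasCylDeriv T Ω (fun s y => φ s y * ψ s y) t x (φ t x * a' + ψ t x * a)
      fun j => φ t x * b' j + ψ t x * b j := by
  obtain ⟨f, hf, hf1, hf2⟩ := h.exists_hasFDerivWithinAt hT hu ht hx
  obtain ⟨g, hg, hg1, hg2⟩ := h'.exists_hasFDerivWithinAt hT hu ht hx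
  refine (HasCylDeriv.of_hasFDerivWithinAt hT hu ht hx (hf.mul hg)).congr_deriv ?_ fun j => ?_
  · simp [hf1, hg1]
  · simp [hf2, hg2]

theorem HasCylDeriv.const_mul (hT : 0 < T) (hu : UniqueDiffOn ℝ (closure Ω))
    (ht : t ∈ Icc 0 T) (hx : x ∈ closure Ω) (c : ℝ) (h : HasCylDeriv T Ω φ t x a b) :
    HasCylDeriv T Ω (fun s y => c * φ s y) t x (c * a) fun j => c * b j := by
  obtain ⟨f, hf, hf1, hf2⟩ := h.exists_hasFDerivWithinAt hT hu ht hx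
  refine (HasCylDeriv.of_hasFDerivWithinAt hT hu ht hx (hf.const_mul c)).congr_deriv ?_
    fun j => ?_
  · simp [hf1]
  · simp [hf2]

theorem HasCylDeriv.comp₂ (hT : 0 < T) (hu : UniqueDiffOn ℝ (closure Ω))
    (ht : t ∈ Icc 0 T) (hx : x ∈ closure Ω) (h : HasCylDeriv T Ω φ t x a b)
    (h' : HasCylDeriv T Ω ψ t x a' b') {G : ℝ × ℝ → ℝ} {S : Set (ℝ × ℝ)} {c c' : ℝ}
    (hG : HasFDerivWithinAt G (c • ContinuousLinearMap.fst ℝ ℝ ℝ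
      + c' • ContinuousLinearMap.snd ℝ ℝ ℝ) S (φ t x, ψ t x))
    (hS : ∀ s ∈ Icc 0 T, ∀ y ∈ closure Ω, (φ s y, ψ s y) ∈ S) :
    HasCylDeriv T Ω (fun s y => G (φ s y, ψ s y)) t x (c * a + c' * a')
      fun j => c * b j + c' * b' j := by
  obtain ⟨f, hf, hf1, hf2⟩ := h.exists_hasFDerivWithinAt hT hu ht hx
  obtain ⟨g, hg, hg1, hg2⟩ := h'.exists_hasFDerivWithinAt hT hu ht hx
  refine (HasCylDeriv.of_hasFDerivWithinAt hT hu ht hx (HasFDerivWithinAt.comp (t, x) hG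
    (hf.prodMk hg) fun p hp => hS _ hp.1 _ hp.2)).congr_deriv ?_ fun j => ?_
  · simp [hf1, hg1]
  · simp [hf2, hg2]

theorem HasCylDeriv.norm_sq (hT : 0 < T) (hu : UniqueDiffOn ℝ (closure Ω))
    (ht : t ∈ Icc 0 T) (hx : x ∈ closure Ω) {v : ℝ → E d → E d} (h : IsC1 T Ω v) :
    HasCylDeriv T Ω (fun s y => ‖v s y‖ ^ 2) t x (2 * ∑ i, v t x i * dt T (fun s y => v s y i) t x)
      fun j => 2 * ∑ i, v t x i * pd Ω j (fun y => v t y i) x := by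
  have hi : ∀ i, HasFDerivWithinAt (fun p : ℝ × E d => v p.1 p.2 i ^ 2) _ _ _ := fun i =>
    ((h.component i).hasFDerivWithinAt ht hx).pow 2
  have hs : HasFDerivWithinAt (fun p : ℝ × E d => ‖v p.1 p.2‖ ^ 2) _ _ _ :=
    (HasFDerivWithinAt.fun_sum (u := Finset.univ) fun i _ => hi i).congr_of_eventuallyEq
      (Eventually.of_forall fun p => by
        simp [EuclideanSpace.norm_sq_eq]) (by simp [EuclideanSpace.norm_sq_eq])
  refine (HasCylDeriv.of_hasFDerivWithinAt hT hu ht hx hs).congr_deriv ?_ fun j => ?_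
  · simp only [sum_apply, smul_apply, Finset.mul_sum]
    refine Finset.sum_congr rfl fun i _ => ?_
    rw [dt_eq_of_hasFDerivWithinAt hT ht hx ((h.component i).hasFDerivWithinAt ht hx)]
    simp; ring
  · simp only [sum_apply, smul_apply, Finset.mul_sum]
    refine Finset.sum_congr rfl fun i _ => ?_
    rw [pd_eq_of_hasFDerivWithinAt (φ := fun s y => v s y i) hu ht hx ((h.component i).hasFDerivWithinAt ht hx)]
    simp; ring

end

end Cylinder

/-- Tietze extension. Measurability of the defects is formulated for test functions continuous on
the whole space, while the fields are controlled only on the closed cylinder. -/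
theorem exists_bounded_continuous_extension {X : Type*} [TopologicalSpace X] [T2Space X]
    [NormalSpace X] {s : Set X} (hs : IsCompact s) {f : X → ℝ} (hf : ContinuousOn f s) :
    ∃ g : X → ℝ, Continuous g ∧ (∃ C, ∀ x, |g x| ≤ C) ∧ EqOn g f s := by
  have : CompactSpace s := isCompact_iff_compactSpace.1 hs
  obtain ⟨g, -, hg⟩ := BoundedContinuousFunction.exists_extension_norm_eq_of_isClosedEmbedding
    (BoundedContinuousFunction.mkOfCompact ⟨s.domRestrict f, continuousOn_iff_continuous_domRestrict.1 hf⟩)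
    hs.isClosed.isClosedEmbedding_subtypeVal
  exact ⟨g, g.continuous, ⟨‖g‖, fun x => g.norm_coe_le_norm x⟩,
    fun x hx => congrFun hg ⟨x, hx⟩⟩

/-! ### Pairing of continuous fields with the defect measures -/

section Pairing

variable {d : ℕ} {T : ℝ} {Ω : Set (E d)}

instance (M : SignedMeasure (E d)) : IsFiniteMeasure M.variation := by
  rw [← SignedMeasure.totalVariation_eq_variation]; infer_instance

theorem integrable_signed_restrict (hΩ : IsCompact (closure Ω)) (M : SignedMeasure (E d))
    {f : E d → ℝ} (hf : ContinuousOn f (closure Ω)) :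
    (M.restrict (closure Ω)).Integrable f := by
  rw [VectorMeasure.Integrable, VectorMeasure.variation_restrict isClosed_closure.measurableSet]
  exact hf.integrableOn_compact hΩ

theorem norm_setIntegral_signed_le (M : SignedMeasure (E d)) {f : E d → ℝ} {C : ℝ}
    (hC : ∀ x ∈ closure Ω, |f x| ≤ C) (hC0 : 0 ≤ C) :
    |∫ᵛ x in closure Ω, f x ∂<•M| ≤ C * M.totalVariation.real univ := by
  have hm : MeasurableSet (closure Ω) := isClosed_closure.measurableSet
  have hB : ‖(ContinuousLinearMap.lsmul ℝ ℝ : ℝ →L[ℝ] ℝ →L[ℝ] ℝ).flip‖ ≤ 1 := by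
    rw [ContinuousLinearMap.opNorm_flip]
    exact ContinuousLinearMap.opNorm_lsmul_le
  have hfin : IsFiniteMeasure (M.restrict (closure Ω)).variation := inferInstance
  have h := VectorMeasure.norm_integral_le_of_norm_le_const (μ := M.restrict (closure Ω))
    (B := (ContinuousLinearMap.lsmul ℝ ℝ : ℝ →L[ℝ] ℝ →L[ℝ] ℝ).flip) (f := f) (C := C) (by
      rw [VectorMeasure.variation_restrict hm]
      exact (ae_restrict_iff' hm).2 (ae_of_all _ hC))
  rw [Real.norm_eq_abs] at h
  refine h.trans ?_
  rw [VectorMeasure.variation_restrict hm, SignedMeasure.totalVariation_eq_variation]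
  have h1 : (M.variation.restrict (closure Ω)).real univ ≤ M.variation.real univ := by
    rw [measureReal_restrict_apply MeasurableSet.univ]
    exact measureReal_mono (subset_univ _)
  calc _ ≤ C * 1 * M.variation.real univ := by gcongr
    _ = _ := by ring

/-- Handles test functions that are piecewise constant in time: a countable choice of measurable
functions, selected measurably. -/
theorem aemeasurable_comp_countable {α β : Type*} [MeasurableSpace α] [MeasurableSpace β]
    [Countable β] [MeasurableSingletonClass β] {μ : Measure α} {F : β → α → ℝ}
    (hF : ∀ k, AEMeasurable (F k) μ) {k : α → β} (hk : Measurable k) :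
    AEMeasurable (fun t => F (k t) t) μ := by
  refine ⟨fun t => (hF (k t)).mk _ t, ?_, ?_⟩
  · have : Measurable fun p : α × β => (hF p.2).mk _ p.1 :=
      measurable_from_prod_countable_left fun b => (hF b).measurable_mk
    exact this.comp (measurable_id.prodMk hk)
  · filter_upwards [ae_all_iff.2 fun b => (hF b).ae_eq_mk] with t ht using ht _

/-- Weak-* measurability concerns test functions independent of time. Freezing the time of the field
on a fine grid reduces to that case, and the boundedness of total variations then gives
integrability. -/
theorem IsTensorDefect.integrable_pairing_entry (hΩ : IsCompact (closure Ω))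
    {M : ℝ → Fin d → Fin d → SignedMeasure (E d)} (hM : IsTensorDefect T Ω M) {g : ℝ → E d → ℝ}
    (hg : ContinuousOn (fun p : ℝ × E d => g p.1 p.2) (Icc 0 T ×ˢ closure Ω)) (i j : Fin d) :
    Integrable (fun t => ∫ᵛ x in closure Ω, g t x ∂<•(M t i j)) (volume.restrict (Ioo 0 T)) := by
  obtain ⟨G, hGc, ⟨C, hC⟩, hG⟩ := exists_bounded_continuous_extension (isCompact_Icc.prod hΩ) hg
  have hC0 : 0 ≤ C := (abs_nonneg _).trans (hC (0, 0))
  have hcongr : (fun t => ∫ᵛ x in closure Ω, G (t, x) ∂<•(M t i j))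
      =ᵐ[volume.restrict (Ioo 0 T)] fun t => ∫ᵛ x in closure Ω, g t x ∂<•(M t i j) := by
    filter_upwards [ae_restrict_mem measurableSet_Ioo] with t ht
    exact VectorMeasure.setIntegral_congr_fun fun x hx => hG ⟨Ioo_subset_Icc_self ht, hx⟩
  have hmeas : AEMeasurable (fun t => ∫ᵛ x in closure Ω, G (t, x) ∂<•(M t i j))
      (volume.restrict (Ioo 0 T)) := by
    -- The grid point `⌊(n+1)t⌋/(n+1)` tends to `t`. For each fixed `t` the frozen pairings converge
    -- by dominated convergence against the finite variation measure.
    refine aemeasurable_of_tendsto_metrizable_ae' (f := fun (n : ℕ) t =>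
      ∫ᵛ x in closure Ω, G ((⌊((n : ℝ) + 1) * t⌋ : ℝ) / ((n : ℝ) + 1), x) ∂<•(M t i j))
      (fun n => ?_) (ae_of_all _ fun t => ?_)
    · exact aemeasurable_comp_countable
        (F := fun (k : ℤ) t => ∫ᵛ x in closure Ω, G ((k : ℝ) / ((n : ℝ) + 1), x) ∂<•(M t i j))
        (k := fun t => ⌊((n : ℝ) + 1) * t⌋)
        (fun k => hM.measurable i j _ (by fun_prop)) (by fun_prop)
    · have hfloor : Tendsto (fun n : ℕ => (⌊((n : ℝ) + 1) * t⌋ : ℝ) / ((n : ℝ) + 1)) atTop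
          (𝓝 t) := by
        rw [tendsto_iff_dist_tendsto_zero]
        refine squeeze_zero (fun _ => dist_nonneg) (fun n => ?_) tendsto_one_div_add_atTop_nhds_zero_nat
        have hn : (0 : ℝ) < (n : ℝ) + 1 := by positivity
        rw [Real.dist_eq, abs_sub_comm, abs_of_nonneg, sub_le_iff_le_add, ← add_div, le_div_iff₀ hn]
        · linarith [Int.lt_floor_add_one (((n : ℝ) + 1) * t)]
        · rw [sub_nonneg, div_le_iff₀ hn]
          linarith [Int.floor_le (((n : ℝ) + 1) * t)]
      have hfin : IsFiniteMeasure ((M t i j).restrict (closure Ω)).variation := inferInstance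
      refine VectorMeasure.tendsto_integral_of_dominated_convergence (fun _ => C)
        (fun n => ?_) (integrable_const _) (fun n => ae_of_all _ fun x => hC _)
        (ae_of_all _ fun x => ?_)
      · exact Continuous.aestronglyMeasurable (by fun_prop)
      · exact (hGc.tendsto (t, x)).comp (hfloor.prodMk_nhds tendsto_const_nhds)
  obtain ⟨B, hB⟩ := hM.bounded
  refine (Integrable.of_bound (C := C * B) hmeas.aestronglyMeasurable ?_).congr hcongr
  filter_upwards [hB] with t ht
  rw [Real.norm_eq_abs]
  refine (norm_setIntegral_signed_le _ (fun x _ => hC _) hC0).trans ?_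
  gcongr
  exact ENNReal.toReal_le_coe_of_le_coe (ht i j)

theorem pairing_sub (hΩ : IsCompact (closure Ω)) {A B : E d → Mat d}
    (hA : ∀ i j, ContinuousOn (fun x => A x i j) (closure Ω))
    (hB : ∀ i j, ContinuousOn (fun x => B x i j) (closure Ω))
    (M : Fin d → Fin d → SignedMeasure (E d)) :
    pairing Ω (fun x => A x - B x) M = pairing Ω A M - pairing Ω B M := by
  simp only [pairing, ← Finset.sum_sub_distrib]
  refine Finset.sum_congr rfl fun i _ => Finset.sum_congr rfl fun j _ => ?_
  exact VectorMeasure.integral_fun_sub (integrable_signed_restrict hΩ _ (hA i j))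
    (integrable_signed_restrict hΩ _ (hB i j))

theorem pairing_congr {A B : E d → Mat d} (h : ∀ x ∈ closure Ω, A x = B x)
    (M : Fin d → Fin d → SignedMeasure (E d)) : pairing Ω A M = pairing Ω B M := by
  simp only [pairing]
  refine Finset.sum_congr rfl fun i _ => Finset.sum_congr rfl fun j _ => ?_
  exact VectorMeasure.setIntegral_congr_fun fun x hx => by simp only [h x hx]

theorem IsTensorDefect.integrable_pairing (hΩ : IsCompact (closure Ω))
    {M : ℝ → Fin d → Fin d → SignedMeasure (E d)} (hM : IsTensorDefect T Ω M)
    {A : ℝ → E d → Mat d}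
    (hA : ∀ i j, ContinuousOn (fun p : ℝ × E d => A p.1 p.2 i j) (Icc 0 T ×ˢ closure Ω)) :
    Integrable (fun t => pairing Ω (A t) (M t)) (volume.restrict (Ioo 0 T)) :=
  integrable_finsetSum _ fun i _ => integrable_finsetSum _ fun j _ =>
    hM.integrable_pairing_entry hΩ (g := fun t x => A t x i j) (hA i j) i j

end Pairing

/-! ### Iterated integrals over the cylinder -/

section Iterated

variable {X : Type*} [MeasurableSpace X] {ν : Measure X} [SFinite ν] {T τ : ℝ}
  {f g : ℝ → X → ℝ}

theorem integrable_prod_restrict_mono {F : Type*} [NormedAddCommGroup F] {f : ℝ × X → F}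
    (hf : Integrable f ((volume.restrict (Ioo 0 T)).prod ν)) (hτ : τ ≤ T) :
    Integrable f ((volume.restrict (Ioo 0 τ)).prod ν) := by
  have h : (volume.restrict (Ioo 0 τ)).prod ν
      = ((volume.restrict (Ioo 0 T)).prod ν).restrict (Ioo 0 τ ×ˢ univ) := by
    rw [← Measure.prod_restrict, Measure.restrict_univ,
      Measure.restrict_restrict measurableSet_Ioo,
      inter_eq_left.2 (Ioo_subset_Ioo_right hτ)]
  rw [h]
  exact hf.restrict

theorem intervalIntegral_integral_eq (hτ : τ ∈ Icc 0 T)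
    (hf : Integrable (fun p : ℝ × X => f p.1 p.2) ((volume.restrict (Ioo 0 T)).prod ν)) :
    ∫ t in (0 : ℝ)..τ, ∫ x, f t x ∂ν
      = ∫ p, f p.1 p.2 ∂((volume.restrict (Ioo 0 τ)).prod ν) := by
  rw [intervalIntegral.integral_of_le hτ.1, integral_Ioc_eq_integral_Ioo]
  exact (integral_prod _ (integrable_prod_restrict_mono hf hτ.2)).symm

end Iterated

/-! ### Continuous coefficients on the cylinder -/

section Coefficients

variable {d : ℕ} {T : ℝ} {Ω : Set (E d)}

theorem aestronglyMeasurable_of_continuousOn_cyl {F : Type*} [NormedAddCommGroup F]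
    (hΩo : IsOpen Ω) {c : ℝ × E d → F}
    (hc : ContinuousOn c (Icc 0 T ×ˢ closure Ω)) :
    AEStronglyMeasurable c ((volume.restrict (Ioo 0 T)).prod (volume.restrict Ω)) := by
  rw [Measure.prod_restrict, ← Measure.volume_eq_prod]
  exact (hc.mono (prod_mono Ioo_subset_Icc_self subset_closure)).aestronglyMeasurable_of_isSeparable
    (measurableSet_Ioo.prod hΩo.measurableSet)
    (TopologicalSpace.IsSeparable.of_separableSpace _)

theorem ae_mem_cyl (hΩo : IsOpen Ω) :
    ∀ᵐ p ∂((volume.restrict (Ioo 0 T)).prod (volume.restrict Ω) : Measure (ℝ × E d)),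
      p.1 ∈ Ioo 0 T ∧ p.2 ∈ Ω := by
  rw [Measure.prod_restrict]
  exact ae_restrict_mem (measurableSet_Ioo.prod hΩo.measurableSet)

theorem exists_bound_cyl {F : Type*} [NormedAddCommGroup F]
    (hΩc : IsCompact (closure Ω)) (hΩo : IsOpen Ω) {c : ℝ × E d → F}
    (hc : ContinuousOn c (Icc 0 T ×ˢ closure Ω)) :
    ∃ C, ∀ᵐ p ∂((volume.restrict (Ioo 0 T)).prod (volume.restrict Ω) : Measure (ℝ × E d)),
      ‖c p‖ ≤ C := by
  obtain ⟨C, hC⟩ := (isCompact_Icc.prod hΩc).exists_bound_of_continuousOn hc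
  refine ⟨C, ?_⟩
  filter_upwards [ae_mem_cyl hΩo] with p hp
  exact hC p ⟨Ioo_subset_Icc_self hp.1, subset_closure hp.2⟩

theorem integrable_coef_mul (hΩc : IsCompact (closure Ω)) (hΩo : IsOpen Ω) {c f : ℝ × E d → ℝ}
    (hc : ContinuousOn c (Icc 0 T ×ˢ closure Ω))
    (hf : Integrable f ((volume.restrict (Ioo 0 T)).prod (volume.restrict Ω))) :
    Integrable (fun p => c p * f p) ((volume.restrict (Ioo 0 T)).prod (volume.restrict Ω)) := by
  obtain ⟨C, hC⟩ := exists_bound_cyl hΩc hΩo hc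
  exact hf.bdd_mul (aestronglyMeasurable_of_continuousOn_cyl hΩo hc) hC

end Coefficients

/-! ### Integrability from bounds on time slices -/

section LpSlices

variable {d : ℕ} {T : ℝ} {Ω : Set (E d)} {F : Type*} [NormedAddCommGroup F]
  [InnerProductSpace ℝ F]

theorem IsWeaklyContinuous.integrable_slice {p : ℝ} (hp : 1 ≤ p)
    (hΩ : volume Ω ≠ ⊤) {f : ℝ → E d → F} (hf : IsWeaklyContinuous T Ω p f) {t : ℝ}
    (ht : t ∈ Icc 0 T) : IntegrableOn (f t) Ω := by
  have : IsFiniteMeasure (volume.restrict Ω) := ⟨by simpa using hΩ.lt_top⟩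
  exact (hf.1 t ht).integrable (by rw [← ENNReal.ofReal_one]; exact ENNReal.ofReal_le_ofReal hp)

theorem IsWeaklyContinuous.integrable {p : ℝ} (hp : 1 ≤ p)
    (hΩ : volume Ω ≠ ⊤) {f : ℝ → E d → ℝ} (hf : IsWeaklyContinuous T Ω p f)
    (hm : AEStronglyMeasurable (fun q : ℝ × E d => f q.1 q.2)
      ((volume.restrict (Ioo 0 T)).prod (volume.restrict Ω))) :
    Integrable (fun q : ℝ × E d => f q.1 q.2)
      ((volume.restrict (Ioo 0 T)).prod (volume.restrict Ω)) := by
  have hfin : IsFiniteMeasure (volume.restrict Ω) := ⟨by simpa using hΩ.lt_top⟩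
  have hp1 : (1 : ℝ≥0∞) ≤ ENNReal.ofReal p := by
    rw [← ENNReal.ofReal_one]; exact ENNReal.ofReal_le_ofReal hp
  refine (integrable_prod_iff hm).2 ⟨?_, ?_⟩
  · filter_upwards [ae_restrict_mem measurableSet_Ioo] with t ht
    exact hf.integrable_slice hp hΩ (Ioo_subset_Icc_self ht)
  · obtain ⟨C, hC⟩ := hf.2.1
    -- The Hölder factor `|Ω|^(1 - 1/p)`, which bounds the `L¹` norm of a slice by its `L^p` norm.
    set V := (volume.restrict Ω) univ ^ (1 / (1 : ℝ≥0∞).toReal - 1 / (ENNReal.ofReal p).toReal)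
      with hV
    have hVt : V ≠ ⊤ := by
      refine ENNReal.rpow_ne_top_of_nonneg ?_ (measure_ne_top _ _)
      rw [ENNReal.toReal_ofReal (by linarith), ENNReal.toReal_one, sub_nonneg]
      exact one_div_le_one_div_of_le one_pos hp
    refine Integrable.of_bound (C := (C * V).toReal) hm.norm.integral_prod_right' ?_
    filter_upwards [hC, ae_restrict_mem measurableSet_Ioo] with t ht hT
    have hslice := hf.1 t (Ioo_subset_Icc_self hT)
    have h1 := eLpNorm_le_eLpNorm_mul_rpow_measure_univ hp1 hslice.1
    rw [Real.norm_of_nonneg (integral_nonneg fun _ => norm_nonneg _)]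
    rw [integral_norm_eq_lintegral_enorm hslice.1, ← eLpNorm_one_eq_lintegral_enorm]
    refine ENNReal.toReal_mono (ENNReal.mul_ne_top ENNReal.coe_ne_top hVt) (h1.trans ?_)
    gcongr

end LpSlices

/-! ### Integrals over the lateral boundary -/

section Lateral

variable {d : ℕ} {D : Data d}

theorem Data.measurable_flux (huB : Continuous D.uB) : Measurable D.flux :=
  huB.measurable.inner (measurable_outerNormal D.Ω)

theorem Data.exists_bound_flux (huB : Continuous D.uB) (hs : HasCompactSupport D.uB) :
    ∃ C, ∀ x, |D.flux x| ≤ C := by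
  obtain ⟨C, hC⟩ := hs.exists_bound_of_continuous huB
  refine ⟨C, fun x => (abs_real_inner_le_norm _ _).trans ?_⟩
  calc ‖D.uB x‖ * ‖outerNormal D.Ω x‖ ≤ C * 1 :=
        mul_le_mul (hC x) (norm_outerNormal_le x) (norm_nonneg _)
          ((norm_nonneg _).trans (hC x))
    _ = C := mul_one C

theorem Data.measurableSet_inflow (huB : Continuous D.uB) : MeasurableSet D.inflow :=
  isClosed_frontier.measurableSet.inter
    (measurableSet_lt (Data.measurable_flux huB) measurable_const)

theorem Data.measurableSet_outflow (huB : Continuous D.uB) : MeasurableSet D.outflow :=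
  isClosed_frontier.measurableSet.diff (Data.measurableSet_inflow huB)

theorem surfaceMeasure_restrict_frontier (Ω : Set (E d)) :
    (surfaceMeasure Ω).restrict (frontier Ω) = surfaceMeasure Ω := by
  rw [surfaceMeasure, Measure.restrict_restrict isClosed_frontier.measurableSet, inter_self]

theorem Data.integral_outflow_add_inflow (huB : Continuous D.uB) {f : E d → ℝ}
    (hf : Integrable f (surfaceMeasure D.Ω)) :
    (∫ x in D.outflow, f x ∂(surfaceMeasure D.Ω)) + ∫ x in D.inflow, f x ∂(surfaceMeasure D.Ω)
      = ∫ x, f x ∂(surfaceMeasure D.Ω) := by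
  conv_rhs => rw [← surfaceMeasure_restrict_frontier]
  have hsub : D.inflow ⊆ frontier D.Ω := fun x hx => hx.1
  have h1 := setIntegral_union (μ := surfaceMeasure D.Ω) (f := f)
    (disjoint_sdiff_left (s := D.inflow) (t := frontier D.Ω)) (Data.measurableSet_inflow huB)
    hf.integrableOn hf.integrableOn
  rw [sdiff_union_self, union_eq_left.2 hsub] at h1
  exact h1.symm

/-- Integrability for the measure `|u_B · n| dS` is integrability of `|u_B · n| f`; multiplying by
the bounded sign of the flux restores the signed density. -/
theorem Data.integrable_mul_flux (huB : Continuous D.uB)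
    (hs : IsFiniteMeasure (surfaceMeasure D.Ω)) {f : ℝ × E d → ℝ}
    (hf : Integrable f D.latMeasure) :
    Integrable (fun p => f p * D.flux p.2)
      ((volume.restrict (Ioo 0 D.T)).prod (surfaceMeasure D.Ω)) := by
  have hfl := Data.measurable_flux huB
  have hdm : Measurable fun x => ENNReal.ofReal |D.flux x| := by fun_prop
  rw [Data.latMeasure, Data.fluxMeasure, Data.timeMeasure, prod_withDensity_right hdm,
    integrable_withDensity_iff_integrable_smul' (by fun_prop)
      (ae_of_all _ fun _ => ENNReal.ofReal_lt_top)] at hf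
  have h1 : Integrable (fun p : ℝ × E d => (SignType.sign (D.flux p.2) : ℝ) *
      ((ENNReal.ofReal |D.flux p.2|).toReal • f p))
      ((volume.restrict (Ioo 0 D.T)).prod (surfaceMeasure D.Ω)) := by
    refine hf.bdd_mul (c := 1) ?_ (ae_of_all _ fun p => ?_)
    · have hsg : Measurable fun r : ℝ => ((SignType.sign r : SignType) : ℝ) := by
        have : (fun r : ℝ => ((SignType.sign r : SignType) : ℝ))
            = fun r => if 0 < r then (1 : ℝ) else if r < 0 then -1 else 0 := by
          ext r
          rw [sign_apply]
          split_ifs <;> simp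
        rw [this]
        exact Measurable.ite measurableSet_Ioi measurable_const
          (Measurable.ite measurableSet_Iio measurable_const measurable_const)
      exact (hsg.comp (hfl.comp measurable_snd)).aestronglyMeasurable
    · rcases lt_trichotomy (D.flux p.2) 0 with h | h | h <;> simp [h]
  refine h1.congr (ae_of_all _ fun p => ?_)
  simp only [ENNReal.toReal_ofReal (abs_nonneg _), smul_eq_mul]
  rw [← mul_assoc, sign_mul_abs, mul_comm]

theorem Data.isFiniteMeasure_latMeasure (huB : Continuous D.uB) (hc : HasCompactSupport D.uB)
    (hs : IsFiniteMeasure (surfaceMeasure D.Ω)) : IsFiniteMeasure D.latMeasure := by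
  obtain ⟨C, hC⟩ := Data.exists_bound_flux huB hc
  have : IsFiniteMeasure D.fluxMeasure := by
    refine isFiniteMeasure_withDensity (ne_of_lt ?_)
    calc ∫⁻ x, ENNReal.ofReal |D.flux x| ∂(surfaceMeasure D.Ω)
        ≤ ∫⁻ _, ENNReal.ofReal C ∂(surfaceMeasure D.Ω) :=
          lintegral_mono fun x => ENNReal.ofReal_le_ofReal (hC x)
      _ < ⊤ := by
          rw [lintegral_const]
          exact ENNReal.mul_lt_top ENNReal.ofReal_lt_top (measure_lt_top _ _)
  rw [Data.latMeasure, Data.timeMeasure]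
  infer_instance

theorem prod_surfaceMeasure_eq_restrict {Ω : Set (E d)} (hs : IsFiniteMeasure (surfaceMeasure Ω))
    (T : ℝ) : (volume.restrict (Ioo 0 T)).prod (surfaceMeasure Ω)
      = (volume.prod (surfaceMeasure Ω)).restrict (Ioo 0 T ×ˢ frontier Ω) := by
  rw [← Measure.prod_restrict, surfaceMeasure_restrict_frontier]

theorem integrable_coef_mul_lateral {Ω : Set (E d)} (hs : IsFiniteMeasure (surfaceMeasure Ω))
    (hΩc : IsCompact (closure Ω)) {T : ℝ} {c f : ℝ × E d → ℝ}
    (hc : ContinuousOn c (Icc 0 T ×ˢ closure Ω))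
    (hf : Integrable f ((volume.restrict (Ioo 0 T)).prod (surfaceMeasure Ω))) :
    Integrable (fun p => c p * f p) ((volume.restrict (Ioo 0 T)).prod (surfaceMeasure Ω)) := by
  have hm : MeasurableSet (Ioo 0 T ×ˢ frontier Ω) :=
    measurableSet_Ioo.prod isClosed_frontier.measurableSet
  have hsub : Ioo 0 T ×ˢ frontier Ω ⊆ Icc 0 T ×ˢ closure Ω :=
    prod_mono Ioo_subset_Icc_self frontier_subset_closure
  obtain ⟨C, hC⟩ := (isCompact_Icc.prod hΩc).exists_bound_of_continuousOn hc
  refine hf.bdd_mul (c := C) ?_ ?_ <;> rw [prod_surfaceMeasure_eq_restrict hs]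
  · exact (hc.mono hsub).aestronglyMeasurable_of_isSeparable hm
      (TopologicalSpace.IsSeparable.of_separableSpace _)
  · filter_upwards [ae_restrict_mem hm] with p hp using hC p (hsub hp)

theorem integrable_prod_restrict_right {X Y : Type*} [MeasurableSpace X] [MeasurableSpace Y]
    {α : Measure X} {β : Measure Y} [SFinite α] [SFinite β] {f : X × Y → ℝ}
    (hf : Integrable f (α.prod β)) (s : Set Y) : Integrable f (α.prod (β.restrict s)) := by
  have : α.prod (β.restrict s) = (α.prod β).restrict (univ ×ˢ s) := by
    rw [← Measure.prod_restrict, Measure.restrict_univ]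
  rw [this]
  exact hf.restrict

/-- The divergence theorem for the flux of a scalar carried by a field equal to `u_B` on the
boundary. -/
theorem integral_div_smul_eq_flux (hΩ : IsBoundedLipschitzDomain D.Ω) {p : E d → ℝ}
    {U : E d → E d} (hp : ContDiffOn ℝ 1 p (closure D.Ω))
    (hU : ContDiffOn ℝ 1 U (closure D.Ω)) (hb : ∀ x ∈ frontier D.Ω, U x = D.uB x) :
    ∫ x in D.Ω, div D.Ω (fun y => p y • U y) x = ∫ x, p x * D.flux x ∂(surfaceMeasure D.Ω) := by
  have hfin := hΩ.isFiniteMeasure_surfaceMeasure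
  have hc := hΩ.isCompact_closure
  have hf : ∀ j, ContDiffOn ℝ 1 (fun y => (p y • U y) j) (closure D.Ω) := fun j =>
    (EuclideanSpace.proj j : E d →L[ℝ] ℝ).contDiff.comp_contDiffOn (hp.smul hU)
  simp only [div, pd]
  rw [integral_finsetSum]
  · simp only [integral_fderivWithin_eq_surface hΩ (hf _)]
    rw [← integral_finsetSum]
    · rw [surfaceMeasure]
      refine setIntegral_congr_fun isClosed_frontier.measurableSet fun x hx => ?_
      simp only [hb x hx, Data.flux, PiLp.inner_apply,
        PiLp.smul_apply, smul_eq_mul, Finset.mul_sum]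
      refine Finset.sum_congr rfl fun j _ => ?_
      simp; ring
    · intro j _
      have h1 : IntegrableOn (fun y => (p y • U y) j) (frontier D.Ω) (surfaceMeasure D.Ω) :=
        ((hf j).continuousOn.mono frontier_subset_closure).integrableOn_compact
          (hc.of_isClosed_subset isClosed_frontier frontier_subset_closure)
      rw [IntegrableOn, surfaceMeasure_restrict_frontier] at h1
      refine h1.mul_bdd (c := 1)
        ((measurable_outerNormal D.Ω).inner measurable_const).aestronglyMeasurable
        (ae_of_all _ fun x => ?_)
      refine (norm_inner_le_norm _ _).trans ?_
      simpa using norm_outerNormal_le x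
  · intro j _
    have := ((hf j).continuousOn_fderivWithin hΩ.uniqueDiffOn le_rfl).clm_apply
      (continuousOn_const (c := EuclideanSpace.single j (1 : ℝ)))
    exact (this.integrableOn_compact hc).mono_set subset_closure

end Lateral

/-! ### Integrability of the fields of a solution -/

section Fields

variable {d : ℕ} {D : Data d} {γ : ℝ} {R Z : ℝ → E d → ℝ} {u : ℝ → E d → E d}
  {Du : ℝ → E d → Mat d} {m : ℝ → E d → E d}
  {Rey : ℝ → Fin d → Fin d → SignedMeasure (E d)} {En : ℝ → Measure (E d)}

theorem IsBoundedLipschitzDomain.volume_ne_top {Ω : Set (E d)} (hΩ : IsBoundedLipschitzDomain Ω) :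
    volume Ω ≠ ⊤ := hΩ.isBounded.measure_lt_top.ne

theorem IsBoundedLipschitzDomain.isFiniteMeasure_cylMeasure
    (hΩ : IsBoundedLipschitzDomain D.Ω) : IsFiniteMeasure D.cylMeasure := by
  have : IsFiniteMeasure (volume.restrict D.Ω) := ⟨by simpa using hΩ.volume_ne_top.lt_top⟩
  rw [Data.cylMeasure, Data.timeMeasure]
  infer_instance

namespace IsDissipativeTurbulentSolution

theorem integrable_R
    (hsol : IsDissipativeTurbulentSolution D γ R Z u Du m Rey En)
    (hΩ : IsBoundedLipschitzDomain D.Ω) : Integrable (fun p : ℝ × E d => R p.1 p.2) D.cylMeasure :=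
  hsol.R_weak.integrable hsol.one_lt_gamma.le hΩ.volume_ne_top hsol.R_meas

theorem integrable_Z
    (hsol : IsDissipativeTurbulentSolution D γ R Z u Du m Rey En)
    (hΩ : IsBoundedLipschitzDomain D.Ω) : Integrable (fun p : ℝ × E d => Z p.1 p.2) D.cylMeasure :=
  hsol.Z_weak.integrable hsol.one_lt_gamma.le hΩ.volume_ne_top hsol.Z_meas

theorem memLp_u
    (hsol : IsDissipativeTurbulentSolution D γ R Z u Du m Rey En) (i : Fin d) : MemLp (fun p : ℝ × E d => u p.1 p.2 i) 2 D.cylMeasure :=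
  hsol.u_memLp.of_le
    ((EuclideanSpace.proj i : E d →L[ℝ] ℝ).continuous.comp_aestronglyMeasurable hsol.u_memLp.1)
    (ae_of_all _ fun p => PiLp.norm_apply_le (u p.1 p.2) i)

theorem integrable_u
    (hsol : IsDissipativeTurbulentSolution D γ R Z u Du m Rey En)
    (hΩ : IsBoundedLipschitzDomain D.Ω) (i : Fin d) : Integrable (fun p : ℝ × E d => u p.1 p.2 i) D.cylMeasure :=
  have := hΩ.isFiniteMeasure_cylMeasure
  (hsol.memLp_u i).integrable one_le_two

theorem integrable_Ru
    (hsol : IsDissipativeTurbulentSolution D γ R Z u Du m Rey En)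
    (hΩ : IsBoundedLipschitzDomain D.Ω) (i : Fin d) :
    Integrable (fun p : ℝ × E d => R p.1 p.2 * u p.1 p.2 i) D.cylMeasure := by
  refine ((((hsol.integrable_R hΩ).add (hsol.integrable_Z hΩ)).add
    (hsol.convective_int i i))).mono'
    (hsol.R_meas.mul (hsol.memLp_u i).1) ?_
  filter_upwards [hsol.nonneg] with p hp
  rw [Real.norm_eq_abs, abs_le]
  simp only [Pi.add_apply]
  -- From `2|uᵢ| ≤ 1 + uᵢ²` and the signs of the densities, `R|uᵢ|` is at most `(R + Z) + (R +
  -- Z)uᵢ²`.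
  constructor <;> nlinarith [mul_nonneg hp.1 (sq_nonneg (u p.1 p.2 i - 1)), hp.1, hp.2,
    mul_nonneg hp.1 (sq_nonneg (u p.1 p.2 i + 1)), mul_nonneg hp.2 (sq_nonneg (u p.1 p.2 i)),
    mul_nonneg hp.1 (sq_nonneg (u p.1 p.2 i))]

theorem integrable_Zu
    (hsol : IsDissipativeTurbulentSolution D γ R Z u Du m Rey En)
    (hΩ : IsBoundedLipschitzDomain D.Ω) (i : Fin d) :
    Integrable (fun p : ℝ × E d => Z p.1 p.2 * u p.1 p.2 i) D.cylMeasure := by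
  refine ((((hsol.integrable_R hΩ).add (hsol.integrable_Z hΩ)).add
    (hsol.convective_int i i))).mono'
    (hsol.Z_meas.mul (hsol.memLp_u i).1) ?_
  filter_upwards [hsol.nonneg] with p hp
  rw [Real.norm_eq_abs, abs_le]
  simp only [Pi.add_apply]
  constructor <;> nlinarith [mul_nonneg hp.2 (sq_nonneg (u p.1 p.2 i - 1)), hp.1, hp.2,
    mul_nonneg hp.2 (sq_nonneg (u p.1 p.2 i + 1)), mul_nonneg hp.1 (sq_nonneg (u p.1 p.2 i)),
    mul_nonneg hp.2 (sq_nonneg (u p.1 p.2 i))]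

theorem integrable_rhou
    (hsol : IsDissipativeTurbulentSolution D γ R Z u Du m Rey En)
    (hΩ : IsBoundedLipschitzDomain D.Ω) (i : Fin d) :
    Integrable (fun p : ℝ × E d => (R p.1 p.2 + Z p.1 p.2) * u p.1 p.2 i) D.cylMeasure := by
  simp only [add_mul]
  exact (hsol.integrable_Ru hΩ i).add (hsol.integrable_Zu hΩ i)

theorem integrable_R_lateral
    (hsol : IsDissipativeTurbulentSolution D γ R Z u Du m Rey En)
    (hΩ : IsBoundedLipschitzDomain D.Ω) (hD : D.Admissible) :
    Integrable (fun p : ℝ × E d => R p.1 p.2) D.latMeasure :=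
  have := Data.isFiniteMeasure_latMeasure hD.uB_smooth.continuous hD.uB_supp
    hΩ.isFiniteMeasure_surfaceMeasure
  hsol.R_bdry.integrable (by
    rw [← ENNReal.ofReal_one]; exact ENNReal.ofReal_le_ofReal hsol.one_lt_gamma.le)

theorem integrable_Z_lateral
    (hsol : IsDissipativeTurbulentSolution D γ R Z u Du m Rey En)
    (hΩ : IsBoundedLipschitzDomain D.Ω) (hD : D.Admissible) :
    Integrable (fun p : ℝ × E d => Z p.1 p.2) D.latMeasure :=
  have := Data.isFiniteMeasure_latMeasure hD.uB_smooth.continuous hD.uB_supp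
    hΩ.isFiniteMeasure_surfaceMeasure
  hsol.Z_bdry.integrable (by
    rw [← ENNReal.ofReal_one]; exact ENNReal.ofReal_le_ofReal hsol.one_lt_gamma.le)

theorem integrable_m_slice
    (hsol : IsDissipativeTurbulentSolution D γ R Z u Du m Rey En)
    (hΩ : IsBoundedLipschitzDomain D.Ω) {t : ℝ} (ht : t ∈ Icc 0 D.T) : IntegrableOn (m t) D.Ω := by
  refine hsol.m_weak.integrable_slice ?_ hΩ.volume_ne_top ht
  have := hsol.one_lt_gamma
  rw [le_div_iff₀ (by linarith)]; linarith

theorem integrable_energyDensity_slice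
    (hsol : IsDissipativeTurbulentSolution D γ R Z u Du m Rey En) : ∀ᵐ t ∂(volume.restrict (Ioo 0 D.T)),
    IntegrableOn (fun x => D.energyDensity (R t x) (Z t x) (u t x)) D.Ω := by
  have hint : Integrable (fun p : ℝ × E d => D.energyDensity (R p.1 p.2) (Z p.1 p.2) (u p.1 p.2))
      D.cylMeasure := by
    have h1 := ((integrable_finsetSum Finset.univ fun i _ =>
      hsol.convective_int i i).const_mul (1 / 2)).add hsol.H_int
    refine h1.congr (ae_of_all _ fun p => ?_)
    simp only [Pi.add_apply, Data.energyDensity, EuclideanSpace.norm_sq_eq, Real.norm_eq_abs,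
      sq_abs, Finset.mul_sum]
    congr 1
    exact Finset.sum_congr rfl fun i _ => by ring
  rw [Data.cylMeasure, Data.timeMeasure] at hint
  exact hint.prod_right_ae

end IsDissipativeTurbulentSolution

/-- Decomposition of the relative energy of a time slice. -/
theorem integral_relEnergy_eq (hΩ : IsBoundedLipschitzDomain D.Ω)
    (hD : D.Admissible) {R Z r z h₁ h₂ p : E d → ℝ} {u m U : E d → E d}
    (hR : IntegrableOn R D.Ω) (hZ : IntegrableOn Z D.Ω) (hm : IntegrableOn m D.Ω)
    (hmu : ∀ᵐ x ∂(volume.restrict D.Ω), m x = (R x + Z x) • u x)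
    (hen : IntegrableOn (fun x => D.energyDensity (R x) (Z x) (u x)) D.Ω)
    (hU : ContinuousOn U (closure D.Ω)) (hh₁ : ContinuousOn h₁ (closure D.Ω))
    (hh₂ : ContinuousOn h₂ (closure D.Ω)) (hp : ContinuousOn p (closure D.Ω))
    (hb : ∀ x ∈ D.Ω, ∀ a c, bregman D.K D.H a c (r x) (z x)
      = D.H (a, c) - h₁ x * a - h₂ x * c + p x) :
    IntegrableOn (fun x => D.relEnergy (R x) (Z x) (u x) (r x) (z x) (U x)) D.Ω ∧
    (∫ x in D.Ω, D.relEnergy (R x) (Z x) (u x) (r x) (z x) (U x))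
      = (∫ x in D.Ω, D.energyDensity (R x) (Z x) (u x - D.uB x))
        + (∫ x in D.Ω, inner ℝ (m x) (D.uB x - U x))
        + (∫ x in D.Ω, R x * (1 / 2 * ‖U x‖ ^ 2 - 1 / 2 * ‖D.uB x‖ ^ 2 - h₁ x))
        + (∫ x in D.Ω, Z x * (1 / 2 * ‖U x‖ ^ 2 - 1 / 2 * ‖D.uB x‖ ^ 2 - h₂ x))
        + ∫ x in D.Ω, p x := by
  have hc := hΩ.isCompact_closure
  have huB : ContinuousOn D.uB (closure D.Ω) := hD.uB_smooth.continuous.continuousOn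
  have hmeas : ∀ {F : Type _} [NormedAddCommGroup F] {c : E d → F}, ContinuousOn c (closure D.Ω) →
      AEStronglyMeasurable c (volume.restrict D.Ω) := fun hc =>
    (hc.mono subset_closure).aestronglyMeasurable_of_isSeparable hΩ.isOpen.measurableSet
      (TopologicalSpace.IsSeparable.of_separableSpace _)
  have hbd : ∀ {F : Type _} [NormedAddCommGroup F] {c : E d → F}, ContinuousOn c (closure D.Ω) →
      ∃ C, ∀ᵐ x ∂(volume.restrict D.Ω), ‖c x‖ ≤ C := fun hcc => by
    obtain ⟨C, hC⟩ := hc.exists_bound_of_continuousOn hcc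
    exact ⟨C, (ae_restrict_iff' hΩ.isOpen.measurableSet).2
      (ae_of_all _ fun x hx => hC x (subset_closure hx))⟩
  have hmul : ∀ {f c : E d → ℝ}, IntegrableOn f D.Ω → ContinuousOn c (closure D.Ω) →
      IntegrableOn (fun x => f x * c x) D.Ω := fun hf hcc => by
    obtain ⟨C, hC⟩ := hbd hcc
    exact Integrable.mul_bdd hf (hmeas hcc) hC
  have hinn : ∀ {c : E d → E d}, ContinuousOn c (closure D.Ω) →
      IntegrableOn (fun x => inner ℝ (m x) (c x)) D.Ω := fun hcc => by
    obtain ⟨C, hC⟩ := hbd hcc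
    have hms := hmeas hcc
    refine Integrable.mono' (hm.norm.mul_const C) (hm.1.inner hms) ?_
    filter_upwards [hC] with x hx
    exact (norm_inner_le_norm _ _).trans (mul_le_mul_of_nonneg_left hx (norm_nonneg _))
  have hI2 : IntegrableOn (fun x => inner ℝ (m x) (D.uB x - U x)) D.Ω := hinn (huB.sub hU)
  have hI3 : IntegrableOn (fun x => R x *
      (1 / 2 * ‖U x‖ ^ 2 - 1 / 2 * ‖D.uB x‖ ^ 2 - h₁ x)) D.Ω := hmul hR (((hU.norm.pow 2).const_mul (1 / 2)).sub ((huB.norm.pow 2).const_mul (1 / 2))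
    |>.sub hh₁)
  have hI4 : IntegrableOn (fun x => Z x *
      (1 / 2 * ‖U x‖ ^ 2 - 1 / 2 * ‖D.uB x‖ ^ 2 - h₂ x)) D.Ω := hmul hZ (((hU.norm.pow 2).const_mul (1 / 2)).sub ((huB.norm.pow 2).const_mul (1 / 2))
    |>.sub hh₂)
  have hI5 : IntegrableOn p D.Ω := (hp.integrableOn_compact hc).mono_set subset_closure
  -- Finite energy is known for `u`, not for `u - u_B`. The difference consists of `m · u_B` and
  -- `½(R+Z)|u_B|²`, both integrable because `u_B` is bounded on `Ω`.
  have hI1 : IntegrableOn (fun x => D.energyDensity (R x) (Z x) (u x - D.uB x)) D.Ω := by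
    have h1 := (Integrable.sub hen (hinn huB)).add
      (hmul (hR.add hZ) (c := fun x => 1 / 2 * ‖D.uB x‖ ^ 2) ((huB.norm.pow 2).const_mul (1 / 2)))
    refine h1.congr ?_
    filter_upwards [hmu] with x hx
    simp only [Pi.add_apply, Pi.sub_apply, Data.energyDensity, hx, norm_sub_sq_real,
      real_inner_smul_left]
    ring
  have hsum := (((Integrable.add hI1 hI2).add hI3).add hI4).add hI5
  -- Expansion of `|u - U|²` around `u_B`, with `(R + Z) u` replaced by `m`, and the affine form of
  -- the Bregman term.
  have heq : (fun x => D.relEnergy (R x) (Z x) (u x) (r x) (z x) (U x))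
      =ᵐ[volume.restrict D.Ω] fun x => D.energyDensity (R x) (Z x) (u x - D.uB x)
        + inner ℝ (m x) (D.uB x - U x) + R x * (1 / 2 * ‖U x‖ ^ 2 - 1 / 2 * ‖D.uB x‖ ^ 2 - h₁ x)
        + Z x * (1 / 2 * ‖U x‖ ^ 2 - 1 / 2 * ‖D.uB x‖ ^ 2 - h₂ x) + p x := by
    filter_upwards [hmu, ae_restrict_mem hΩ.isOpen.measurableSet] with x hx hxΩ
    simp only [Data.relEnergy, hb x hxΩ, Data.energyDensity, hx, norm_sub_sq_real,
      real_inner_smul_left, inner_sub_right]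
    ring
  refine ⟨hsum.congr heq.symm, ?_⟩
  rw [integral_congr_ae heq, integral_add _ hI5, integral_add _ hI4, integral_add _ hI3,
    integral_add hI1 hI2]
  · exact Integrable.add hI1 hI2
  · exact (Integrable.add hI1 hI2).add hI3
  · exact ((Integrable.add hI1 hI2).add hI3).add hI4

/-- Fundamental theorem of calculus for a `C¹` field on the cylinder. -/
theorem integral_sub_eq_integral_dt {Ω : Set (E d)} (hΩ : IsBoundedLipschitzDomain Ω) {T : ℝ}
    (hT : 0 < T) {p : ℝ → E d → ℝ} (hp : IsC1 T Ω p) {τ : ℝ} (hτ : τ ∈ Icc 0 T) :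
    (∫ x in Ω, p τ x) - ∫ x in Ω, p 0 x = ∫ t in (0 : ℝ)..τ, ∫ x in Ω, dt T p t x := by
  have hc := hΩ.isCompact_closure
  have hfinΩ : IsFiniteMeasure (volume.restrict Ω) := ⟨by simpa using hΩ.volume_ne_top.lt_top⟩
  have hdtc := hp.continuousOn_dt hT hΩ.uniqueDiffOn
  have hint : Integrable (fun q : ℝ × E d => dt T p q.1 q.2)
      ((volume.restrict (Ioo 0 T)).prod (volume.restrict Ω)) := by
    have := integrable_coef_mul hc hΩ.isOpen hdtc (integrable_const (1 : ℝ))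
    simpa using this
  have hsl : ∀ t ∈ Icc 0 T, IntegrableOn (p t) Ω := fun t ht =>
    ((hp.slice ht).continuousOn.integrableOn_compact hc).mono_set subset_closure
  rw [intervalIntegral_integral_eq hτ hint,
    integral_prod_symm _ (integrable_prod_restrict_mono hint hτ.2),
    ← integral_sub (hsl τ hτ) (hsl 0 ⟨le_rfl, hT.le⟩)]
  refine setIntegral_congr_fun hΩ.isOpen.measurableSet fun x hx => ?_
  have hx' := subset_closure hx
  have hd : ∀ t ∈ Icc 0 T, HasDerivWithinAt (fun s => p s x) (dt T p t x) (Icc 0 T) t := by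
    intro t ht
    have h1 : HasDerivWithinAt (fun s : ℝ => (s, x)) ((1 : ℝ), (0 : E d)) (Icc 0 T) t :=
      ((hasDerivAt_id t).prodMk (hasDerivAt_const t x)).hasDerivWithinAt
    have h2 := HasFDerivWithinAt.comp_hasDerivWithinAt (t := Icc 0 T ×ˢ closure Ω) t
      (hp.hasFDerivWithinAt ht hx') h1 fun s hs => ⟨hs, hx'⟩
    exact h2.differentiableWithinAt.hasDerivWithinAt
  have hsub : Icc 0 τ ⊆ Icc 0 T := Icc_subset_Icc_right hτ.2
  have hcx : ContinuousOn (fun t => dt T p t x) (Icc 0 T) :=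
    hdtc.comp (f := fun t : ℝ => (t, x)) (by fun_prop) fun t ht => ⟨ht, hx'⟩
  have := intervalIntegral.integral_eq_sub_of_hasDerivAt_of_le hτ.1
    (f := fun s => p s x) (f' := fun t => dt T p t x)
    (fun t ht => ((hd t (hsub ht)).continuousWithinAt).mono hsub)
    (fun t ht => (hd t (hsub (Ioo_subset_Icc_self ht))).hasDerivAt
      (Icc_mem_nhds ht.1 (ht.2.trans_le hτ.2)))
    (by
      refine ContinuousOn.intervalIntegrable ?_
      rw [uIcc_of_le hτ.1]
      exact hcx.mono hsub)
  rw [intervalIntegral.integral_of_le hτ.1, integral_Ioc_eq_integral_Ioo] at this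
  exact this.symm

end Fields

/-! ### Derivatives of the fields built from a test triple -/

section CompoundFields

variable {d : ℕ} {T : ℝ} {Ω : Set (E d)} {φ ψ : ℝ → E d → ℝ} {U V : ℝ → E d → E d} {t : ℝ}
  {x : E d}

theorem IsC1.sub {F : Type*} [NormedAddCommGroup F] [NormedSpace ℝ F] {φ ψ : ℝ → E d → F}
    (h : IsC1 T Ω φ) (h' : IsC1 T Ω ψ) : IsC1 T Ω fun t x => φ t x - ψ t x :=
  ContDiffOn.sub h h'

theorem IsC1.add {F : Type*} [NormedAddCommGroup F] [NormedSpace ℝ F] {φ ψ : ℝ → E d → F}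
    (h : IsC1 T Ω φ) (h' : IsC1 T Ω ψ) : IsC1 T Ω fun t x => φ t x + ψ t x :=
  ContDiffOn.add h h'

theorem IsC1.smul (h : IsC1 T Ω φ) (h' : IsC1 T Ω U) : IsC1 T Ω fun t x => φ t x • U t x :=
  ContDiffOn.smul h h'

theorem IsC1.half_norm_sq (h : IsC1 T Ω U) : IsC1 T Ω fun t x => 1 / 2 * ‖U t x‖ ^ 2 :=
  contDiffOn_const.mul (ContDiffOn.norm_sq ℝ h)

theorem IsC1.comp₂ {S : Set (ℝ × ℝ)} {G : ℝ × ℝ → ℝ} (hG : ContDiffOn ℝ 1 G S)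
    (h : IsC1 T Ω φ) (h' : IsC1 T Ω ψ)
    (hS : ∀ s ∈ Icc 0 T, ∀ y ∈ closure Ω, (φ s y, ψ s y) ∈ S) :
    IsC1 T Ω fun t x => G (φ t x, ψ t x) :=
  hG.comp (ContDiffOn.prodMk h h') fun p hp => hS p.1 hp.1 p.2 hp.2

theorem div_smul_eq (hT : 0 < T) (hu : UniqueDiffOn ℝ (closure Ω)) (hφ : IsC1 T Ω φ)
    (hU : IsC1 T Ω U) (ht : t ∈ Icc 0 T) (hx : x ∈ closure Ω) :
    div Ω (fun y => φ t y • U t y) x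
      = ∑ j, (φ t x * jac Ω (U t) x j j + U t x j * pd Ω j (φ t) x) :=
  Finset.sum_congr rfl fun j _ =>
    ((hφ.hasCylDeriv ht hx).mul hT hu ht hx ((hU.component j).hasCylDeriv ht hx)).space j

theorem jac_sub_eq (hT : 0 < T) (hu : UniqueDiffOn ℝ (closure Ω)) (hU : IsC1 T Ω U)
    (hV : IsC1 T Ω V) (ht : t ∈ Icc 0 T) (hx : x ∈ closure Ω) :
    jac Ω (fun y => U t y - V t y) x = jac Ω (U t) x - jac Ω (V t) x := by
  ext i j
  exact (((hU.component i).hasCylDeriv ht hx).sub hT hu ht hx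
    ((hV.component i).hasCylDeriv ht hx)).space j

theorem div_eq_trace_jac (v : E d → E d) (x : E d) : div Ω v x = ∑ j, jac Ω v x j j := rfl

theorem dt_sub_apply (hT : 0 < T) (hu : UniqueDiffOn ℝ (closure Ω)) (hU : IsC1 T Ω U)
    (hV : IsC1 T Ω V) (ht : t ∈ Icc 0 T) (hx : x ∈ closure Ω) (i : Fin d) :
    dt T (fun s y => U s y - V s y) t x i
      = dt T (fun s y => U s y i) t x - dt T (fun s y => V s y i) t x := by
  rw [dt_apply hT (hU.sub hV) ht hx]
  exact (((hU.component i).hasCylDeriv ht hx).sub hT hu ht hx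
    ((hV.component i).hasCylDeriv ht hx)).time

theorem dt_const {F : Type*} [NormedAddCommGroup F] [NormedSpace ℝ F] (f : E d → F) (t : ℝ)
    (x : E d) : dt T (fun _ y => f y) t x = 0 := by
  simp [dt]

variable {D : Data d} {r z : ℝ → E d → ℝ}

theorem massResidual_eq (hT : 0 < D.T) (hu : UniqueDiffOn ℝ (closure D.Ω)) (hr : IsC1 D.T D.Ω r)
    {U : ℝ → E d → E d} (hU : IsC1 D.T D.Ω U) (ht : t ∈ Icc 0 D.T) (hx : x ∈ closure D.Ω) :
    massResidual D r U t x = dt D.T r t x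
      + ∑ j, (r t x * jac D.Ω (U t) x j j + U t x j * pd D.Ω j (r t) x) := by
  rw [massResidual, div_smul_eq hT hu hr hU ht hx]

theorem momentumResidual_apply (hT : 0 < D.T) (hu : UniqueDiffOn ℝ (closure D.Ω))
    (hr : IsC1 D.T D.Ω r) (hz : IsC1 D.T D.Ω z) {U : ℝ → E d → E d} (hU : IsC1 D.T D.Ω U)
    (ht : t ∈ Icc 0 D.T) (hx : x ∈ closure D.Ω) (i : Fin d) :
    momentumResidual D r z U t x i
      = ((r t x + z t x) * dt D.T (fun s y => U s y i) t x
          + U t x i * (dt D.T r t x + dt D.T z t x))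
        + ∑ j, ((r t x + z t x)
            * (U t x i * jac D.Ω (U t) x j j + U t x j * jac D.Ω (U t) x i j)
          + U t x i * U t x j * (pd D.Ω j (r t) x + pd D.Ω j (z t) x)) := by
  have hs := (hr.hasCylDeriv ht hx).add hT hu ht hx (hz.hasCylDeriv ht hx)
  have hUi := fun i => (hU.component i).hasCylDeriv ht hx
  have h1 : dt D.T (fun s y => (r s y + z s y) • U s y) t x i
      = (r t x + z t x) * dt D.T (fun s y => U s y i) t x
          + U t x i * (dt D.T r t x + dt D.T z t x) := by
    rw [dt_apply hT ((hr.add hz).smul hU) ht hx]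
    exact (hs.mul hT hu ht hx (hUi i)).time
  have h2 : ∀ j, pd D.Ω j (fun y => ((r t y + z t y) • outer (U t y) (U t y)) i j) x
      = (r t x + z t x) * (U t x i * jac D.Ω (U t) x j j + U t x j * jac D.Ω (U t) x i j)
        + U t x i * U t x j * (pd D.Ω j (r t) x + pd D.Ω j (z t) x) := fun j =>
    (hs.mul hT hu ht hx ((hUi i).mul hT hu ht hx (hUi j))).space j
  simp only [momentumResidual, divTensor, PiLp.add_apply, h1, h2]

theorem hasCylDeriv_half_norm_sq_sub (hT : 0 < T) (hu : UniqueDiffOn ℝ (closure Ω))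
    (hU : IsC1 T Ω U) {w : E d → E d} (hw : ContDiff ℝ 1 w) {a : ℝ} {b : Fin d → ℝ}
    (hφ : HasCylDeriv T Ω φ t x a b) (ht : t ∈ Icc 0 T) (hx : x ∈ closure Ω) :
    HasCylDeriv T Ω (fun s y => 1 / 2 * ‖U s y‖ ^ 2 - 1 / 2 * ‖w y‖ ^ 2 - φ s y) t x
      ((∑ i, U t x i * dt T (fun s y => U s y i) t x) - a)
      fun j => (∑ i, U t x i * jac Ω (U t) x i j) - (∑ i, w x i * jac Ω w x i j) - b j := by
  have h1 := (HasCylDeriv.norm_sq hT hu ht hx hU).const_mul hT hu ht hx (1 / 2)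
  have h2 := (HasCylDeriv.norm_sq hT hu ht hx (isC1_const hw)).const_mul hT hu ht hx (1 / 2)
  refine ((h1.sub hT hu ht hx h2).sub hT hu ht hx hφ).congr_deriv ?_ fun j => ?_
  · have h0 : ∀ i, dt T (fun (_ : ℝ) (y : E d) => w y i) t x = 0 := fun i => dt_const _ t x
    simp only [h0]; simp
  · simp only [jac, Matrix.of_apply]; ring

end CompoundFields

/-! ### The pointwise identity behind the relative energy inequality -/

/-- Here `A` and `B` stand for the gradients of `U` and `u_B`, `V` for `u_B`, and the `hᵢⱼ` for the
second derivatives of `H`. All terms with `B` cancel. After substitution of the pressure derivatives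
the only division is by `r + z`, and the two sides differ by a multiple of `q (r + z) = R + Z`. The
multiplier is minus the product of `U - u` with the acceleration `∂ₜU + (U · ∇)U`. The dimension
matters only for writing out the sums. -/
theorem relative_energy_identity {d : ℕ} (hd : d = 2 ∨ d = 3)
    {R Z Pv r z rt zt h₁₁ h₁₂ h₂₂ PR PZ pv : ℝ} {u U V Ut rx zx : Fin d → ℝ}
    {A B : Fin d → Fin d → ℝ} (h0 : r + z ≠ 0) (hPR : PR = r * h₁₁ + z * h₁₂)
    (hPZ : PZ = r * h₁₂ + z * h₂₂) :
    -((R + Z) * (∑ i, ∑ j, u i * u j * B i j) + Pv * ∑ j, B j j)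
      + (R + Z) * (∑ i, ∑ j, u j * B i j * V i)
      + ((R + Z) * (∑ i, u i * -Ut i) + (R + Z) * (∑ i, ∑ j, u i * u j * (B i j - A i j))
        + Pv * ∑ j, (B j j - A j j))
      + (R * ((∑ i, U i * Ut i) - (h₁₁ * rt + h₁₂ * zt))
        + R * ∑ j, u j * ((∑ i, U i * A i j) - (∑ i, V i * B i j) - (h₁₁ * rx j + h₁₂ * zx j)))
      + (Z * ((∑ i, U i * Ut i) - (h₁₂ * rt + h₂₂ * zt))
        + Z * ∑ j, u j * ((∑ i, U i * A i j) - (∑ i, V i * B i j) - (h₁₂ * rx j + h₂₂ * zx j)))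
      + (PR * rt + PZ * zt) + ∑ j, (pv * A j j + U j * (PR * rx j + PZ * zx j))
    = -((R + Z) * ∑ i, ∑ j, (U j - u j) * A i j * (U i - u i))
      - (Pv - PR * (R - r) - PZ * (Z - z) - pv) * (∑ j, A j j)
      + ((R + Z) / (r + z) - 1) * (∑ i, (U i - u i) * (((r + z) * Ut i + U i * (rt + zt))
          + ∑ j, ((r + z) * (U i * A j j + U j * A i j) + U i * U j * (rx j + zx j))))
      + (∑ i, (U i - u i) * ((((r + z) * Ut i + U i * (rt + zt))
          + ∑ j, ((r + z) * (U i * A j j + U j * A i j) + U i * U j * (rx j + zx j)))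
          + (PR * rx i + PZ * zx i)))
      + (R - r) * (∑ i, (U i - u i) * (h₁₁ * rx i + h₁₂ * zx i))
      + (Z - z) * (∑ i, (U i - u i) * (h₂₂ * zx i + h₁₂ * rx i))
      + ((R + Z) / (r + z) * (∑ i, (u i - U i) * U i) + PR - R * h₁₁ - Z * h₁₂)
        * (rt + ∑ j, (r * A j j + U j * rx j))
      + ((R + Z) / (r + z) * (∑ i, (u i - U i) * U i) + PZ - Z * h₂₂ - R * h₁₂)
        * (zt + ∑ j, (z * A j j + U j * zx j)) := by
  have hq : (R + Z) / (r + z) * (r + z) = R + Z := div_mul_cancel₀ _ h0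
  set q := (R + Z) / (r + z)
  subst hPR hPZ
  rcases hd with rfl | rfl
  · simp only [Fin.sum_univ_two]
    linear_combination (-((U 0 - u 0) * (Ut 0 + U 0 * A 0 0 + U 1 * A 0 1)
      + (U 1 - u 1) * (Ut 1 + U 0 * A 1 0 + U 1 * A 1 1))) * hq
  · simp only [Fin.sum_univ_three]
    linear_combination (-((U 0 - u 0) * (Ut 0 + U 0 * A 0 0 + U 1 * A 0 1 + U 2 * A 0 2)
      + (U 1 - u 1) * (Ut 1 + U 0 * A 1 0 + U 1 * A 1 1 + U 2 * A 1 2)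
      + (U 2 - u 2) * (Ut 2 + U 0 * A 2 0 + U 1 * A 2 1 + U 2 * A 2 2))) * hq

/-! ### Integrability of the terms of the relative energy inequality -/

section Terms

variable {d : ℕ} {D : Data d} {γ : ℝ} {R Z : ℝ → E d → ℝ} {u : ℝ → E d → E d}
  {Du : ℝ → E d → Mat d} {m : ℝ → E d → E d}
  {Rey : ℝ → Fin d → Fin d → SignedMeasure (E d)} {En : ℝ → Measure (E d)}

theorem Data.integrable_coef_mul (hΩ : IsBoundedLipschitzDomain D.Ω) {c f : ℝ × E d → ℝ}
    (hc : ContinuousOn c (Icc 0 D.T ×ˢ closure D.Ω)) (hf : Integrable f D.cylMeasure) :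
    Integrable (fun p => c p * f p) D.cylMeasure :=
  Bifluid.integrable_coef_mul hΩ.isCompact_closure hΩ.isOpen hc hf

theorem Data.integrable_coef (hΩ : IsBoundedLipschitzDomain D.Ω) {c : ℝ × E d → ℝ}
    (hc : ContinuousOn c (Icc 0 D.T ×ˢ closure D.Ω)) : Integrable c D.cylMeasure := by
  have := hΩ.isFiniteMeasure_cylMeasure
  simpa using Data.integrable_coef_mul hΩ hc (integrable_const (1 : ℝ))

theorem continuousOn_apply {X : Type*} [TopologicalSpace X] {s : Set X} {U : X → E d}
    (hU : ContinuousOn U s) (i : Fin d) : ContinuousOn (fun p => U p i) s :=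
  (EuclideanSpace.proj i : E d →L[ℝ] ℝ).continuous.comp_continuousOn hU

theorem continuousOn_of_apply {X : Type*} [TopologicalSpace X] {s : Set X} {U : X → E d}
    (hU : ∀ i, ContinuousOn (fun p => U p i) s) : ContinuousOn U s :=
  (PiLp.continuous_toLp 2 _).comp_continuousOn (continuousOn_pi.2 hU)

theorem Data.integrable_mul_inner (hΩ : IsBoundedLipschitzDomain D.Ω) {g : ℝ × E d → ℝ}
    {v w : ℝ × E d → E d} (hw : ContinuousOn w (Icc 0 D.T ×ˢ closure D.Ω))
    (hgv : ∀ i, Integrable (fun p => g p * v p i) D.cylMeasure) :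
    Integrable (fun p => g p * inner ℝ (v p) (w p)) D.cylMeasure := by
  have := integrable_finsetSum Finset.univ fun i _ =>
    Data.integrable_coef_mul hΩ (continuousOn_apply hw i) (hgv i)
  refine this.congr (ae_of_all _ fun p => ?_)
  simp only [PiLp.inner_apply, RCLike.inner_apply, conj_trivial, Finset.mul_sum]
  exact Finset.sum_congr rfl fun i _ => by ring

theorem Data.integrable_mul_sub (hΩ : IsBoundedLipschitzDomain D.Ω) {g : ℝ × E d → ℝ}
    {v U : ℝ × E d → E d} (hU : ContinuousOn U (Icc 0 D.T ×ˢ closure D.Ω))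
    (hg : Integrable g D.cylMeasure) (hgv : ∀ i, Integrable (fun p => g p * v p i) D.cylMeasure)
    (i : Fin d) : Integrable (fun p => g p * (U p - v p) i) D.cylMeasure :=
  ((Data.integrable_coef_mul hΩ (continuousOn_apply hU i) hg).sub (hgv i)).congr
    (ae_of_all _ fun p => by simp only [Pi.sub_apply, PiLp.sub_apply]; ring)

theorem integrable_convect (hΩ : IsBoundedLipschitzDomain D.Ω) {g : ℝ × E d → ℝ}
    {v w : ℝ × E d → E d} {A : ℝ × E d → Mat d}
    (hA : ∀ i j, ContinuousOn (fun p => A p i j) (Icc 0 D.T ×ˢ closure D.Ω))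
    (hg : ∀ i j, Integrable (fun p => g p * v p j * w p i) D.cylMeasure) :
    Integrable (fun p => g p * convect (v p) (A p) (w p)) D.cylMeasure := by
  have := integrable_finsetSum Finset.univ fun i _ => integrable_finsetSum Finset.univ fun j _ =>
    Data.integrable_coef_mul hΩ (hA i j) (hg i j)
  refine this.congr (ae_of_all _ fun p => ?_)
  simp only [convect, Finset.mul_sum]
  exact Finset.sum_congr rfl fun i _ => Finset.sum_congr rfl fun j _ => by ring

theorem frob_outer_eq_convect (v w : E d) (A : Mat d) : frob (outer v w) A = convect w A v := by
  simp only [frob, outer, convect, Matrix.of_apply]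
  exact Finset.sum_congr rfl fun i _ => Finset.sum_congr rfl fun j _ => by ring

theorem frob_add_left (A B C : Mat d) : frob (A + B) C = frob A C + frob B C := by
  simp only [frob, Matrix.add_apply, add_mul, Finset.sum_add_distrib]

theorem frob_smul_left (a : ℝ) (A B : Mat d) : frob (a • A) B = a * frob A B := by
  simp only [frob, Matrix.smul_apply, smul_eq_mul, Finset.mul_sum, mul_assoc]

theorem frob_sub_right (A B C : Mat d) : frob A (B - C) = frob A B - frob A C := by
  simp only [frob, Matrix.sub_apply, mul_sub, Finset.sum_sub_distrib]

theorem frob_one_left (A : Mat d) : frob 1 A = ∑ j, A j j := by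
  simp only [frob, Matrix.one_apply, ite_mul, one_mul, zero_mul, Finset.sum_ite_eq,
    Finset.mem_univ, if_true]

namespace IsDissipativeTurbulentSolution

theorem memLp_S (hsol : IsDissipativeTurbulentSolution D γ R Z u Du m Rey En) (i j : Fin d) :
    MemLp (fun p : ℝ × E d => D.S (Du p.1 p.2) i j) 2 D.cylMeasure := by
  have h1 := ((hsol.Du_memLp i j).add (hsol.Du_memLp j i)).const_mul D.mu
  have h2 := ((memLp_finsetSum Finset.univ fun k _ => hsol.Du_memLp k k).const_mul
    D.lam).mul_const ((1 : Mat d) i j)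
  refine (h1.add h2).ae_eq (ae_of_all _ fun p => ?_)
  simp [Data.S, stress, Matrix.trace, mul_add]

theorem integrable_frob_S (hsol : IsDissipativeTurbulentSolution D γ R Z u Du m Rey En)
    (hΩ : IsBoundedLipschitzDomain D.Ω) {A : ℝ × E d → Mat d}
    (hA : ∀ i j, ContinuousOn (fun p => A p i j) (Icc 0 D.T ×ˢ closure D.Ω)) :
    Integrable (fun p : ℝ × E d => frob (D.S (Du p.1 p.2)) (A p)) D.cylMeasure := by
  have := hΩ.isFiniteMeasure_cylMeasure
  have := integrable_finsetSum Finset.univ fun i _ => integrable_finsetSum Finset.univ fun j _ =>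
    Data.integrable_coef_mul hΩ (hA i j) ((hsol.memLp_S i j).integrable one_le_two)
  refine this.congr (ae_of_all _ fun p => ?_)
  simp only [frob]
  exact Finset.sum_congr rfl fun i _ => Finset.sum_congr rfl fun j _ => by ring

theorem integrable_frob_S_self (hsol : IsDissipativeTurbulentSolution D γ R Z u Du m Rey En) :
    Integrable (fun p : ℝ × E d => frob (D.S (Du p.1 p.2)) (Du p.1 p.2)) D.cylMeasure :=
  integrable_finsetSum _ fun i _ => integrable_finsetSum _ fun j _ =>
    (hsol.memLp_S i j).integrable_mul (hsol.Du_memLp i j)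

theorem integrable_convect_self (hsol : IsDissipativeTurbulentSolution D γ R Z u Du m Rey En)
    (hΩ : IsBoundedLipschitzDomain D.Ω) {A : ℝ × E d → Mat d}
    (hA : ∀ i j, ContinuousOn (fun p => A p i j) (Icc 0 D.T ×ˢ closure D.Ω)) :
    Integrable (fun p : ℝ × E d => (R p.1 p.2 + Z p.1 p.2)
      * convect (u p.1 p.2) (A p) (u p.1 p.2)) D.cylMeasure :=
  integrable_convect (g := fun p => R p.1 p.2 + Z p.1 p.2) (v := fun p => u p.1 p.2)
    (w := fun p => u p.1 p.2) hΩ hA fun i j => hsol.convective_int j i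

theorem integrable_convect_coef (hsol : IsDissipativeTurbulentSolution D γ R Z u Du m Rey En)
    (hΩ : IsBoundedLipschitzDomain D.Ω) {A : ℝ × E d → Mat d} {w : ℝ × E d → E d}
    (hA : ∀ i j, ContinuousOn (fun p => A p i j) (Icc 0 D.T ×ˢ closure D.Ω))
    (hw : ContinuousOn w (Icc 0 D.T ×ˢ closure D.Ω)) :
    Integrable (fun p : ℝ × E d => (R p.1 p.2 + Z p.1 p.2)
      * convect (u p.1 p.2) (A p) (w p)) D.cylMeasure :=
  integrable_convect (g := fun p => R p.1 p.2 + Z p.1 p.2) (v := fun p => u p.1 p.2)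
    (w := w) hΩ hA fun i j => (Data.integrable_coef_mul hΩ (continuousOn_apply hw i)
      (hsol.integrable_rhou hΩ j)).congr (ae_of_all _ fun p => by simp only; ring)

/-- The product in `U - u` expands into a density, two momenta and a convective term, each with
continuous coefficients. -/
theorem integrable_convect_sub (hsol : IsDissipativeTurbulentSolution D γ R Z u Du m Rey En)
    (hΩ : IsBoundedLipschitzDomain D.Ω) {A : ℝ × E d → Mat d} {U : ℝ × E d → E d}
    (hA : ∀ i j, ContinuousOn (fun p => A p i j) (Icc 0 D.T ×ˢ closure D.Ω))
    (hU : ContinuousOn U (Icc 0 D.T ×ˢ closure D.Ω)) :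
    Integrable (fun p : ℝ × E d => (R p.1 p.2 + Z p.1 p.2)
      * convect (U p - u p.1 p.2) (A p) (U p - u p.1 p.2)) D.cylMeasure := by
  refine integrable_convect (g := fun p => R p.1 p.2 + Z p.1 p.2)
    (v := fun p => U p - u p.1 p.2) (w := fun p => U p - u p.1 p.2) hΩ hA fun i j => ?_
  have hρ : Integrable (fun p : ℝ × E d => R p.1 p.2 + Z p.1 p.2) D.cylMeasure :=
    (hsol.integrable_R hΩ).add (hsol.integrable_Z hΩ)
  have hUi := fun i => continuousOn_apply hU i
  have h1 := Data.integrable_coef_mul hΩ ((hUi j).mul (hUi i)) hρ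
  have h2 := Data.integrable_coef_mul hΩ (hUi j) (hsol.integrable_rhou hΩ i)
  have h3 := Data.integrable_coef_mul hΩ (hUi i) (hsol.integrable_rhou hΩ j)
  refine (((h1.sub h2).sub h3).add (hsol.convective_int j i)).congr (ae_of_all _ fun p => ?_)
  simp only [Pi.add_apply, Pi.sub_apply, Pi.mul_apply, PiLp.sub_apply]
  ring

end IsDissipativeTurbulentSolution

end Terms

/-! ### Linearity of iterated integrals -/

section HasIterInt

variable {X : Type*} [MeasurableSpace X]

/-- `f` is integrable on `(0,T) × X` and `a` is the iterated integral of `f` up to time `τ`. -/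
def HasIterInt (ν : Measure X) (T τ : ℝ) (f : ℝ → X → ℝ) (a : ℝ) : Prop :=
  Integrable (fun p : ℝ × X => f p.1 p.2) ((volume.restrict (Ioo 0 T)).prod ν) ∧
    ∫ t in (0 : ℝ)..τ, ∫ x, f t x ∂ν = a

variable {ν : Measure X} [SFinite ν] {T τ : ℝ} {f g : ℝ → X → ℝ} {a b : ℝ}

theorem HasIterInt.add (hτ : τ ∈ Icc 0 T) (hf : HasIterInt ν T τ f a)
    (hg : HasIterInt ν T τ g b) : HasIterInt ν T τ (fun t x => f t x + g t x) (a + b) := by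
  have h := hf.1.add hg.1
  refine ⟨h, ?_⟩
  rw [intervalIntegral_integral_eq hτ h, ← hf.2, ← hg.2, intervalIntegral_integral_eq hτ hf.1,
    intervalIntegral_integral_eq hτ hg.1]
  exact integral_add (integrable_prod_restrict_mono hf.1 hτ.2)
    (integrable_prod_restrict_mono hg.1 hτ.2)

theorem HasIterInt.neg (hτ : τ ∈ Icc 0 T) (hf : HasIterInt ν T τ f a) :
    HasIterInt ν T τ (fun t x => -f t x) (-a) := by
  have h := hf.1.neg
  refine ⟨h, ?_⟩
  rw [intervalIntegral_integral_eq hτ h, ← hf.2, intervalIntegral_integral_eq hτ hf.1]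
  exact integral_neg _

theorem HasIterInt.sub (hτ : τ ∈ Icc 0 T) (hf : HasIterInt ν T τ f a)
    (hg : HasIterInt ν T τ g b) : HasIterInt ν T τ (fun t x => f t x - g t x) (a - b) := by
  simpa only [sub_eq_add_neg] using hf.add hτ (hg.neg hτ)

theorem HasIterInt.eq_of_ae (hτ : τ ∈ Icc 0 T) (hf : HasIterInt ν T τ f a)
    (hg : HasIterInt ν T τ g b)
    (h : ∀ᵐ p ∂((volume.restrict (Ioo 0 T)).prod ν), f p.1 p.2 = g p.1 p.2) : a = b := by
  rw [← hf.2, ← hg.2, intervalIntegral_integral_eq hτ hf.1, intervalIntegral_integral_eq hτ hg.1]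
  refine integral_congr_ae ?_
  have hle : (volume.restrict (Ioo 0 τ)).prod ν ≤ (volume.restrict (Ioo 0 T)).prod ν :=
    Measure.prod_mono (Measure.restrict_mono (Ioo_subset_Ioo_right hτ.2) le_rfl) le_rfl
  exact (Measure.absolutelyContinuous_of_le hle).ae_le h

end HasIterInt

/-! ### Continuity of the coefficients -/

section CoefficientContinuity

variable {d : ℕ} {D : Data d} {r z : ℝ → E d → ℝ} {U : ℝ → E d → E d}

theorem continuousOn_div (hT : 0 < D.T) (hu : UniqueDiffOn ℝ (closure D.Ω))
    (hU : IsC1 D.T D.Ω U) :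
    ContinuousOn (fun p : ℝ × E d => div D.Ω (U p.1) p.2) (Icc 0 D.T ×ˢ closure D.Ω) :=
  continuousOn_finsetSum _ fun j _ => (hU.component j).continuousOn_pd hT hu j

theorem continuousOn_grad (hT : 0 < D.T) (hu : UniqueDiffOn ℝ (closure D.Ω))
    (hr : IsC1 D.T D.Ω r) :
    ContinuousOn (fun p : ℝ × E d => grad D.Ω (r p.1) p.2) (Icc 0 D.T ×ˢ closure D.Ω) :=
  continuousOn_of_apply fun j => hr.continuousOn_pd hT hu j

theorem continuousOn_massResidual (hT : 0 < D.T) (hu : UniqueDiffOn ℝ (closure D.Ω))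
    (hr : IsC1 D.T D.Ω r) (hU : IsC1 D.T D.Ω U) :
    ContinuousOn (fun p : ℝ × E d => massResidual D r U p.1 p.2) (Icc 0 D.T ×ˢ closure D.Ω) :=
  (hr.continuousOn_dt hT hu).fun_add
    (continuousOn_div (U := fun t y => r t y • U t y) hT hu (hr.smul hU))

theorem continuousOn_momentumResidual (hT : 0 < D.T) (hu : UniqueDiffOn ℝ (closure D.Ω))
    (hr : IsC1 D.T D.Ω r) (hz : IsC1 D.T D.Ω z) (hU : IsC1 D.T D.Ω U) :
    ContinuousOn (fun p : ℝ × E d => momentumResidual D r z U p.1 p.2)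
      (Icc 0 D.T ×ˢ closure D.Ω) := by
  have h1 : ∀ i j, IsC1 D.T D.Ω fun t y => ((r t y + z t y) • outer (U t y) (U t y)) i j :=
    fun i j => ContDiffOn.mul (hr.add hz) (ContDiffOn.mul (hU.component i) (hU.component j))
  have h2 : ContinuousOn (fun p : ℝ × E d =>
      divTensor D.Ω (fun y => (r p.1 y + z p.1 y) • outer (U p.1 y) (U p.1 y)) p.2)
      (Icc 0 D.T ×ˢ closure D.Ω) := by
    refine continuousOn_of_apply fun i => ?_
    have h3 := continuousOn_finsetSum Finset.univ fun j _ => (h1 i j).continuousOn_pd hT hu j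
    exact h3
  have h4 := ((hr.add hz).smul hU).continuousOn_dt hT hu
  exact h4.fun_add h2

end CoefficientContinuity

/-! ### Thermodynamic relations for the data -/

section Thermodynamics

variable {d : ℕ} {D : Data d} {J : Set ℝ}

theorem Data.contDiffOn_H (hb : D.b₁ < D.b₂) (hJ₁ : Ioo D.b₁ D.b₂ ⊆ J)
    (hJ₂ : J ⊆ Icc D.b₁ D.b₂) (hP : ContDiffOn ℝ 2 D.P (slopeCone J)) :
    ContDiffOn ℝ 2 D.H (slopeCone J) :=
  contDiffOn_helmholtz (ordConnected_of_Ioo_subset hJ₁ hJ₂).convex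
    (uniqueDiffOn_slopeCone hb hJ₁ hJ₂) hP

theorem Data.contDiffOn_dR_H (hb : D.b₁ < D.b₂) (hJ₁ : Ioo D.b₁ D.b₂ ⊆ J)
    (hJ₂ : J ⊆ Icc D.b₁ D.b₂) (hP : ContDiffOn ℝ 2 D.P (slopeCone J)) :
    ContDiffOn ℝ 1 (dR D.K D.H) (slopeCone J) :=
  contDiffOn_dR hb hJ₁ hJ₂ (Data.contDiffOn_H hb hJ₁ hJ₂ hP) (by norm_num)

theorem Data.contDiffOn_dZ_H (hb : D.b₁ < D.b₂) (hJ₁ : Ioo D.b₁ D.b₂ ⊆ J)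
    (hJ₂ : J ⊆ Icc D.b₁ D.b₂) (hP : ContDiffOn ℝ 2 D.P (slopeCone J)) :
    ContDiffOn ℝ 1 (dZ D.K D.H) (slopeCone J) :=
  contDiffOn_dZ hb hJ₁ hJ₂ (Data.contDiffOn_H hb hJ₁ hJ₂ hP) (by norm_num)

theorem Data.continuousOn_dR {F : ℝ × ℝ → ℝ} (hb : D.b₁ < D.b₂) (hJ₁ : Ioo D.b₁ D.b₂ ⊆ J)
    (hJ₂ : J ⊆ Icc D.b₁ D.b₂) (hF : ContDiffOn ℝ 1 F (slopeCone J)) :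
    ContinuousOn (dR D.K F) (slopeCone J) :=
  (contDiffOn_dR (m := 0) hb hJ₁ hJ₂ hF (by norm_num)).continuousOn

theorem Data.continuousOn_dZ {F : ℝ × ℝ → ℝ} (hb : D.b₁ < D.b₂) (hJ₁ : Ioo D.b₁ D.b₂ ⊆ J)
    (hJ₂ : J ⊆ Icc D.b₁ D.b₂) (hF : ContDiffOn ℝ 1 F (slopeCone J)) :
    ContinuousOn (dZ D.K F) (slopeCone J) :=
  (contDiffOn_dZ (m := 0) hb hJ₁ hJ₂ hF (by norm_num)).continuousOn

theorem Data.hasFDerivWithinAt_of_contDiffOn {F : ℝ × ℝ → ℝ} (hb : D.b₁ < D.b₂)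
    (hJ₁ : Ioo D.b₁ D.b₂ ⊆ J) (hJ₂ : J ⊆ Icc D.b₁ D.b₂) (hF : ContDiffOn ℝ 1 F (slopeCone J))
    {p : ℝ × ℝ} (hp : p ∈ slopeCone J) :
    HasFDerivWithinAt F (dR D.K F p • ContinuousLinearMap.fst ℝ ℝ ℝ
      + dZ D.K F p • ContinuousLinearMap.snd ℝ ℝ ℝ) (slopeCone J) p :=
  hasFDerivWithinAt_slopeCone hb hJ₁ hJ₂ hp (hF.differentiableOn one_ne_zero p hp)

theorem Data.hasFDerivWithinAt_dR_H (hb : D.b₁ < D.b₂) (hJ₁ : Ioo D.b₁ D.b₂ ⊆ J)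
    (hJ₂ : J ⊆ Icc D.b₁ D.b₂) (hP : ContDiffOn ℝ 2 D.P (slopeCone J)) {p : ℝ × ℝ}
    (hp : p ∈ slopeCone J) :
    HasFDerivWithinAt (dR D.K D.H) (dR D.K (dR D.K D.H) p • ContinuousLinearMap.fst ℝ ℝ ℝ
      + dR D.K (dZ D.K D.H) p • ContinuousLinearMap.snd ℝ ℝ ℝ) (slopeCone J) p := by
  have h := Data.hasFDerivWithinAt_of_contDiffOn hb hJ₁ hJ₂
    (Data.contDiffOn_dR_H hb hJ₁ hJ₂ hP) hp
  have hc : dZ D.K (dR D.K D.H) p = dR D.K (dZ D.K D.H) p :=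
    dZ_dR_comm hb hJ₁ hJ₂ hp (Data.contDiffOn_H hb hJ₁ hJ₂ hP)
  rwa [hc] at h

/-- By the Helmholtz relation the part independent of `(a, c)` is the pressure. Besides `H`, only
terms linear in the densities are left, and these are accessible to the continuity equations. -/
theorem Data.bregman_H (hb : D.b₁ < D.b₂) (hJ₁ : Ioo D.b₁ D.b₂ ⊆ J)
    (hJ₂ : J ⊆ Icc D.b₁ D.b₂) (hP : ContDiffOn ℝ 2 D.P (slopeCone J)) {r z : ℝ}
    (hp : (r, z) ∈ slopeCone J) (a c : ℝ) :
    bregman D.K D.H a c r z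
      = D.H (a, c) - dR D.K D.H (r, z) * a - dZ D.K D.H (r, z) * c + D.P (r, z) := by
  have h : r * dR D.K D.H (r, z) + z * dZ D.K D.H (r, z) = D.H (r, z) + D.P (r, z) :=
    helmholtz_relation hb hJ₁ hJ₂ hP hp
  rw [bregman]
  linear_combination h

theorem inner_eq_sum (v w : E d) : inner ℝ v w = ∑ i, v i * w i := by
  simp [PiLp.inner_apply, mul_comm]

end Thermodynamics

/-! ### The interior identity -/

section Interior

variable {d : ℕ} {D : Data d} {J : Set ℝ} {r z : ℝ → E d → ℝ} {U : ℝ → E d → E d}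

/-- The left side collects the integrands of the energy inequality, of the tested momentum and
continuity equations, and of the two pressure terms. The viscous parts cancel by linearity, and the
chain rule reduces the rest to `relative_energy_identity`. -/
theorem pointwise_relative_energy_identity (hd : d = 2 ∨ d = 3) (hD : D.Admissible)
    (hu : UniqueDiffOn ℝ (closure D.Ω)) (hJ₁ : Ioo D.b₁ D.b₂ ⊆ J) (hJ₂ : J ⊆ Icc D.b₁ D.b₂)
    (hP : ContDiffOn ℝ 2 D.P (slopeCone J)) (htest : IsTestTriple D (slopeCone J) r z U)
    {t : ℝ} {x : E d} (ht : t ∈ Icc 0 D.T) (hx : x ∈ closure D.Ω) (R Z : ℝ) (u : E d)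
    (A : Mat d) :
    frob (D.S A) (A - jac D.Ω (U t) x) - frob (D.S A) A
      - frob ((R + Z) • outer u u + D.P (R, Z) • (1 : Mat d)) (jac D.Ω D.uB x)
      + (R + Z) * convect u (jac D.Ω D.uB x) (D.uB x)
      + frob (D.S A) (jac D.Ω D.uB x)
      + ((R + Z) * inner ℝ u (dt D.T (fun s y => D.uB y - U s y) t x)
        + (R + Z) * frob (outer u u) (jac D.Ω (fun y => D.uB y - U t y) x)
        + D.P (R, Z) * div D.Ω (fun y => D.uB y - U t y) x
        - frob (D.S A) (jac D.Ω (fun y => D.uB y - U t y) x))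
      + (R * dt D.T (fun s y => 1 / 2 * ‖U s y‖ ^ 2 - 1 / 2 * ‖D.uB y‖ ^ 2
            - dR D.K D.H (r s y, z s y)) t x
        + R * inner ℝ u (grad D.Ω (fun y => 1 / 2 * ‖U t y‖ ^ 2 - 1 / 2 * ‖D.uB y‖ ^ 2
            - dR D.K D.H (r t y, z t y)) x))
      + (Z * dt D.T (fun s y => 1 / 2 * ‖U s y‖ ^ 2 - 1 / 2 * ‖D.uB y‖ ^ 2
            - dZ D.K D.H (r s y, z s y)) t x
        + Z * inner ℝ u (grad D.Ω (fun y => 1 / 2 * ‖U t y‖ ^ 2 - 1 / 2 * ‖D.uB y‖ ^ 2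
            - dZ D.K D.H (r t y, z t y)) x))
      + dt D.T (fun s y => D.P (r s y, z s y)) t x
      + div D.Ω (fun y => D.P (r t y, z t y) • U t y) x
    = -((R + Z) * convect (U t x - u) (jac D.Ω (U t) x) (U t x - u))
      - bregman D.K D.P R Z (r t x) (z t x) * div D.Ω (U t) x
      + ((R + Z) / (r t x + z t x) - 1) * inner ℝ (U t x - u) (momentumResidual D r z U t x)
      + inner ℝ (U t x - u) (momentumResidual D r z U t x
          + grad D.Ω (fun y => D.P (r t y, z t y)) x)
      + (R - r t x) * inner ℝ (U t x - u)
          (dR D.K (dR D.K D.H) (r t x, z t x) • grad D.Ω (r t) x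
            + dR D.K (dZ D.K D.H) (r t x, z t x) • grad D.Ω (z t) x)
      + (Z - z t x) * inner ℝ (U t x - u)
          (dZ D.K (dZ D.K D.H) (r t x, z t x) • grad D.Ω (z t) x
            + dR D.K (dZ D.K D.H) (r t x, z t x) • grad D.Ω (r t) x)
      + ((R + Z) / (r t x + z t x) * inner ℝ (u - U t x) (U t x)
            + dR D.K D.P (r t x, z t x)
            - R * dR D.K (dR D.K D.H) (r t x, z t x)
            - Z * dR D.K (dZ D.K D.H) (r t x, z t x)) * massResidual D r U t x
      + ((R + Z) / (r t x + z t x) * inner ℝ (u - U t x) (U t x)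
            + dZ D.K D.P (r t x, z t x)
            - Z * dZ D.K (dZ D.K D.H) (r t x, z t x)
            - R * dR D.K (dZ D.K D.H) (r t x, z t x)) * massResidual D z U t x := by
  have hT := hD.T_pos
  have hb := hD.b₁_lt_b₂
  have hS := htest.mem t ht x hx
  have hr0 : 0 < r t x := hS.1
  obtain ⟨c, hc, hz⟩ := htest.z_pos
  have hz0 : 0 < z t x := hc.trans_le (hz t ht x hx)
  have hUC := htest.v_C1
  have hBC : IsC1 D.T D.Ω fun _ x => D.uB x := isC1_const hD.uB_smooth
  have hrd := htest.r_C1.hasCylDeriv ht hx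
  have hzd := htest.z_C1.hasCylDeriv ht hx
  have hpC : IsC1 D.T D.Ω fun s y => D.P (r s y, z s y) :=
    IsC1.comp₂ (hP.of_le one_le_two) htest.r_C1 htest.z_C1 htest.mem
  -- first-order data of the composite fields
  have h1 := hrd.comp₂ hT hu ht hx hzd (Data.hasFDerivWithinAt_dR_H hb hJ₁ hJ₂ hP hS) htest.mem
  have h2 := hrd.comp₂ hT hu ht hx hzd (Data.hasFDerivWithinAt_of_contDiffOn hb hJ₁ hJ₂
    (Data.contDiffOn_dZ_H hb hJ₁ hJ₂ hP) hS) htest.mem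
  have hp := hrd.comp₂ hT hu ht hx hzd (Data.hasFDerivWithinAt_of_contDiffOn hb hJ₁ hJ₂
    (hP.of_le one_le_two) hS) htest.mem
  have hφ₁ := hasCylDeriv_half_norm_sq_sub hT hu hUC hD.uB_smooth h1 ht hx
  have hφ₂ := hasCylDeriv_half_norm_sq_sub hT hu hUC hD.uB_smooth h2 ht hx
  have edφ : ∀ i, dt D.T (fun s y => D.uB y - U s y) t x i
      = -dt D.T (fun s y => U s y i) t x := fun i => by
    rw [dt_sub_apply hT hu hBC hUC ht hx i, dt_const, zero_sub]
  have ejφ : jac D.Ω (fun y => D.uB y - U t y) x = jac D.Ω D.uB x - jac D.Ω (U t) x :=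
    jac_sub_eq hT hu hBC hUC ht hx
  have e1t := hφ₁.time
  have e1x : ∀ j, pd D.Ω j (fun y => 1 / 2 * ‖U t y‖ ^ 2 - 1 / 2 * ‖D.uB y‖ ^ 2
            - dR D.K D.H (r t y, z t y)) x = _ := hφ₁.space
  have e2t := hφ₂.time
  have e2x : ∀ j, pd D.Ω j (fun y => 1 / 2 * ‖U t y‖ ^ 2 - 1 / 2 * ‖D.uB y‖ ^ 2
            - dZ D.K D.H (r t y, z t y)) x = _ := hφ₂.space
  have ept := hp.time
  have epx : ∀ j, pd D.Ω j (fun y => D.P (r t y, z t y)) x = _ := hp.space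
  have egrad : ∀ (f : E d → ℝ) (j : Fin d), grad D.Ω f x j = pd D.Ω j f x := fun _ _ => rfl
  have hpress : dR D.K D.P (r t x, z t x) = r t x * dR D.K (dR D.K D.H) (r t x, z t x)
      + z t x * dR D.K (dZ D.K D.H) (r t x, z t x) ∧ dZ D.K D.P (r t x, z t x)
      = r t x * dR D.K (dZ D.K D.H) (r t x, z t x)
      + z t x * dZ D.K (dZ D.K D.H) (r t x, z t x) := dR_dZ_pressure hb hJ₁ hJ₂ hP hS
  have key := relative_energy_identity hd (R := R) (Z := Z) (Pv := D.P (R, Z)) (u := fun i => u i)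
    (U := fun i => U t x i) (V := fun i => D.uB x i)
    (Ut := fun i => dt D.T (fun s y => U s y i) t x) (rx := fun j => pd D.Ω j (r t) x)
    (zx := fun j => pd D.Ω j (z t) x) (A := fun i j => jac D.Ω (U t) x i j)
    (B := fun i j => jac D.Ω D.uB x i j) (rt := dt D.T r t x) (zt := dt D.T z t x)
    (pv := D.P (r t x, z t x)) (add_pos hr0 hz0).ne' hpress.1 hpress.2
  rw [div_smul_eq hT hu hpC hUC ht hx, massResidual_eq hT hu htest.r_C1 hUC ht hx,
    massResidual_eq hT hu htest.z_C1 hUC ht hx]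
  simp only [frob_sub_right, frob_add_left, frob_smul_left, frob_one_left, ejφ, div_eq_trace_jac,
    inner_eq_sum, edφ, e1t, e1x, e2t, e2x, ept, epx, egrad, bregman, PiLp.add_apply,
    PiLp.sub_apply, PiLp.smul_apply, smul_eq_mul, convect,
    momentumResidual_apply hT hu htest.r_C1 htest.z_C1 hUC ht hx, Matrix.sub_apply]
  -- The convective products are still contracted at this stage and have to be matched with the
  -- explicit double sums of `key`.
  have hfo : frob (outer u u) (jac D.Ω D.uB x) - frob (outer u u) (jac D.Ω (U t) x)
      = ∑ i, ∑ j, u i * u j * (jac D.Ω D.uB x i j - jac D.Ω (U t) x i j) := by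
    rw [← frob_sub_right]; rfl
  have hfo' : frob (outer u u) (jac D.Ω D.uB x) = ∑ i, ∑ j, u i * u j * jac D.Ω D.uB x i j := rfl
  linear_combination key + (R + Z) * hfo - (R + Z) * hfo'

end Interior

/-! ### Integration of the pointwise identity over the cylinder -/

section InteriorIntegral

variable {d : ℕ} {D : Data d} {J : Set ℝ} {γ : ℝ} {R Z : ℝ → E d → ℝ} {u : ℝ → E d → E d}
  {Du : ℝ → E d → Mat d} {m : ℝ → E d → E d}
  {Rey : ℝ → Fin d → Fin d → SignedMeasure (E d)} {En : ℝ → Measure (E d)}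
  {r z : ℝ → E d → ℝ} {U : ℝ → E d → E d}

theorem IsTestTriple.continuousOn_comp {F : ℝ × ℝ → ℝ}
    (htest : IsTestTriple D (slopeCone J) r z U) (hF : ContinuousOn F (slopeCone J)) :
    ContinuousOn (fun p : ℝ × E d => F (r p.1 p.2, z p.1 p.2)) (Icc 0 D.T ×ˢ closure D.Ω) :=
  hF.comp (htest.r_C1.continuousOn.prodMk htest.z_C1.continuousOn)
    fun p hp => htest.mem p.1 hp.1 p.2 hp.2

/-- The weighted velocity fields `g (u - U)` are integrable for `g = R`, `Z`, `R + Z` and `1`. -/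
theorem IsDissipativeTurbulentSolution.integrable_mul_inner_sub
    (hΩ : IsBoundedLipschitzDomain D.Ω) {g : ℝ × E d → ℝ} {V w : ℝ × E d → E d}
    (hV : ContinuousOn V (Icc 0 D.T ×ˢ closure D.Ω))
    (hw : ContinuousOn w (Icc 0 D.T ×ˢ closure D.Ω)) (hg : Integrable g D.cylMeasure)
    (hgu : ∀ i, Integrable (fun p => g p * u p.1 p.2 i) D.cylMeasure) :
    Integrable (fun p => g p * inner ℝ (V p - u p.1 p.2) (w p)) D.cylMeasure :=
  Data.integrable_mul_inner hΩ hw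
    (Data.integrable_mul_sub (v := fun p => u p.1 p.2) hΩ hV hg hgu)

theorem HasIterInt.of_cyl {τ : ℝ} {f : ℝ → E d → ℝ}
    (h : Integrable (fun p : ℝ × E d => f p.1 p.2) D.cylMeasure) :
    HasIterInt (volume.restrict D.Ω) D.T τ f (∫ t in (0 : ℝ)..τ, ∫ x in D.Ω, f t x) :=
  ⟨h, rfl⟩

/-- Once each of the terms is known to be integrable on the cylinder, iterated integrals are
additive and the pointwise identity can be integrated. Every term is a finite sum of an integrable
field of the solution times a continuous coefficient, apart from the viscous dissipation, which is a
product of two square-integrable factors. -/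
theorem interior_identity (hd : d = 2 ∨ d = 3) (hD : D.Admissible)
    (hΩ : IsBoundedLipschitzDomain D.Ω) (hJ₁ : Ioo D.b₁ D.b₂ ⊆ J) (hJ₂ : J ⊆ Icc D.b₁ D.b₂)
    (hP : ContDiffOn ℝ 2 D.P (slopeCone J))
    (hsol : IsDissipativeTurbulentSolution D γ R Z u Du m Rey En)
    (htest : IsTestTriple D (slopeCone J) r z U) {τ : ℝ} (hτ : τ ∈ Icc 0 D.T) :
    (∫ t in (0 : ℝ)..τ, ∫ x in D.Ω, frob (D.S (Du t x)) (Du t x - jac D.Ω (U t) x))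
      - (∫ t in (0 : ℝ)..τ, ∫ x in D.Ω, frob (D.S (Du t x)) (Du t x))
      - (∫ t in (0 : ℝ)..τ, ∫ x in D.Ω,
          frob ((R t x + Z t x) • outer (u t x) (u t x) + D.P (R t x, Z t x) • (1 : Mat d))
            (jac D.Ω D.uB x))
      + (∫ t in (0 : ℝ)..τ, ∫ x in D.Ω,
          (R t x + Z t x) * convect (u t x) (jac D.Ω D.uB x) (D.uB x))
      + (∫ t in (0 : ℝ)..τ, ∫ x in D.Ω, frob (D.S (Du t x)) (jac D.Ω D.uB x))
      + (∫ t in (0 : ℝ)..τ, ∫ x in D.Ω,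
          ((R t x + Z t x) * inner ℝ (u t x) (dt D.T (fun s y => D.uB y - U s y) t x)
            + (R t x + Z t x) * frob (outer (u t x) (u t x))
                (jac D.Ω (fun y => D.uB y - U t y) x)
            + D.P (R t x, Z t x) * div D.Ω (fun y => D.uB y - U t y) x
            - frob (D.S (Du t x)) (jac D.Ω (fun y => D.uB y - U t y) x)))
      + (∫ t in (0 : ℝ)..τ, ∫ x in D.Ω,
          (R t x * dt D.T (fun s y => 1 / 2 * ‖U s y‖ ^ 2 - 1 / 2 * ‖D.uB y‖ ^ 2
              - dR D.K D.H (r s y, z s y)) t x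
            + R t x * inner ℝ (u t x) (grad D.Ω (fun y => 1 / 2 * ‖U t y‖ ^ 2
              - 1 / 2 * ‖D.uB y‖ ^ 2 - dR D.K D.H (r t y, z t y)) x)))
      + (∫ t in (0 : ℝ)..τ, ∫ x in D.Ω,
          (Z t x * dt D.T (fun s y => 1 / 2 * ‖U s y‖ ^ 2 - 1 / 2 * ‖D.uB y‖ ^ 2
              - dZ D.K D.H (r s y, z s y)) t x
            + Z t x * inner ℝ (u t x) (grad D.Ω (fun y => 1 / 2 * ‖U t y‖ ^ 2
              - 1 / 2 * ‖D.uB y‖ ^ 2 - dZ D.K D.H (r t y, z t y)) x)))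
      + (∫ t in (0 : ℝ)..τ, ∫ x in D.Ω, dt D.T (fun s y => D.P (r s y, z s y)) t x)
      + (∫ t in (0 : ℝ)..τ, ∫ x in D.Ω, div D.Ω (fun y => D.P (r t y, z t y) • U t y) x)
    = - (∫ t in (0 : ℝ)..τ, ∫ x in D.Ω,
          (R t x + Z t x) * convect (U t x - u t x) (jac D.Ω (U t) x) (U t x - u t x))
      - (∫ t in (0 : ℝ)..τ, ∫ x in D.Ω,
          bregman D.K D.P (R t x) (Z t x) (r t x) (z t x) * div D.Ω (U t) x)
      + (∫ t in (0 : ℝ)..τ, ∫ x in D.Ω,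
          ((R t x + Z t x) / (r t x + z t x) - 1)
            * inner ℝ (U t x - u t x) (momentumResidual D r z U t x))
      + (∫ t in (0 : ℝ)..τ, ∫ x in D.Ω,
          inner ℝ (U t x - u t x)
            (momentumResidual D r z U t x + grad D.Ω (fun y => D.P (r t y, z t y)) x))
      + (∫ t in (0 : ℝ)..τ, ∫ x in D.Ω,
          (R t x - r t x) * inner ℝ (U t x - u t x)
            (dR D.K (dR D.K D.H) (r t x, z t x) • grad D.Ω (r t) x
              + dR D.K (dZ D.K D.H) (r t x, z t x) • grad D.Ω (z t) x))
      + (∫ t in (0 : ℝ)..τ, ∫ x in D.Ω,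
          (Z t x - z t x) * inner ℝ (U t x - u t x)
            (dZ D.K (dZ D.K D.H) (r t x, z t x) • grad D.Ω (z t) x
              + dR D.K (dZ D.K D.H) (r t x, z t x) • grad D.Ω (r t) x))
      + (∫ t in (0 : ℝ)..τ, ∫ x in D.Ω,
          ((R t x + Z t x) / (r t x + z t x) * inner ℝ (u t x - U t x) (U t x)
              + dR D.K D.P (r t x, z t x)
              - R t x * dR D.K (dR D.K D.H) (r t x, z t x)
              - Z t x * dR D.K (dZ D.K D.H) (r t x, z t x)) * massResidual D r U t x)
      + (∫ t in (0 : ℝ)..τ, ∫ x in D.Ω,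
          ((R t x + Z t x) / (r t x + z t x) * inner ℝ (u t x - U t x) (U t x)
              + dZ D.K D.P (r t x, z t x)
              - Z t x * dZ D.K (dZ D.K D.H) (r t x, z t x)
              - R t x * dR D.K (dZ D.K D.H) (r t x, z t x)) * massResidual D z U t x) := by
  have hT := hD.T_pos
  have hb := hD.b₁_lt_b₂
  have hu := hΩ.uniqueDiffOn
  have hfin := hΩ.isFiniteMeasure_cylMeasure
  -- regularity of the coefficients
  have hrC := htest.r_C1
  have hzC := htest.z_C1
  have hUC := htest.v_C1
  have hBC : IsC1 D.T D.Ω fun _ x => D.uB x := isC1_const hD.uB_smooth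
  have hP1 : ContDiffOn ℝ 1 D.P (slopeCone J) := hP.of_le one_le_two
  have hH1 := Data.contDiffOn_dR_H hb hJ₁ hJ₂ hP
  have hH2 := Data.contDiffOn_dZ_H hb hJ₁ hJ₂ hP
  have hpC : IsC1 D.T D.Ω fun s y => D.P (r s y, z s y) := IsC1.comp₂ hP1 hrC hzC htest.mem
  have hφ₁ : IsC1 D.T D.Ω fun s y => 1 / 2 * ‖U s y‖ ^ 2 - 1 / 2 * ‖D.uB y‖ ^ 2
      - dR D.K D.H (r s y, z s y) :=
    (hUC.half_norm_sq.sub hBC.half_norm_sq).sub (IsC1.comp₂ hH1 hrC hzC htest.mem)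
  have hφ₂ : IsC1 D.T D.Ω fun s y => 1 / 2 * ‖U s y‖ ^ 2 - 1 / 2 * ‖D.uB y‖ ^ 2
      - dZ D.K D.H (r s y, z s y) :=
    (hUC.half_norm_sq.sub hBC.half_norm_sq).sub (IsC1.comp₂ hH2 hrC hzC htest.mem)
  have hφ : IsC1 D.T D.Ω fun s y => D.uB y - U s y := hBC.sub hUC
  have cr := hrC.continuousOn
  have cz := hzC.continuousOn
  have cU := hUC.continuousOn
  have cA := hUC.continuousOn_jac hT hu
  have cB := hBC.continuousOn_jac hT hu
  have cdU := continuousOn_div hT hu hUC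
  have cM := continuousOn_momentumResidual hT hu hrC hzC hUC
  have cmr := continuousOn_massResidual hT hu hrC hUC
  have cmz := continuousOn_massResidual hT hu hzC hUC
  have cgr := continuousOn_grad hT hu hrC
  have cgz := continuousOn_grad hT hu hzC
  have cp := hpC.continuousOn
  have cPR := htest.continuousOn_comp (Data.continuousOn_dR hb hJ₁ hJ₂ hP1)
  have cPZ := htest.continuousOn_comp (Data.continuousOn_dZ hb hJ₁ hJ₂ hP1)
  have c11 := htest.continuousOn_comp (Data.continuousOn_dR hb hJ₁ hJ₂ hH1)
  have c12 := htest.continuousOn_comp (Data.continuousOn_dR hb hJ₁ hJ₂ hH2)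
  have c22 := htest.continuousOn_comp (Data.continuousOn_dZ hb hJ₁ hJ₂ hH2)
  -- Both test densities are positive on the closed cylinder, so the quotient by `r + z` is
  -- multiplication by a continuous coefficient.
  have cinv : ContinuousOn (fun p : ℝ × E d => (r p.1 p.2 + z p.1 p.2)⁻¹)
      (Icc 0 D.T ×ˢ closure D.Ω) := by
    refine (cr.add cz).inv₀ fun p hp => ?_
    obtain ⟨c, hc, hz⟩ := htest.z_pos
    have h1 : 0 < r p.1 p.2 := (htest.mem p.1 hp.1 p.2 hp.2).1
    have h2 := hz p.1 hp.1 p.2 hp.2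
    exact (add_pos h1 (hc.trans_le h2)).ne'
  -- integrability of the fields
  have iR := hsol.integrable_R hΩ
  have iZ := hsol.integrable_Z hΩ
  have iρ : Integrable (fun p : ℝ × E d => R p.1 p.2 + Z p.1 p.2) D.cylMeasure := iR.add iZ
  have iP := hsol.P_int
  have i1 : Integrable (fun _ : ℝ × E d => (1 : ℝ)) D.cylMeasure := integrable_const 1
  have i1u : ∀ i, Integrable (fun p : ℝ × E d => (1 : ℝ) * u p.1 p.2 i) D.cylMeasure := fun i => by
    simpa using hsol.integrable_u hΩ i
  have mulc := @Data.integrable_coef_mul d D hΩ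
  have ins := @IsDissipativeTurbulentSolution.integrable_mul_inner_sub d D u hΩ
  have frS := fun (A : ℝ × E d → Mat d) hA => hsol.integrable_frob_S hΩ (A := A) hA
  have hG0 : HasIterInt (volume.restrict D.Ω) D.T τ (fun t x =>
      frob (D.S (Du t x)) (Du t x - jac D.Ω (U t) x)) _ :=
    .of_cyl ((hsol.integrable_frob_S_self.sub (frS _ cA)).congr
      (ae_of_all _ fun p => (frob_sub_right _ _ _).symm))
  have he0 : HasIterInt (volume.restrict D.Ω) D.T τ (fun t x =>
      frob (D.S (Du t x)) (Du t x)) _ := .of_cyl hsol.integrable_frob_S_self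
  have he1 : HasIterInt (volume.restrict D.Ω) D.T τ (fun t x =>
      frob ((R t x + Z t x) • outer (u t x) (u t x) + D.P (R t x, Z t x) • (1 : Mat d))
        (jac D.Ω D.uB x)) _ :=
    .of_cyl (((hsol.integrable_convect_self hΩ cB).add
      (mulc (continuousOn_div hT hu hBC) iP)).congr (ae_of_all _ fun p => by
        simp only [Pi.add_apply, frob_add_left, frob_smul_left, frob_outer_eq_convect,
          frob_one_left, div_eq_trace_jac]; ring))
  have he2 : HasIterInt (volume.restrict D.Ω) D.T τ (fun t x =>
      (R t x + Z t x) * convect (u t x) (jac D.Ω D.uB x) (D.uB x)) _ :=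
    .of_cyl (hsol.integrable_convect_coef hΩ cB hBC.continuousOn)
  have he3 : HasIterInt (volume.restrict D.Ω) D.T τ (fun t x =>
      frob (D.S (Du t x)) (jac D.Ω D.uB x)) _ := .of_cyl (frS _ cB)
  have cdφ : ContinuousOn (fun p : ℝ × E d => dt D.T (fun s y => D.uB y - U s y) p.1 p.2)
      (Icc 0 D.T ×ˢ closure D.Ω) := hφ.continuousOn_dt hT hu
  have hm1 : HasIterInt (volume.restrict D.Ω) D.T τ (fun t x =>
      (R t x + Z t x) * inner ℝ (u t x) (dt D.T (fun s y => D.uB y - U s y) t x)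
        + (R t x + Z t x) * frob (outer (u t x) (u t x)) (jac D.Ω (fun y => D.uB y - U t y) x)
        + D.P (R t x, Z t x) * div D.Ω (fun y => D.uB y - U t y) x
        - frob (D.S (Du t x)) (jac D.Ω (fun y => D.uB y - U t y) x)) _ :=
    .of_cyl (((((Data.integrable_mul_inner (v := fun p => u p.1 p.2) hΩ cdφ
        (hsol.integrable_rhou hΩ)).add
      (hsol.integrable_convect_self hΩ (hφ.continuousOn_jac hT hu))).add
      (mulc (continuousOn_div hT hu hφ) iP)).sub (frS _ (hφ.continuousOn_jac hT hu))).congr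
      (ae_of_all _ fun p => by
        simp only [Pi.add_apply, Pi.sub_apply, frob_outer_eq_convect]; ring))
  have hc1 : HasIterInt (volume.restrict D.Ω) D.T τ (fun t x =>
      R t x * dt D.T (fun s y => 1 / 2 * ‖U s y‖ ^ 2 - 1 / 2 * ‖D.uB y‖ ^ 2
          - dR D.K D.H (r s y, z s y)) t x
        + R t x * inner ℝ (u t x) (grad D.Ω (fun y => 1 / 2 * ‖U t y‖ ^ 2
          - 1 / 2 * ‖D.uB y‖ ^ 2 - dR D.K D.H (r t y, z t y)) x)) _ :=
    .of_cyl (((mulc (hφ₁.continuousOn_dt hT hu) iR).add (Data.integrable_mul_inner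
      (v := fun p => u p.1 p.2) hΩ (continuousOn_grad hT hu hφ₁) (hsol.integrable_Ru hΩ))).congr
      (ae_of_all _ fun p => by simp only [Pi.add_apply]; ring))
  have hc2 : HasIterInt (volume.restrict D.Ω) D.T τ (fun t x =>
      Z t x * dt D.T (fun s y => 1 / 2 * ‖U s y‖ ^ 2 - 1 / 2 * ‖D.uB y‖ ^ 2
          - dZ D.K D.H (r s y, z s y)) t x
        + Z t x * inner ℝ (u t x) (grad D.Ω (fun y => 1 / 2 * ‖U t y‖ ^ 2
          - 1 / 2 * ‖D.uB y‖ ^ 2 - dZ D.K D.H (r t y, z t y)) x)) _ :=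
    .of_cyl (((mulc (hφ₂.continuousOn_dt hT hu) iZ).add (Data.integrable_mul_inner
      (v := fun p => u p.1 p.2) hΩ (continuousOn_grad hT hu hφ₂) (hsol.integrable_Zu hΩ))).congr
      (ae_of_all _ fun p => by simp only [Pi.add_apply]; ring))
  have hf1 : HasIterInt (volume.restrict D.Ω) D.T τ (fun t x =>
      dt D.T (fun s y => D.P (r s y, z s y)) t x) _ :=
    .of_cyl (Data.integrable_coef hΩ (hpC.continuousOn_dt hT hu))
  have hg1 : HasIterInt (volume.restrict D.Ω) D.T τ (fun t x =>
      div D.Ω (fun y => D.P (r t y, z t y) • U t y) x) _ :=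
    .of_cyl (Data.integrable_coef hΩ (continuousOn_div (U := fun t y => D.P (r t y, z t y) • U t y)
      hT hu (hpC.smul hUC)))
  have hG1 : HasIterInt (volume.restrict D.Ω) D.T τ (fun t x =>
      (R t x + Z t x) * convect (U t x - u t x) (jac D.Ω (U t) x) (U t x - u t x)) _ :=
    .of_cyl (hsol.integrable_convect_sub hΩ cA cU)
  have hG2 : HasIterInt (volume.restrict D.Ω) D.T τ (fun t x =>
      bregman D.K D.P (R t x) (Z t x) (r t x) (z t x) * div D.Ω (U t) x) _ :=
    .of_cyl ((((mulc cdU iP).sub (mulc (cPR.mul cdU) iR)).sub (mulc (cPZ.mul cdU) iZ)).add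
      (Data.integrable_coef hΩ ((((cPR.mul cr).add (cPZ.mul cz)).sub cp).mul cdU)) |>.congr
      (ae_of_all _ fun p => by
        simp only [Pi.add_apply, Pi.sub_apply, Pi.mul_apply, bregman]; ring))
  have hG3 : HasIterInt (volume.restrict D.Ω) D.T τ (fun t x =>
      ((R t x + Z t x) / (r t x + z t x) - 1)
        * inner ℝ (U t x - u t x) (momentumResidual D r z U t x)) _ :=
    .of_cyl (((mulc cinv (ins cU cM iρ (hsol.integrable_rhou hΩ))).sub
      (ins cU cM i1 i1u)).congr (ae_of_all _ fun p => by
        simp only [Pi.sub_apply]; ring))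
  have hG4 : HasIterInt (volume.restrict D.Ω) D.T τ (fun t x =>
      inner ℝ (U t x - u t x)
        (momentumResidual D r z U t x + grad D.Ω (fun y => D.P (r t y, z t y)) x)) _ :=
    .of_cyl ((ins cU (cM.fun_add (continuousOn_grad hT hu hpC)) i1 i1u).congr
      (ae_of_all _ fun p => by simp only [one_mul]))
  have cw1 := (c11.smul cgr).fun_add (c12.smul cgz)
  have cw2 := (c22.smul cgz).fun_add (c12.smul cgr)
  have hG5 : HasIterInt (volume.restrict D.Ω) D.T τ (fun t x =>
      (R t x - r t x) * inner ℝ (U t x - u t x)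
        (dR D.K (dR D.K D.H) (r t x, z t x) • grad D.Ω (r t) x
          + dR D.K (dZ D.K D.H) (r t x, z t x) • grad D.Ω (z t) x)) _ :=
    .of_cyl (((ins cU cw1 iR (hsol.integrable_Ru hΩ)).sub (mulc cr (ins cU cw1 i1 i1u))).congr
      (ae_of_all _ fun p => by simp only [Pi.sub_apply, Pi.smul_apply']; ring))
  have hG6 : HasIterInt (volume.restrict D.Ω) D.T τ (fun t x =>
      (Z t x - z t x) * inner ℝ (U t x - u t x)
        (dZ D.K (dZ D.K D.H) (r t x, z t x) • grad D.Ω (z t) x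
          + dR D.K (dZ D.K D.H) (r t x, z t x) • grad D.Ω (r t) x)) _ :=
    .of_cyl (((ins cU cw2 iZ (hsol.integrable_Zu hΩ)).sub (mulc cz (ins cU cw2 i1 i1u))).congr
      (ae_of_all _ fun p => by simp only [Pi.sub_apply, Pi.smul_apply']; ring))
  have iq := ins cU cU iρ (hsol.integrable_rhou hΩ)
  have hsw : ∀ v w y : E d, inner ℝ (v - w) y = -inner ℝ (w - v) y := fun v w y => by
    rw [← inner_neg_left, neg_sub]
  have hG7 : HasIterInt (volume.restrict D.Ω) D.T τ (fun t x =>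
      ((R t x + Z t x) / (r t x + z t x) * inner ℝ (u t x - U t x) (U t x)
          + dR D.K D.P (r t x, z t x)
          - R t x * dR D.K (dR D.K D.H) (r t x, z t x)
          - Z t x * dR D.K (dZ D.K D.H) (r t x, z t x)) * massResidual D r U t x) _ :=
    .of_cyl ((((Data.integrable_coef hΩ (cPR.mul cmr)).sub (mulc (cinv.mul cmr) iq)).sub
      (mulc (c11.mul cmr) iR)).sub (mulc (c12.mul cmr) iZ) |>.congr (ae_of_all _ fun p => by
        simp only [Pi.sub_apply, Pi.mul_apply, hsw (u p.1 p.2)]; ring))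
  have hG8 : HasIterInt (volume.restrict D.Ω) D.T τ (fun t x =>
      ((R t x + Z t x) / (r t x + z t x) * inner ℝ (u t x - U t x) (U t x)
          + dZ D.K D.P (r t x, z t x)
          - Z t x * dZ D.K (dZ D.K D.H) (r t x, z t x)
          - R t x * dR D.K (dZ D.K D.H) (r t x, z t x)) * massResidual D z U t x) _ :=
    .of_cyl ((((Data.integrable_coef hΩ (cPZ.mul cmz)).sub (mulc (cinv.mul cmz) iq)).sub
      (mulc (c22.mul cmz) iZ)).sub (mulc (c12.mul cmz) iR) |>.congr (ae_of_all _ fun p => by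
        simp only [Pi.sub_apply, Pi.mul_apply, hsw (u p.1 p.2)]; ring))
  -- The terms are combined in exactly the order of the pointwise identity, so that it closes the
  -- remaining almost-everywhere goal directly.
  refine (((((((((hG0.sub hτ he0).sub hτ he1).add hτ he2).add hτ he3).add hτ hm1).add hτ
    hc1).add hτ hc2).add hτ hf1).add hτ hg1).eq_of_ae hτ
    ((((((((hG1.neg hτ).sub hτ hG2).add hτ hG3).add hτ hG4).add hτ hG5).add hτ hG6).add hτ
      hG7).add hτ hG8) ?_
  filter_upwards [ae_mem_cyl hΩ.isOpen] with p hp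
  exact pointwise_relative_energy_identity hd hD hu hJ₁ hJ₂ hP htest
    (Ioo_subset_Icc_self hp.1) (subset_closure hp.2) _ _ _ _

end InteriorIntegral

/-! ### Boundary terms -/

section BoundaryIntegral

variable {d : ℕ} {D : Data d} {J : Set ℝ} {γ : ℝ} {R Z : ℝ → E d → ℝ} {u : ℝ → E d → E d}
  {Du : ℝ → E d → Mat d} {m : ℝ → E d → E d}
  {Rey : ℝ → Fin d → Fin d → SignedMeasure (E d)} {En : ℝ → Measure (E d)}
  {r z : ℝ → E d → ℝ} {U : ℝ → E d → E d}

theorem ae_mem_lateral {Ω : Set (E d)} (hs : IsFiniteMeasure (surfaceMeasure Ω)) {T : ℝ}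
    {s : Set (E d)} (hsm : MeasurableSet s) (hsub : s ⊆ frontier Ω) :
    ∀ᵐ p ∂((volume.restrict (Ioo 0 T)).prod ((surfaceMeasure Ω).restrict s)),
      p.1 ∈ Ioo 0 T ∧ p.2 ∈ frontier Ω := by
  rw [Measure.prod_restrict]
  filter_upwards [ae_restrict_mem (measurableSet_Ioo.prod hsm)] with p hp
    using ⟨hp.1, hsub hp.2⟩

/-- A bounded measurable function of the space variable, times the flux, is integrable on the
lateral boundary. -/
theorem Data.integrable_bounded_mul_flux (hD : D.Admissible)
    (hs : IsFiniteMeasure (surfaceMeasure D.Ω)) {f : E d → ℝ} (hf : Measurable f) {C : ℝ}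
    (hC : ∀ x, |f x| ≤ C) :
    Integrable (fun p : ℝ × E d => f p.2 * D.flux p.2)
      ((volume.restrict (Ioo 0 D.T)).prod (surfaceMeasure D.Ω)) := by
  obtain ⟨C', hC'⟩ := Data.exists_bound_flux (D := D) hD.uB_smooth.continuous hD.uB_supp
  have hfl := Data.measurable_flux (D := D) hD.uB_smooth.continuous
  refine Integrable.of_bound (C := C * C')
    ((hf.comp measurable_snd).mul (hfl.comp measurable_snd)).aestronglyMeasurable
    (ae_of_all _ fun p => ?_)
  rw [norm_mul]
  exact mul_le_mul (hC _) (hC' _) (abs_nonneg _) ((abs_nonneg _).trans (hC p.2))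

/-- On the boundary `U = u_B`, so the test functions of the continuity equations reduce to minus the
derivatives of `H`. The affine form of the Bregman term then leaves only the flux of the pressure `P
(r, z)`. It has the same integrand on the inflow and outflow parts, so these join into one surface
integral to which the divergence theorem applies. -/
theorem boundary_identity (hD : D.Admissible)
    (hΩ : IsBoundedLipschitzDomain D.Ω) (hJ₁ : Ioo D.b₁ D.b₂ ⊆ J) (hJ₂ : J ⊆ Icc D.b₁ D.b₂)
    (hPK : ContDiffOn ℝ 1 D.P D.K) (hP₀ : D.P (0, 0) = 0)
    (hP : ContDiffOn ℝ 2 D.P (slopeCone J))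
    (hsol : IsDissipativeTurbulentSolution D γ R Z u Du m Rey En)
    (htest : IsTestTriple D (slopeCone J) r z U) {τ : ℝ} (hτ : τ ∈ Icc 0 D.T) :
    (∫ t in (0 : ℝ)..τ, ∫ x in D.outflow,
        bregman D.K D.H (R t x) (Z t x) (r t x) (z t x) * D.flux x ∂(surfaceMeasure D.Ω))
      + (∫ t in (0 : ℝ)..τ, ∫ x in D.inflow,
        bregman D.K D.H (D.RB x) (D.ZB x) (r t x) (z t x) * D.flux x ∂(surfaceMeasure D.Ω))
    = (∫ t in (0 : ℝ)..τ, ∫ x in D.outflow,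
        D.H (R t x, Z t x) * D.flux x ∂(surfaceMeasure D.Ω))
      + (∫ _t in (0 : ℝ)..τ, ∫ x in D.inflow,
        D.H (D.RB x, D.ZB x) * D.flux x ∂(surfaceMeasure D.Ω))
      + ((∫ t in (0 : ℝ)..τ, ∫ x in D.outflow, (1 / 2 * ‖U t x‖ ^ 2 - 1 / 2 * ‖D.uB x‖ ^ 2
            - dR D.K D.H (r t x, z t x)) * R t x * D.flux x ∂(surfaceMeasure D.Ω))
        + ∫ t in (0 : ℝ)..τ, ∫ x in D.inflow, (1 / 2 * ‖U t x‖ ^ 2 - 1 / 2 * ‖D.uB x‖ ^ 2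
            - dR D.K D.H (r t x, z t x)) * D.RB x * D.flux x ∂(surfaceMeasure D.Ω))
      + ((∫ t in (0 : ℝ)..τ, ∫ x in D.outflow, (1 / 2 * ‖U t x‖ ^ 2 - 1 / 2 * ‖D.uB x‖ ^ 2
            - dZ D.K D.H (r t x, z t x)) * Z t x * D.flux x ∂(surfaceMeasure D.Ω))
        + ∫ t in (0 : ℝ)..τ, ∫ x in D.inflow, (1 / 2 * ‖U t x‖ ^ 2 - 1 / 2 * ‖D.uB x‖ ^ 2
            - dZ D.K D.H (r t x, z t x)) * D.ZB x * D.flux x ∂(surfaceMeasure D.Ω))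
      + ∫ t in (0 : ℝ)..τ, ∫ x in D.Ω, div D.Ω (fun y => D.P (r t y, z t y) • U t y) x := by
  have hb := hD.b₁_lt_b₂
  have hs := hΩ.isFiniteMeasure_surfaceMeasure
  have hΩc := hΩ.isCompact_closure
  have hBc := hD.uB_smooth.continuous
  have hBC : IsC1 D.T D.Ω fun _ x => D.uB x := isC1_const hD.uB_smooth
  have hpC : IsC1 D.T D.Ω fun s y => D.P (r s y, z s y) :=
    IsC1.comp₂ (hP.of_le one_le_two) htest.r_C1 htest.z_C1 htest.mem
  have hφ₁ : IsC1 D.T D.Ω fun s y => 1 / 2 * ‖U s y‖ ^ 2 - 1 / 2 * ‖D.uB y‖ ^ 2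
      - dR D.K D.H (r s y, z s y) :=
    (htest.v_C1.half_norm_sq.sub hBC.half_norm_sq).sub
      (IsC1.comp₂ (Data.contDiffOn_dR_H hb hJ₁ hJ₂ hP) htest.r_C1 htest.z_C1 htest.mem)
  have hφ₂ : IsC1 D.T D.Ω fun s y => 1 / 2 * ‖U s y‖ ^ 2 - 1 / 2 * ‖D.uB y‖ ^ 2
      - dZ D.K D.H (r s y, z s y) :=
    (htest.v_C1.half_norm_sq.sub hBC.half_norm_sq).sub
      (IsC1.comp₂ (Data.contDiffOn_dZ_H hb hJ₁ hJ₂ hP) htest.r_C1 htest.z_C1 htest.mem)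
  -- integrability on the whole lateral boundary
  have iH := Data.integrable_mul_flux hBc hs hsol.H_bdry
  have iR := Data.integrable_mul_flux hBc hs (hsol.integrable_R_lateral hΩ hD)
  have iZ := Data.integrable_mul_flux hBc hs (hsol.integrable_Z_lateral hΩ hD)
  obtain ⟨CR, hCR⟩ := hD.RB_supp.exists_bound_of_continuous hD.RB_cont
  obtain ⟨CZ, hCZ⟩ := hD.ZB_supp.exists_bound_of_continuous hD.ZB_cont
  -- The boundary densities may reach the vertex of the cone or an edge outside `slopeCone J`;
  -- boundedness of `H` there rests on the `C¹` regularity of `P` on the closed cone and on `P (0,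
  -- 0) = 0`.
  obtain ⟨CH, hCH⟩ := exists_bound_helmholtz hD.b₁_pos hb hPK hP₀ CR
  have iRB := Data.integrable_bounded_mul_flux hD hs hD.RB_cont.measurable hCR
  have iZB := Data.integrable_bounded_mul_flux hD hs hD.ZB_cont.measurable hCZ
  have iHB := Data.integrable_bounded_mul_flux (f := fun x => D.H (D.RB x, D.ZB x)) hD hs
    (measurable_helmholtz_comp hb hPK.continuousOn (hD.RB_cont.prodMk hD.ZB_cont) hD.B_mem)
    (C := CH) fun x => hCH _ (hD.B_mem x) ((le_abs_self _).trans (hCR x))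
  have i1 := Data.integrable_bounded_mul_flux (f := fun _ => (1 : ℝ)) (C := 1) hD hs
    measurable_const (by simp)
  have cm : ∀ {c f : ℝ × E d → ℝ}, ContinuousOn c (Icc 0 D.T ×ˢ closure D.Ω) →
      Integrable f ((volume.restrict (Ioo 0 D.T)).prod (surfaceMeasure D.Ω)) →
      Integrable (fun p => c p * f p)
        ((volume.restrict (Ioo 0 D.T)).prod (surfaceMeasure D.Ω)) :=
    fun hc hf => integrable_coef_mul_lateral hs hΩc hc hf
  have ip : Integrable (fun p : ℝ × E d => D.P (r p.1 p.2, z p.1 p.2) * D.flux p.2)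
      ((volume.restrict (Ioo 0 D.T)).prod (surfaceMeasure D.Ω)) := by
    simpa only [one_mul] using cm hpC.continuousOn i1
  -- the identity on one of the two parts of the boundary
  have part : ∀ {s : Set (E d)}, MeasurableSet s → s ⊆ frontier D.Ω → ∀ a c : ℝ → E d → ℝ,
      Integrable (fun p : ℝ × E d => D.H (a p.1 p.2, c p.1 p.2) * D.flux p.2)
        ((volume.restrict (Ioo 0 D.T)).prod (surfaceMeasure D.Ω)) →
      Integrable (fun p : ℝ × E d => a p.1 p.2 * D.flux p.2)
        ((volume.restrict (Ioo 0 D.T)).prod (surfaceMeasure D.Ω)) →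
      Integrable (fun p : ℝ × E d => c p.1 p.2 * D.flux p.2)
        ((volume.restrict (Ioo 0 D.T)).prod (surfaceMeasure D.Ω)) →
      ∫ t in (0 : ℝ)..τ, ∫ x in s,
        bregman D.K D.H (a t x) (c t x) (r t x) (z t x) * D.flux x ∂(surfaceMeasure D.Ω)
      = (∫ t in (0 : ℝ)..τ, ∫ x in s, D.H (a t x, c t x) * D.flux x ∂(surfaceMeasure D.Ω))
        + (∫ t in (0 : ℝ)..τ, ∫ x in s, (1 / 2 * ‖U t x‖ ^ 2 - 1 / 2 * ‖D.uB x‖ ^ 2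
            - dR D.K D.H (r t x, z t x)) * a t x * D.flux x ∂(surfaceMeasure D.Ω))
        + (∫ t in (0 : ℝ)..τ, ∫ x in s, (1 / 2 * ‖U t x‖ ^ 2 - 1 / 2 * ‖D.uB x‖ ^ 2
            - dZ D.K D.H (r t x, z t x)) * c t x * D.flux x ∂(surfaceMeasure D.Ω))
        + ∫ t in (0 : ℝ)..τ, ∫ x in s, D.P (r t x, z t x) * D.flux x ∂(surfaceMeasure D.Ω) := by
    intro s hsm hsub a c iHac ia ic
    have k1 : HasIterInt ((surfaceMeasure D.Ω).restrict s) D.T τ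
        (fun t x => D.H (a t x, c t x) * D.flux x) _ :=
      ⟨integrable_prod_restrict_right iHac s, rfl⟩
    have k2 : HasIterInt ((surfaceMeasure D.Ω).restrict s) D.T τ
        (fun t x => (1 / 2 * ‖U t x‖ ^ 2 - 1 / 2 * ‖D.uB x‖ ^ 2
            - dR D.K D.H (r t x, z t x)) * a t x * D.flux x) _ :=
      ⟨integrable_prod_restrict_right ((cm hφ₁.continuousOn ia).congr
        (ae_of_all _ fun p => (mul_assoc _ _ _).symm)) s, rfl⟩
    have k3 : HasIterInt ((surfaceMeasure D.Ω).restrict s) D.T τ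
        (fun t x => (1 / 2 * ‖U t x‖ ^ 2 - 1 / 2 * ‖D.uB x‖ ^ 2
            - dZ D.K D.H (r t x, z t x)) * c t x * D.flux x) _ :=
      ⟨integrable_prod_restrict_right ((cm hφ₂.continuousOn ic).congr
        (ae_of_all _ fun p => (mul_assoc _ _ _).symm)) s, rfl⟩
    have k4 : HasIterInt ((surfaceMeasure D.Ω).restrict s) D.T τ
        (fun t x => D.P (r t x, z t x) * D.flux x) _ :=
      ⟨integrable_prod_restrict_right ip s, rfl⟩
    have k := ((k1.add hτ k2).add hτ k3).add hτ k4
    have hae : ∀ᵐ p ∂((volume.restrict (Ioo 0 D.T)).prod ((surfaceMeasure D.Ω).restrict s)),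
        D.H (a p.1 p.2, c p.1 p.2) * D.flux p.2
          + (1 / 2 * ‖U p.1 p.2‖ ^ 2 - 1 / 2 * ‖D.uB p.2‖ ^ 2
            - dR D.K D.H (r p.1 p.2, z p.1 p.2)) * a p.1 p.2 * D.flux p.2
          + (1 / 2 * ‖U p.1 p.2‖ ^ 2 - 1 / 2 * ‖D.uB p.2‖ ^ 2
            - dZ D.K D.H (r p.1 p.2, z p.1 p.2)) * c p.1 p.2 * D.flux p.2
          + D.P (r p.1 p.2, z p.1 p.2) * D.flux p.2
        = bregman D.K D.H (a p.1 p.2) (c p.1 p.2) (r p.1 p.2) (z p.1 p.2) * D.flux p.2 := by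
      filter_upwards [ae_mem_lateral hs hsm hsub] with p hp
      have ht := Ioo_subset_Icc_self hp.1
      rw [Data.bregman_H hb hJ₁ hJ₂ hP (htest.mem _ ht _ (frontier_subset_closure hp.2)),
        htest.v_bdry _ ht _ hp.2]
      ring
    exact (HasIterInt.eq_of_ae hτ k (g := fun t x =>
      bregman D.K D.H (a t x) (c t x) (r t x) (z t x) * D.flux x) ⟨k.1.congr hae, rfl⟩ hae).symm
  rw [part (Data.measurableSet_outflow hBc) sdiff_subset R Z iH iR iZ,
    part (Data.measurableSet_inflow hBc) (fun x hx => hx.1) (fun _ x => D.RB x)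
      (fun _ x => D.ZB x) iHB iRB iZB]
  -- the pressure flux through the whole boundary
  have hpress : (∫ t in (0 : ℝ)..τ, ∫ x in D.outflow,
        D.P (r t x, z t x) * D.flux x ∂(surfaceMeasure D.Ω))
      + (∫ t in (0 : ℝ)..τ, ∫ x in D.inflow,
        D.P (r t x, z t x) * D.flux x ∂(surfaceMeasure D.Ω))
      = ∫ t in (0 : ℝ)..τ, ∫ x in D.Ω, div D.Ω (fun y => D.P (r t y, z t y) • U t y) x := by
    have hii : ∀ s : Set (E d), IntervalIntegrable (fun t => ∫ x in s,
        D.P (r t x, z t x) * D.flux x ∂(surfaceMeasure D.Ω)) volume 0 τ := fun s => by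
      rw [intervalIntegrable_iff_integrableOn_Ioo_of_le hτ.1]
      exact (integrable_prod_restrict_mono (integrable_prod_restrict_right ip s)
        hτ.2).integral_prod_left
    rw [← intervalIntegral.integral_add (hii _) (hii _)]
    refine intervalIntegral.integral_congr_ae ?_
    rw [uIoc_of_le hτ.1]
    have hsl := ip.prod_right_ae
    rw [ae_restrict_iff' measurableSet_Ioo] at hsl
    -- When `τ = T` the half-open interval of integration contains the final time, about which the
    -- slice statement says nothing; a single time is negligible.
    have hneT : ∀ᵐ t : ℝ, t ≠ D.T := by simp [ae_iff, measure_singleton]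
    filter_upwards [hsl, hneT] with t hint hne ht
    have htT : t ∈ Ioo 0 D.T := ⟨ht.1, lt_of_le_of_ne (ht.2.trans hτ.2) hne⟩
    have htI := Ioo_subset_Icc_self htT
    rw [Data.integral_outflow_add_inflow hBc (hint htT)]
    exact (integral_div_smul_eq_flux hΩ (hpC.slice htI) (htest.v_C1.slice htI)
      (htest.v_bdry t htI)).symm
  linear_combination hpress

end BoundaryIntegral

end Bifluid

end

/-! ### The relative energy inequality -/

theorem mainTheorem3 {d : ℕ} (hd : d = 2 ∨ d = 3) (D : Bifluid.Data d) (hD : D.Admissible)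
    (hΩ : Bifluid.IsBoundedLipschitzDomain D.Ω)
    (J : Set ℝ) (hJ₁ : Set.Ioo D.b₁ D.b₂ ⊆ J) (hJ₂ : J ⊆ Set.Icc D.b₁ D.b₂)
    (hP₁ : ContDiffOn ℝ 1 D.P D.K)
    (hP₂ : ContDiffOn ℝ 2 D.P (Bifluid.slopeCone J))
    (hP₀ : D.P (0, 0) = 0)
    (γ : ℝ) (R Z : ℝ → Bifluid.E d → ℝ) (u : ℝ → Bifluid.E d → Bifluid.E d)
    (Du : ℝ → Bifluid.E d → Bifluid.Mat d) (m : ℝ → Bifluid.E d → Bifluid.E d)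
    (Rey : ℝ → Fin d → Fin d → SignedMeasure (Bifluid.E d))
    (En : ℝ → Measure (Bifluid.E d))
    (hsol : Bifluid.IsDissipativeTurbulentSolution D γ R Z u Du m Rey En)
    (𝔯 𝔷 : ℝ → Bifluid.E d → ℝ) (𝔲 : ℝ → Bifluid.E d → Bifluid.E d)
    (htest : Bifluid.IsTestTriple D (Bifluid.slopeCone J) 𝔯 𝔷 𝔲) :
    IntegrableOn
      (fun x => D.relEnergy (D.R0 x) (D.Z0 x) (D.u0 x) (𝔯 0 x) (𝔷 0 x) (𝔲 0 x)) D.Ω ∧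
    ∀ᵐ τ ∂(volume.restrict (Set.Ioo 0 D.T)),
      IntegrableOn
        (fun x => D.relEnergy (R τ x) (Z τ x) (u τ x) (𝔯 τ x) (𝔷 τ x) (𝔲 τ x)) D.Ω ∧
      (∫ x in D.Ω, D.relEnergy (R τ x) (Z τ x) (u τ x) (𝔯 τ x) (𝔷 τ x) (𝔲 τ x))
        - (∫ x in D.Ω,
            D.relEnergy (D.R0 x) (D.Z0 x) (D.u0 x) (𝔯 0 x) (𝔷 0 x) (𝔲 0 x))
        + (∫ t in (0 : ℝ)..τ, ∫ x in D.Ω,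
            Bifluid.frob (D.S (Du t x)) (Du t x - Bifluid.jac D.Ω (𝔲 t) x))
        + (∫ t in (0 : ℝ)..τ, ∫ x in D.outflow,
            Bifluid.bregman D.K D.H (R t x) (Z t x) (𝔯 t x) (𝔷 t x) * D.flux x
              ∂(Bifluid.surfaceMeasure D.Ω))
        + (∫ t in (0 : ℝ)..τ, ∫ x in D.inflow,
            Bifluid.bregman D.K D.H (D.RB x) (D.ZB x) (𝔯 t x) (𝔷 t x) * D.flux x
              ∂(Bifluid.surfaceMeasure D.Ω))
        + (En τ).real (closure D.Ω)
      ≤ - (∫ t in (0 : ℝ)..τ, ∫ x in D.Ω,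
            (R t x + Z t x)
              * Bifluid.convect (𝔲 t x - u t x) (Bifluid.jac D.Ω (𝔲 t) x) (𝔲 t x - u t x))
        - (∫ t in (0 : ℝ)..τ, ∫ x in D.Ω,
            Bifluid.bregman D.K D.P (R t x) (Z t x) (𝔯 t x) (𝔷 t x)
              * Bifluid.div D.Ω (𝔲 t) x)
        + (∫ t in (0 : ℝ)..τ, ∫ x in D.Ω,
            ((R t x + Z t x) / (𝔯 t x + 𝔷 t x) - 1)
              * inner ℝ (𝔲 t x - u t x) (Bifluid.momentumResidual D 𝔯 𝔷 𝔲 t x))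
        + (∫ t in (0 : ℝ)..τ, ∫ x in D.Ω,
            inner ℝ (𝔲 t x - u t x)
              (Bifluid.momentumResidual D 𝔯 𝔷 𝔲 t x
                + Bifluid.grad D.Ω (fun y => D.P (𝔯 t y, 𝔷 t y)) x))
        + (∫ t in (0 : ℝ)..τ, ∫ x in D.Ω,
            (R t x - 𝔯 t x) * inner ℝ (𝔲 t x - u t x)
              (Bifluid.dR D.K (Bifluid.dR D.K D.H) (𝔯 t x, 𝔷 t x)
                  • Bifluid.grad D.Ω (𝔯 t) x
                + Bifluid.dR D.K (Bifluid.dZ D.K D.H) (𝔯 t x, 𝔷 t x)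
                  • Bifluid.grad D.Ω (𝔷 t) x))
        + (∫ t in (0 : ℝ)..τ, ∫ x in D.Ω,
            (Z t x - 𝔷 t x) * inner ℝ (𝔲 t x - u t x)
              (Bifluid.dZ D.K (Bifluid.dZ D.K D.H) (𝔯 t x, 𝔷 t x)
                  • Bifluid.grad D.Ω (𝔷 t) x
                + Bifluid.dR D.K (Bifluid.dZ D.K D.H) (𝔯 t x, 𝔷 t x)
                  • Bifluid.grad D.Ω (𝔯 t) x))
        + (∫ t in (0 : ℝ)..τ, ∫ x in D.Ω,
            ((R t x + Z t x) / (𝔯 t x + 𝔷 t x) * inner ℝ (u t x - 𝔲 t x) (𝔲 t x)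
                + Bifluid.dR D.K D.P (𝔯 t x, 𝔷 t x)
                - R t x * Bifluid.dR D.K (Bifluid.dR D.K D.H) (𝔯 t x, 𝔷 t x)
                - Z t x * Bifluid.dR D.K (Bifluid.dZ D.K D.H) (𝔯 t x, 𝔷 t x))
              * Bifluid.massResidual D 𝔯 𝔲 t x)
        + (∫ t in (0 : ℝ)..τ, ∫ x in D.Ω,
            ((R t x + Z t x) / (𝔯 t x + 𝔷 t x) * inner ℝ (u t x - 𝔲 t x) (𝔲 t x)
                + Bifluid.dZ D.K D.P (𝔯 t x, 𝔷 t x)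
                - Z t x * Bifluid.dZ D.K (Bifluid.dZ D.K D.H) (𝔯 t x, 𝔷 t x)
                - R t x * Bifluid.dR D.K (Bifluid.dZ D.K D.H) (𝔯 t x, 𝔷 t x))
              * Bifluid.massResidual D 𝔷 𝔲 t x)
        - ∫ t in (0 : ℝ)..τ, Bifluid.pairing D.Ω (Bifluid.jac D.Ω (𝔲 t)) (Rey t) := by
  have hT := hD.T_pos
  have hb := hD.b₁_lt_b₂
  have hc := hΩ.isCompact_closure
  have hu := hΩ.uniqueDiffOn
  have hUC := htest.v_C1
  have hBC : Bifluid.IsC1 D.T D.Ω fun _ x => D.uB x := Bifluid.isC1_const hD.uB_smooth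
  have hpC : Bifluid.IsC1 D.T D.Ω fun s y => D.P (𝔯 s y, 𝔷 s y) :=
    Bifluid.IsC1.comp₂ (hP₂.of_le one_le_two) htest.r_C1 htest.z_C1 htest.mem
  have hh₁ : Bifluid.IsC1 D.T D.Ω fun s y => Bifluid.dR D.K D.H (𝔯 s y, 𝔷 s y) :=
    Bifluid.IsC1.comp₂ (Bifluid.Data.contDiffOn_dR_H hb hJ₁ hJ₂ hP₂) htest.r_C1 htest.z_C1
      htest.mem
  have hh₂ : Bifluid.IsC1 D.T D.Ω fun s y => Bifluid.dZ D.K D.H (𝔯 s y, 𝔷 s y) :=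
    Bifluid.IsC1.comp₂ (Bifluid.Data.contDiffOn_dZ_H hb hJ₁ hJ₂ hP₂) htest.r_C1 htest.z_C1
      htest.mem
  have hBU := hUC.half_norm_sq.sub hBC.half_norm_sq
  have hφ := hBC.sub hUC
  have hbreg : ∀ t ∈ Icc 0 D.T, ∀ x ∈ D.Ω, ∀ a c, Bifluid.bregman D.K D.H a c (𝔯 t x) (𝔷 t x)
      = D.H (a, c) - Bifluid.dR D.K D.H (𝔯 t x, 𝔷 t x) * a
        - Bifluid.dZ D.K D.H (𝔯 t x, 𝔷 t x) * c + D.P (𝔯 t x, 𝔷 t x) := fun t ht x hx =>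
    Bifluid.Data.bregman_H hb hJ₁ hJ₂ hP₂ (htest.mem t ht x (subset_closure hx))
  have h0 : (0 : ℝ) ∈ Icc 0 D.T := ⟨le_rfl, hT.le⟩
  have hvol := hΩ.volume_ne_top
  -- At the initial time the momentum is taken to be `(R₀ + Z₀) u₀` itself. Integrability of the
  -- initial data is inherited from the weakly continuous representatives at `t = 0`.
  have hinit := Bifluid.integral_relEnergy_eq hΩ hD (R := D.R0) (Z := D.Z0) (u := D.u0)
    (m := fun x => (D.R0 x + D.Z0 x) • D.u0 x) (U := 𝔲 0)
    ((hsol.R_weak.integrable_slice hsol.one_lt_gamma.le hvol h0).congr hsol.init_R)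
    ((hsol.Z_weak.integrable_slice hsol.one_lt_gamma.le hvol h0).congr hsol.init_Z)
    ((hsol.integrable_m_slice hΩ h0).congr hsol.init_m) (ae_of_all _ fun _ => rfl)
    hD.finite_energy (hUC.slice h0).continuousOn (hh₁.slice h0).continuousOn
    (hh₂.slice h0).continuousOn (hpC.slice h0).continuousOn (hbreg 0 h0)
  refine ⟨hinit.1, ?_⟩
  filter_upwards [hsol.energy, hsol.integrable_energyDensity_slice, hsol.m_eq,
    ae_restrict_mem measurableSet_Ioo] with τ henergy hslice hm hτo
  have hτ := Ioo_subset_Icc_self hτo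
  have hfinal := Bifluid.integral_relEnergy_eq hΩ hD (R := R τ) (Z := Z τ) (u := u τ)
    (m := m τ) (U := 𝔲 τ)
    (hsol.R_weak.integrable_slice hsol.one_lt_gamma.le hvol hτ)
    (hsol.Z_weak.integrable_slice hsol.one_lt_gamma.le hvol hτ)
    (hsol.integrable_m_slice hΩ hτ) hm hslice (hUC.slice hτ).continuousOn
    (hh₁.slice hτ).continuousOn (hh₂.slice hτ).continuousOn (hpC.slice hτ).continuousOn
    (hbreg τ hτ)
  refine ⟨hfinal.1, ?_⟩
  -- The two velocities agree on the boundary, so their difference is an admissible test field. The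
  -- next two lines test the continuity equations with the coefficients of `R` and `Z` in the
  -- decomposition of the relative energy.
  have hmom := hsol.momentum (fun t x => D.uB x - 𝔲 t x) hφ
    (fun t ht x hx => by simp only [htest.v_bdry t ht x hx, sub_self]) τ hτ
  have hconR := hsol.continuity_R _ (hBU.sub hh₁) τ hτ
  have hconZ := hsol.continuity_Z _ (hBU.sub hh₂) τ hτ
  have hftc := Bifluid.integral_sub_eq_integral_dt hΩ hT hpC hτ
  have hint := Bifluid.interior_identity hd hD hΩ hJ₁ hJ₂ hP₂ hsol htest hτ
  have hbdry := Bifluid.boundary_identity hD hΩ hJ₁ hJ₂ hP₁ hP₀ hP₂ hsol htest hτ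
  -- Linearity of the defect term: the part with `u_B` cancels the one in the energy inequality,
  -- leaving the pairing with the gradient of the test velocity.
  have hpair : ∫ t in (0 : ℝ)..τ,
        Bifluid.pairing D.Ω (Bifluid.jac D.Ω fun x => D.uB x - 𝔲 t x) (Rey t)
      = (∫ t in (0 : ℝ)..τ, Bifluid.pairing D.Ω (Bifluid.jac D.Ω D.uB) (Rey t))
        - ∫ t in (0 : ℝ)..τ, Bifluid.pairing D.Ω (Bifluid.jac D.Ω (𝔲 t)) (Rey t) := by
    have hcB := hBC.continuousOn_jac hT hu
    have hcU := hUC.continuousOn_jac hT hu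
    have hii : ∀ f : ℝ → ℝ, Integrable f (volume.restrict (Ioo 0 D.T)) →
        IntervalIntegrable f volume 0 τ := fun f hf => by
      rw [intervalIntegrable_iff_integrableOn_Ioo_of_le hτ.1]
      exact IntegrableOn.mono_set hf (Ioo_subset_Ioo_right hτ.2)
    rw [← intervalIntegral.integral_sub
      (hii _ (hsol.tensorDefect.integrable_pairing hc hcB))
      (hii _ (hsol.tensorDefect.integrable_pairing hc hcU))]
    refine intervalIntegral.integral_congr fun t ht => ?_
    rw [uIcc_of_le hτ.1] at ht
    have htT : t ∈ Icc 0 D.T := ⟨ht.1, ht.2.trans hτ.2⟩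
    have hslc : ∀ {A : ℝ → Bifluid.E d → Bifluid.Mat d} (i j : Fin d),
        ContinuousOn (fun p : ℝ × Bifluid.E d => A p.1 p.2 i j) (Icc 0 D.T ×ˢ closure D.Ω) →
        ContinuousOn (fun x => A t x i j) (closure D.Ω) := fun i j hA =>
      hA.comp (f := fun x : Bifluid.E d => (t, x)) (by fun_prop) fun x hx => ⟨htT, hx⟩
    have hsub := Bifluid.pairing_sub (A := Bifluid.jac D.Ω D.uB) (B := Bifluid.jac D.Ω (𝔲 t)) hc
      (fun i j => hslc (A := fun _ => Bifluid.jac D.Ω D.uB) i j (hcB i j))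
      (fun i j => hslc (A := fun t => Bifluid.jac D.Ω (𝔲 t)) i j (hcU i j)) (Rey t)
    refine Eq.trans ?_ hsub
    exact Bifluid.pairing_congr (fun x hx => Bifluid.jac_sub_eq hT hu hBC hUC htT hx) _
  have hi := hinit.2
  have hf := hfinal.2
  rw [hpair] at hmom
  -- The energy inequality plus the tested equations, the time derivative of the pressure and the
  -- two identities; everything is linear in the integrals.
  linarith
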